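/- Let $K$ be a field and $G$ a finite group; all $KG$-modules are finite-dimensional. The Green ring $a(KG)$ is generated as an abelian group by the isomorphism classes $[M]$ of $KG$-modules subject to $[A\oplus B]=[A]+[B]$, with product $[A][B]=[A\otimes_K B]$. A module $M$ is \emph{algebraic} if $[M]$ is a root of a non-zero polynomial with integer coefficients. Let $\Omega^0(M)$ be the projective-free part of $M$ (so $M\cong\Omega^0(M)\oplus P$ with $P$ projective and $\Omega^0(M)$ without non-zero projective summands), let $\Omega(M)$ be the kernel of a projective cover of $M$, $\Omega^{-1}(M)$ the cokernel of an injective hull of $M$, and let $\Omega^{n}$, $\Omega^{-n}$ ($n\ge 1$) be the iterates of $\Omega$, $\Omega^{-1}$. Call $M$ \emph{periodic} if $\Omega^n(M)\cong\Omega^0(M)$ for some $n>0$ (so projective modules count as periodic), and \emph{self-dual} if $M\cong M^*$. \textbf{Theorem.} Let $M$ be a $KG$-module. \begin{enumerate} \item If $M$ is periodic and algebraic, then $\Omega^i(M)$ is algebraic for every $i\in\mathbb Z$. \item If $M$ is non-periodic, then $\Omega^i(M)$ is algebraic for at most one $i\in\mathbb Z$. If $M$ is moreover algebraic, then $\Omega^i(M)$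 is algebraic exactly for $i=0$. If $M$ is non-periodic and self-dual and $\Omega^i(M)$ is algebraic, then $i=0$ and $M$ is algebraic. \end{enumerate} Furthermore, all possibilities occur. Let $K$ be any field of characteristic $2$. \begin{enumerate} \item[(a)] The trivial module $K$ of the quaternion group $Q_8$ is periodic, and all $\Omega^i(K)$ are algebraic. \item[(b)] The trivial module $K$ of the four-group $V_4$ is non-periodic, and $\Omega^i(K)$ is algebraic if and only if $i=0$. \item[(c)] There is a surjective homomorphism $Q_8\to V_4$ such that, for every $i\neq 0$, the $KV_4$-module $\Omega^i(K)$, viewed as a $KQ_8$-module $N$, is indecomposable and periodic, and no $\Omega^j(N)$ ($j\in\mathbb Z$) is algebraic. \item[(d)] For every dihedral group $D$ of order $2^{m+1}$ with $m\ge 2$ there is an indecomposable non-periodic $KD$-module $M$ such that no $\Omega^i(M)$ ($i\in\mathbb Z$) is algebraic, and there is an indecomposable, self-dual, non-periodic, algebraic $KD$-module. \end{enumerate} -/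

import Mathlib

open CategoryTheory Limits MonoidalCategory
universe u v w

/-! ### Projective covers and injective hulls -/

/-- `f : P ⟶ M` is a projective cover: `P` is projective and `f` is an essential epimorphism. -/
structure IsProjectiveCover {C : Type u} [Category.{v} C] {P M : C} (f : P ⟶ M) : Prop where
  projective : Projective P
  epi : Epi f
  essential : ∀ {X : C} (g : X ⟶ P), Epi (g ≫ f) → Epi g

/-- `f : M ⟶ I` is an injective hull: `I` is injective and `f` is an essential monomorphism. -/
structure IsInjectiveHull {C : Type u} [Category.{v} C] {M I : C} (f : M ⟶ I) : Prop where
  injective : Injective I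
  mono : Mono f
  essential : ∀ {X : C} (g : I ⟶ X), Mono (f ≫ g) → Mono g

/-- Projective covers exist in an abelian category with enough projectives and a suitable
dimension function. -/
theorem exists_isProjectiveCover {C : Type u} [Category.{v} C] [Abelian C] [EnoughProjectives C]
    (d : C → ℕ)
    (hmono : ∀ {X Y : C} (f : X ⟶ Y) [Mono f], d X ≤ d Y ∧ (d Y ≤ d X → IsIso f))
    (hepi : ∀ {X Y : C} (f : X ⟶ Y) [Epi f], d X ≤ d Y → IsIso f) (M : C) :
    ∃ (P : C) (f : P ⟶ M), IsProjectiveCover f := by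
  classical
  have hne : ∃ n, ∃ (P : C) (f : P ⟶ M), Projective P ∧ Epi f ∧ d P = n :=
    ⟨_, Projective.over M, Projective.π M, inferInstance, inferInstance, rfl⟩
  obtain ⟨P, f, hP, hf, hd⟩ := Nat.find_spec hne
  have hmin : ∀ (Q : C) (q : Q ⟶ M), Projective Q → Epi q → d P ≤ d Q := fun Q q h1 h2 => by
    rw [hd]; exact Nat.find_min' hne ⟨Q, q, h1, h2, rfl⟩
  refine ⟨P, f, hP, hf, fun {X} g hg => ?_⟩
  let φ : End P := Projective.factorThru f (g ≫ f) ≫ g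
  have hφ : φ ≫ f = f := by
    simp only [φ, Category.assoc]; exact Projective.factorThru_comp f (g ≫ f)
  have hpow : ∀ n : ℕ, (φ ^ n : End P) ≫ f = f := by
    intro n
    induction n with
    | zero => simp [End.one_def]
    | succ n ih =>
      rw [pow_succ, End.mul_def, Category.assoc, ih, hφ]
  have hfac : ∀ {X Y : C} (x : X ⟶ Y), ∃ (I : C) (e : X ⟶ I) (i : I ⟶ Y), Epi e ∧ Mono i ∧ e ≫ i = x :=
    fun x => ⟨_, factorThruImage x, image.ι x, inferInstance, inferInstance, image.fac x⟩
  have hne2 : ∃ n, ∃ (k : ℕ) (I : C) (e : P ⟶ I) (i : I ⟶ P),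
      Epi e ∧ Mono i ∧ e ≫ i = (φ ^ (k + 1) : End P) ∧ d I = n := by
    obtain ⟨I, e, i, h1, h2, h3⟩ := hfac (φ ^ (0 + 1) : End P)
    exact ⟨_, 0, I, e, i, h1, h2, h3, rfl⟩
  obtain ⟨k, I, e, i, he, hi, hei, hk⟩ := Nat.find_spec hne2
  obtain ⟨J, a, b, ha, hb, hab⟩ : ∃ (J : C) (a : I ⟶ J) (b : J ⟶ I),
      Epi a ∧ Mono b ∧ a ≫ b = i ≫ e := hfac (i ≫ e)
  have h1 : d I ≤ d J := by
    rw [hk]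
    refine Nat.find_min' hne2 ⟨2 * k + 1, J, e ≫ a, b ≫ i, epi_comp _ _, mono_comp _ _, ?_, rfl⟩
    rw [show (2 * k + 1) + 1 = (k + 1) + (k + 1) by ring, pow_add, End.mul_def, ← hei,
      Category.assoc, reassoc_of% hab, Category.assoc]
  have hb' : IsIso b := (hmono b).2 h1
  have hie : Epi (i ≫ e) := by rw [← hab]; exact epi_comp _ _
  have hie' : IsIso (i ≫ e) := hepi (i ≫ e) le_rfl
  have hQ : Projective I :=
    Retract.projective (Y := P) ⟨i, e ≫ inv (i ≫ e), by
      rw [← Category.assoc, IsIso.hom_inv_id]⟩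
  have hif : Epi (i ≫ f) := by
    have h : e ≫ (i ≫ f) = f := by rw [← Category.assoc, hei]; exact hpow _
    rw [← h] at hf
    exact epi_of_epi e _
  have hi' : IsIso i := (hmono i).2 (hmin _ (i ≫ f) hQ hif)
  have hψ : Epi (e ≫ i) := epi_comp _ _
  rw [hei, pow_succ', End.mul_def, ← Category.assoc] at hψ
  exact @epi_of_epi _ _ _ _ _ _ g hψ

/-! ### Finite-dimensional `KG`-modules

`FDRep K G` is the category of finite-dimensional `KG`-modules. For a finite group `G` its projective
(injective) objects are the finite-dimensional projective (injective) modules over the group algebra.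
-/

namespace FDRep

variable {K : Type u} [Field K] {G : Type v} [Group G]

/-- The morphism given by an equivariant linear map. -/
noncomputable def homOf {V W : FDRep K G} (l : V →ₗ[K] W) (h : ∀ g v, l (V.ρ g v) = W.ρ g (l v)) : V ⟶ W where
  hom := FGModuleCat.ofHom l
  comm g := by
    ext v
    exact h g v

/-- The linear map underlying a morphism. -/
def lin {V W : FDRep K G} (f : V ⟶ W) : V →ₗ[K] W := f.hom.hom.hom

theorem lin_comm {V W : FDRep K G} (f : V ⟶ W) (g : G) (v : V) :
    lin f (V.ρ g v) = W.ρ g (lin f v) := by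
  have := congrArg (fun t => t.hom.hom v) (f.comm g)
  exact this

theorem lin_comp {V W X : FDRep K G} (f : V ⟶ W) (g : W ⟶ X) (v : V) :
    lin (f ≫ g) v = lin g (lin f v) := rfl

theorem lin_ext {V W : FDRep K G} {f g : V ⟶ W} (h : ∀ v, lin f v = lin g v) : f = g := by
  apply Action.Hom.ext
  ext v
  exact h v

theorem lin_injective {V W : FDRep K G} (f : V ⟶ W) [Mono f] : Function.Injective (lin f) := by
  have h : Mono ((Action.forget _ _ ⋙ forget₂ (FGModuleCat K) (ModuleCat K)).map f) :=
    inferInstance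
  exact (ModuleCat.mono_iff_injective _).1 h

theorem lin_surjective {V W : FDRep K G} (f : V ⟶ W) [Epi f] : Function.Surjective (lin f) := by
  have h : Epi ((Action.forget _ _ ⋙ forget₂ (FGModuleCat K) (ModuleCat K)).map f) :=
    inferInstance
  exact (ModuleCat.epi_iff_surjective _).1 h

theorem epi_of_surj {V W : FDRep K G} (f : V ⟶ W) (h : Function.Surjective (lin f)) : Epi f := by
  constructor
  intro Z a b hab
  refine lin_ext fun w => ?_
  obtain ⟨v, rfl⟩ := h w
  rw [← lin_comp, ← lin_comp, hab]

theorem mono_of_inj {V W : FDRep K G} (f : V ⟶ W) (h : Function.Injective (lin f)) : Mono f := by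
  constructor
  intro Z a b hab
  refine lin_ext fun w => h ?_
  rw [← lin_comp, ← lin_comp, hab]

theorem mono_dim {X Y : FDRep K G} (f : X ⟶ Y) [Mono f] :
    Module.finrank K X ≤ Module.finrank K Y ∧
      (Module.finrank K Y ≤ Module.finrank K X → IsIso f) := by
  have hi := lin_injective f
  refine ⟨LinearMap.finrank_le_finrank_of_injective hi, fun h => ?_⟩
  have h' := le_antisymm h (LinearMap.finrank_le_finrank_of_injective hi)
  have : Epi f := epi_of_surj f ((LinearMap.injective_iff_surjective_of_finrank_eq_finrank
    h'.symm).1 hi)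
  exact isIso_of_mono_of_epi f

theorem epi_dim {X Y : FDRep K G} (f : X ⟶ Y) [Epi f] :
    Module.finrank K Y ≤ Module.finrank K X ∧
      (Module.finrank K X ≤ Module.finrank K Y → IsIso f) := by
  have hi := lin_surjective f
  refine ⟨LinearMap.finrank_le_finrank_of_surjective hi, fun h => ?_⟩
  have h' := le_antisymm h (LinearMap.finrank_le_finrank_of_surjective hi)
  have : Mono f := mono_of_inj f ((LinearMap.injective_iff_surjective_of_finrank_eq_finrank
    h').2 hi)
  exact isIso_of_mono_of_epi f

/-- Functions `G → V` with `G` acting by right translation, where `G` is identified with `Fin n`. -/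
def coindRep (n : ℕ) (e : G ≃ Fin n) (V : Type u) [AddCommGroup V] [Module K V] :
    Representation K G (Fin n → V) where
  toFun g := LinearMap.funLeft K V (fun i => e (e.symm i * g))
  map_one' := by ext; simp [LinearMap.funLeft]
  map_mul' g h := by ext; simp [LinearMap.funLeft, mul_assoc]

theorem coindRep_apply (n : ℕ) (e : G ≃ Fin n) (V : Type u) [AddCommGroup V] [Module K V]
    (g : G) (x : Fin n → V) (i : Fin n) :
    coindRep (K := K) n e V g x i = x (e (e.symm i * g)) := rfl

/-- The module of functions `G → V`, for a module `V`. -/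
noncomputable abbrev coindObj (n : ℕ) (e : G ≃ Fin n) (V : FDRep K G) : FDRep K G :=
  FDRep.of (coindRep (K := K) n e V)

theorem injective_coindObj (n : ℕ) (e : G ≃ Fin n) (V : FDRep K G) :
    Injective (coindObj n e V) := by
  constructor
  intro X Y u i hi
  obtain ⟨r, hr⟩ := (lin i).exists_leftInverse_of_injective
    (LinearMap.ker_eq_bot.2 (lin_injective i))
  let t : Y →ₗ[K] V := (LinearMap.proj (e 1)).comp ((lin u).comp r)
  refine ⟨homOf (W := coindObj n e V) (LinearMap.pi fun j => t.comp (Y.ρ (e.symm j))) ?_, ?_⟩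
  · intro g y
    funext j
    change t (Y.ρ (e.symm j) (Y.ρ g y)) = t (Y.ρ (e.symm (e (e.symm j * g))) y)
    simp
  · refine lin_ext fun x => ?_
    funext j
    change lin u (r (Y.ρ (e.symm j) (lin i x))) (e 1) = lin u x j
    rw [← lin_comm]
    have := LinearMap.congr_fun hr (X.ρ (e.symm j) x)
    simp only [LinearMap.comp_apply, LinearMap.id_apply] at this
    rw [this, lin_comm]
    change coindRep n e V (e.symm j) (lin u x) (e 1) = _
    rw [coindRep_apply]
    simp

theorem projective_coindObj (n : ℕ) (e : G ≃ Fin n) (V : FDRep K G) :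
    Projective (coindObj n e V) := by
  classical
  constructor
  intro X Y u p hp
  obtain ⟨r, hr⟩ := (lin p).exists_rightInverse_of_surjective
    (LinearMap.range_eq_top.2 (lin_surjective p))
  let s : V →ₗ[K] X := r.comp ((lin u).comp (LinearMap.single K (fun _ => V) (e 1)))
  let l : (Fin n → V) →ₗ[K] X :=
    ∑ j, (X.ρ (e.symm j)⁻¹).comp (s.comp (LinearMap.proj j))
  have hl : ∀ x, l x = ∑ j, X.ρ (e.symm j)⁻¹ (s (x j)) := fun x => by
    simp [l, LinearMap.sum_apply]
  refine ⟨homOf (V := coindObj n e V) l ?_, ?_⟩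
  · intro g x
    change l (coindRep n e V g x) = X.ρ g (l x)
    rw [hl, hl, map_sum]
    refine Fintype.sum_equiv ((e.symm.trans (Equiv.mulRight g)).trans e) _ _ fun j => ?_
    rw [coindRep_apply, ← Module.End.mul_apply, ← map_mul]
    simp
  · refine lin_ext fun x => ?_
    change lin p (l x) = lin u x
    rw [hl, map_sum]
    have h1 : ∀ j, lin p (X.ρ (e.symm j)⁻¹ (s (x j))) = lin u (Pi.single j (x j)) := by
      intro j
      rw [lin_comm]
      have := LinearMap.congr_fun hr (lin u (Pi.single (e 1) (x j)))
      simp only [LinearMap.comp_apply, LinearMap.id_apply] at this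
      change Y.ρ (e.symm j)⁻¹ (lin p (r (lin u (Pi.single (e 1) (x j))))) = _
      rw [this, ← lin_comm]
      congr 1
      funext i
      change coindRep n e V (e.symm j)⁻¹ (Pi.single (e 1) (x j)) i = _
      rw [coindRep_apply]
      by_cases hij : i = j
      · subst hij; simp
      · have : e (e.symm i * (e.symm j)⁻¹) ≠ e 1 := by
          intro h
          exact hij (e.symm.injective (mul_inv_eq_one.1 (e.injective h)))
        rw [Pi.single_eq_of_ne this, Pi.single_eq_of_ne hij]
    simp_rw [h1]
    rw [← map_sum, Finset.univ_sum_single]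

variable [Finite G]

instance : EnoughProjectives (FDRep K G) where
  presentation V := by
    obtain ⟨n, ⟨e⟩⟩ := Finite.exists_equiv_fin G
    let l : (Fin n → V) →ₗ[K] V := ∑ j, (V.ρ (e.symm j)⁻¹).comp (LinearMap.proj j)
    have hl : ∀ x, l x = ∑ j, V.ρ (e.symm j)⁻¹ (x j) := fun x => by
      simp [l, LinearMap.sum_apply]
    have hc : ∀ (g : G) (x : Fin n → V), l (coindRep (K := K) n e V g x) = V.ρ g (l x) := by
      intro g x
      rw [hl, hl, map_sum]
      refine Fintype.sum_equiv ((e.symm.trans (Equiv.mulRight g)).trans e) _ _ fun j => ?_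
      rw [coindRep_apply, ← Module.End.mul_apply, ← map_mul]
      simp
    refine ⟨{ p := coindObj n e V, projective := projective_coindObj n e V,
              f := homOf (V := coindObj n e V) l hc, epi := ?_ }⟩
    refine epi_of_surj _ fun v => ⟨(Pi.single (e 1) v : Fin n → V), ?_⟩
    change l (Pi.single (e 1) v) = v
    rw [hl, Finset.sum_eq_single (e 1)]
    · simp
    · intro j _ hj
      simp [Pi.single_eq_of_ne hj]
    · simp

instance : EnoughInjectives (FDRep K G) where
  presentation V := by
    obtain ⟨n, ⟨e⟩⟩ := Finite.exists_equiv_fin G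
    let l : V →ₗ[K] (Fin n → V) := LinearMap.pi fun j => V.ρ (e.symm j)
    refine ⟨⟨coindObj n e V, injective_coindObj n e V, homOf (W := coindObj n e V) l ?_, ?_⟩⟩
    · intro g v
      funext j
      change V.ρ (e.symm j) (V.ρ g v) = V.ρ (e.symm (e (e.symm j * g))) v
      simp
    · refine mono_of_inj _ fun v w h => ?_
      have : V.ρ (e.symm (e 1)) v = V.ρ (e.symm (e 1)) w := congrFun h (e 1)
      simpa using this

theorem exists_projectiveCover (M : FDRep K G) :
    ∃ (P : FDRep K G) (f : P ⟶ M), IsProjectiveCover f :=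
  exists_isProjectiveCover (fun X : FDRep K G => Module.finrank K X) (fun f _ => mono_dim f)
    (fun f _ => (epi_dim f).2) M

theorem exists_injectiveHull (M : FDRep K G) :
    ∃ (I : FDRep K G) (f : M ⟶ I), IsInjectiveHull f := by
  have : EnoughProjectives (FDRep K G)ᵒᵖ := inferInstance
  obtain ⟨P, f, hP, hf, h⟩ := exists_isProjectiveCover (C := (FDRep K G)ᵒᵖ)
    (fun X => Module.finrank K X.unop)
    (fun f _ => ⟨(epi_dim f.unop).1, fun h => by
      have := (epi_dim f.unop).2 h
      exact (isIso_unop_iff f).1 this⟩)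
    (fun f _ h => by
      have := (mono_dim f.unop).2 h
      exact (isIso_unop_iff f).1 this) (Opposite.op M)
  refine ⟨P.unop, f.unop, ?_, inferInstance, fun {X} g hg => ?_⟩
  · exact Injective.injective_iff_projective_op.2 hP
  · have h1 : Epi ((f.unop ≫ g).op) := inferInstance
    have h2 : Epi g.op := h g.op h1
    exact unop_mono_of_epi g.op

end FDRep

/-! ### Heller translates -/

namespace FDRep

variable {K : Type u} [Field K] {G : Type v} [Group G]

/-- `N` has no non-zero projective direct summand. -/
def IsProjectiveFree (N : FDRep K G) : Prop :=
  ∀ N' P : FDRep K G, Projective P → Nonempty (N ≅ N' ⊞ P) → IsZero P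

open scoped ZeroObject in
theorem exists_projectiveFree_summand (M : FDRep K G) :
    ∃ N : FDRep K G, IsProjectiveFree N ∧
      ∃ P : FDRep K G, Projective P ∧ Nonempty (M ≅ N ⊞ P) := by
  classical
  have hne : ∃ n, ∃ N P : FDRep K G, Projective P ∧ Nonempty (M ≅ N ⊞ P) ∧
      Module.finrank K N = n :=
    ⟨_, M, 0, (isZero_zero _).projective, ⟨(isoBiprodZero (isZero_zero _))⟩, rfl⟩
  obtain ⟨N, P, hP, ⟨i⟩, hd⟩ := Nat.find_spec hne
  refine ⟨N, ?_, P, hP, ⟨i⟩⟩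
  rintro N' P' hP' ⟨j⟩
  have hle : Module.finrank K N ≤ Module.finrank K N' := by
    rw [hd]
    refine Nat.find_min' hne ⟨N', P' ⊞ P, inferInstance, ⟨?_⟩, rfl⟩
    exact i ≪≫ biprod.mapIso j (Iso.refl P) ≪≫ biprod.associator N' P' P
  have h1 : IsIso ((biprod.inl : N' ⟶ N' ⊞ P') ≫ j.inv) := (mono_dim _).2 hle
  have h2 : IsIso (biprod.inl : N' ⟶ N' ⊞ P') := IsIso.of_isIso_comp_right _ j.inv
  have h3 : (biprod.snd : N' ⊞ P' ⟶ P') = 0 := by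
    rw [← cancel_epi (biprod.inl : N' ⟶ N' ⊞ P')]; simp
  rw [IsZero.iff_id_eq_zero, ← biprod.inr_snd (X := N') (Y := P'), h3, comp_zero]

/-- The dual (contragredient) module `M* = Hom_K(M, K)`. -/
noncomputable def dualModule (M : FDRep K G) : FDRep K G := FDRep.of (Representation.dual M.ρ)

/-- `M` is isomorphic to its dual. -/
def IsSelfDual (M : FDRep K G) : Prop := Nonempty (M ≅ dualModule M)

/-- `Ω⁰(M)`: the largest projective-free direct summand of `M`, so that `M ≅ Ω⁰(M) ⊕ P` with
`P` projective and `Ω⁰(M)` without non-zero projective summands. -/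
noncomputable def omegaZero (M : FDRep K G) : FDRep K G :=
  (exists_projectiveFree_summand M).choose

section
variable [Finite G]

/-- `Ω(M)`: the kernel of a projective cover `P ⟶ M`. -/
noncomputable def omega (M : FDRep K G) : FDRep K G :=
  kernel (exists_projectiveCover M).choose_spec.choose

/-- `Ω⁻¹(M)`: the cokernel of an injective hull `M ⟶ I`. -/
noncomputable def omegaInv (M : FDRep K G) : FDRep K G :=
  cokernel (exists_injectiveHull M).choose_spec.choose

/-- The Heller translate `Ωⁱ(M)` for an integer `i`. -/
noncomputable def heller (M : FDRep K G) : ℤ → FDRep K G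
  | Int.ofNat 0 => omegaZero M
  | Int.ofNat (n + 1) => omega^[n + 1] M
  | Int.negSucc n => omegaInv^[n + 1] M

/-- `M` is periodic: `Ωⁿ(M) ≅ Ω⁰(M)` for some `n > 0`, that is, `Ωⁿ(M)` is isomorphic to `M` up to
projective direct summands. -/
def IsPeriodic (M : FDRep K G) : Prop :=
  ∃ n : ℕ, 0 < n ∧ Nonempty (heller M n ≅ heller M 0)

end

/-! ### The Green ring and algebraic modules -/

variable (K G) in
/-- The Green ring `a(KG)`: generated as an abelian group by the isomorphism classes of
finite-dimensional `KG`-modules, subject to `[A ⊕ B] = [A] + [B]`, with multiplication induced by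
the tensor product over `K` (the multiplication of isomorphism classes in `Skeleton`). -/
abbrev GreenRing : Type _ :=
  MonoidAlgebra ℤ (Skeleton (FDRep K G)) ⧸ Ideal.span
    {x : MonoidAlgebra ℤ (Skeleton (FDRep K G)) | ∃ A B : FDRep K G,
      x = MonoidAlgebra.of ℤ _ (toSkeleton (A ⊞ B)) -
        (MonoidAlgebra.of ℤ _ (toSkeleton A) + MonoidAlgebra.of ℤ _ (toSkeleton B))}

/-- The class of a module in the Green ring. -/
noncomputable def greenClass (M : FDRep K G) : GreenRing K G :=
  Ideal.Quotient.mk _ (MonoidAlgebra.of ℤ _ (toSkeleton M))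

/-- `M` is algebraic: it satisfies a non-zero polynomial with integer coefficients, addition and
multiplication being direct sum and tensor product. -/
def IsAlgebraicModule (M : FDRep K G) : Prop := IsAlgebraic ℤ (greenClass M)

/-- The trivial module `K`. -/
noncomputable abbrev trivialModule (K : Type u) [Field K] (G : Type v) [Group G] : FDRep K G :=
  𝟙_ (FDRep K G)

/-- The Klein four-group `V₄`. -/
abbrev FourGroup : Type := Multiplicative (ZMod 2) × Multiplicative (ZMod 2)

/-- A `KG`-module viewed as a `KH`-module through a group homomorphism `H → G`. -/
noncomputable abbrev inflate {H : Type w} [Group H] (π : H →* G) (M : FDRep K G) : FDRep K H :=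
  (Action.res (FGModuleCat K) π).obj M

end FDRep

set_option linter.unusedSectionVars false

/-! ### Direct summands and the Krull–Schmidt theorem -/

namespace KrullSchmidt

section Summands

variable {C : Type u} [Category.{v} C] [Abelian C]

/-! Two translations carry the proof. The first concerns algebraicity. By Krull–Schmidt the
multiplicity of an indecomposable module is an additive function on the Green ring, so a polynomial
relation of degree `d` forces every indecomposable summand of the `d`-th tensor power of `M` to
occur in a lower power. Hence `M` is algebraic exactly when finitely many indecomposables account
for all its tensor powers (`isAlgebraicModule_iff`).

The second concerns Heller translates. Schanuel's lemma shows that on stable classes `Ω` is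
multiplication by an invertible element `w`, the class of `Ω(K)` (`exists_syzygy_unit`). So
`Ω^i(M)^{⊗n}` is stably `Ω^{in}(M^{⊗n})`, and algebraicity depends only on the stable class
(`isAlgebraicModule_of_sc_eq`).

If `Ω^n` fixes `M`, then `Ω^i(M)` and `M` have stably the same `n`-th tensor power, which settles
the periodic case. If `M` and `Ω^l(M)` are both algebraic with `l ≠ 0`, the products `M^{⊗(N-t)} ⊗
Ω^l(M)^{⊗t}`, stably `Ω^{lt}(M^{⊗N})`, involve finitely many indecomposables. For `N` large the
pigeonhole principle makes `M^{⊗N}` periodic, and `M` follows because it is a summand of `M ⊗ M* ⊗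
M`. Thus a non-periodic module has at most one algebraic translate. Duality sends `Ω^i` to `Ω^{-i}`,
so for a self-dual module that translate has index `0`.

For the examples, the modules `Ω^{-n}(K)` of `V₄` are strings of dimension `2n + 1`, so `K` is not
periodic. An explicit resolution gives `Q₈` period four. Inflation along a surjection is fully
faithful and so reflects algebraicity, which moves non-algebraic `V₄`-modules to `Q₈` and to
dihedral groups. Restriction to a four-subgroup detects non-periodicity in the dihedral case. -/

theorem retract_complement {X Y : C} (r : Retract Y X) :
    ∃ (Z : C) (s : Retract Z X), s.r ≫ s.i = 𝟙 X - r.r ≫ r.i ∧ Nonempty (X ≅ Y ⊞ Z) := by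
  have he : (𝟙 X - r.r ≫ r.i) ≫ (𝟙 X - r.r ≫ r.i) = 𝟙 X - r.r ≫ r.i := by
    simp [Preadditive.comp_sub, Preadditive.sub_comp]
  obtain ⟨Z, j, q, h1, h2⟩ := IsIdempotentComplete.idempotents_split X _ he
  have hjr : j ≫ r.r = 0 := by
    have : j ≫ (q ≫ j) ≫ r.r = 0 := by rw [h2]; simp [Preadditive.sub_comp]
    simpa [reassoc_of% h1] using this
  have hiq : r.i ≫ q = 0 := by
    have : r.i ≫ (q ≫ j) ≫ q = 0 := by rw [h2]; simp [Preadditive.sub_comp, Preadditive.comp_sub]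
    simpa [h1] using this
  refine ⟨Z, ⟨j, q, h1⟩, h2, ⟨⟨biprod.lift r.r q, biprod.desc r.i j, ?_, ?_⟩⟩⟩
  · simp [biprod.lift_desc, h2]
  · ext <;> simp [h1, hjr, hiq]

/-- A retract is a direct summand. -/
theorem exists_complement {X Y : C} (r : Retract Y X) : ∃ Z : C, Nonempty (X ≅ Y ⊞ Z) :=
  (retract_complement r).imp fun _ h => h.choose_spec.2

/-- The first summand of a biproduct is a retract. -/
noncomputable def retractInl {X Y Z : C} (e : X ≅ Y ⊞ Z) : Retract Y X :=
  ⟨biprod.inl ≫ e.inv, e.hom ≫ biprod.fst, by simp⟩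

/-- The second summand of a biproduct is a retract. -/
noncomputable def retractInr {X Y Z : C} (e : X ≅ Y ⊞ Z) : Retract Z X :=
  ⟨biprod.inr ≫ e.inv, e.hom ≫ biprod.snd, by simp⟩

theorem isZero_of_retract {X Y : C} (r : Retract Y X) (h : IsZero X) : IsZero Y := by
  rw [IsZero.iff_id_eq_zero, ← r.retract, h.eq_of_tgt r.i 0, zero_comp]

theorem _root_.CategoryTheory.Indecomposable.idempotent {N : C} (hN : Indecomposable N) (e : N ⟶ N)
    (he : e ≫ e = e) : e = 0 ∨ e = 𝟙 N := by
  obtain ⟨Y, i, p, h1, h2⟩ := IsIdempotentComplete.idempotents_split N e he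
  obtain ⟨Z, s, h3, ⟨φ⟩⟩ := retract_complement (X := N) (Y := Y) ⟨i, p, h1⟩
  rcases hN.2 Y Z φ with h | h
  · left; rw [← h2, h.eq_of_tgt p 0, zero_comp]
  · right
    rw [h.eq_of_tgt s.r 0, zero_comp, eq_comm, sub_eq_zero] at h3
    rw [h3, ← h2]

/-- An object all of whose idempotent endomorphisms are trivial is indecomposable. -/
theorem indecomposable_of_idempotent {N : C} (h0 : ¬ IsZero N)
    (h : ∀ e : N ⟶ N, e ≫ e = e → e = 0 ∨ e = 𝟙 N) : Indecomposable N := by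
  refine ⟨h0, fun Y Z φ => ?_⟩
  rcases h (φ.hom ≫ biprod.fst ≫ biprod.inl ≫ φ.inv) (by simp) with h1 | h1
  · left
    rw [IsZero.iff_id_eq_zero]
    have := congrArg (fun t => biprod.inl ≫ φ.inv ≫ t ≫ φ.hom ≫ biprod.fst) h1
    simpa using this
  · right
    rw [IsZero.iff_id_eq_zero]
    have := congrArg (fun t => biprod.inr ≫ φ.inv ≫ t ≫ φ.hom ≫ biprod.snd) h1
    simpa using this.symm

/-- A non-zero retract of an indecomposable object is isomorphic to it. -/
theorem iso_of_retract {N X : C} (hN : Indecomposable N) (hX : ¬ IsZero X) (r : Retract X N) :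
    Nonempty (X ≅ N) := by
  rcases hN.idempotent (r.r ≫ r.i) (by simp) with h | h
  · refine absurd ?_ hX
    rw [IsZero.iff_id_eq_zero, ← r.retract]
    have := congrArg (fun t => r.i ≫ t ≫ r.r) h
    simpa using this
  · exact ⟨⟨r.i, r.r, r.retract, h⟩⟩

theorem not_isIso_zero {N : C} (hN : ¬ IsZero N) : ¬ IsIso (0 : N ⟶ N) := fun _ =>
  hN ((IsZero.iff_id_eq_zero N).2 (by rw [← IsIso.hom_inv_id (0 : N ⟶ N), zero_comp]))

omit [Abelian C] in
/-- An automorphism factoring through `F` makes `N` a retract of `F`. -/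
theorem retract_of_isIso {N F : C} (f : N ⟶ F) (g : F ⟶ N) (h : IsIso (f ≫ g)) :
    Nonempty (Retract N F) :=
  ⟨⟨f, g ≫ inv (f ≫ g), by rw [← Category.assoc, IsIso.hom_inv_id]⟩⟩

/-! #### Additive closures -/

/-- `X` belongs to the additive closure of the class `S`: it is a direct summand of a finite direct
sum of members of `S`. -/
def InAdd (S : Set C) (X : C) : Prop :=
  𝟙 X ∈ AddSubgroup.closure {h : X ⟶ X | ∃ F ∈ S, ∃ (f : X ⟶ F) (g : F ⟶ X), f ≫ g = h}

theorem InAdd.of_retract {S : Set C} {X F : C} (hF : F ∈ S) (r : Retract X F) : InAdd S X :=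
  AddSubgroup.subset_closure ⟨F, hF, r.i, r.r, r.retract⟩

theorem InAdd.of_mem {S : Set C} {X : C} (hX : X ∈ S) : InAdd S X := .of_retract hX (Retract.refl X)

/-- The sums of maps factoring through `S` form a two-sided ideal; once it contains the identity of
`Y`, it contains every map that factors through `Y`. The closure properties below follow without
ever forming a finite direct sum. -/
theorem InAdd.comp_mem {S : Set C} {X Y : C} (hY : InAdd S Y) (f : X ⟶ Y) (g : Y ⟶ X) :
    f ≫ g ∈ AddSubgroup.closure {h : X ⟶ X | ∃ F ∈ S, ∃ (f : X ⟶ F) (g : F ⟶ X), f ≫ g = h} := by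
  let φ : (Y ⟶ Y) →+ (X ⟶ X) :=
    { toFun := fun h => f ≫ h ≫ g
      map_zero' := by simp
      map_add' := by simp }
  have hle : AddSubgroup.closure {h : Y ⟶ Y | ∃ F ∈ S, ∃ (f : Y ⟶ F) (g : F ⟶ Y), f ≫ g = h} ≤
      (AddSubgroup.closure {h : X ⟶ X | ∃ F ∈ S, ∃ (f : X ⟶ F) (g : F ⟶ X), f ≫ g = h}).comap φ := by
    rw [AddSubgroup.closure_le]
    rintro _ ⟨F, hF, a, b, rfl⟩
    exact AddSubgroup.subset_closure ⟨F, hF, f ≫ a, b ≫ g, by simp [φ]⟩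
  have := hle hY
  simpa [φ] using this

theorem InAdd.trans {S T : Set C} {X : C} (hX : InAdd S X) (h : ∀ F ∈ S, InAdd T F) : InAdd T X := by
  refine (AddSubgroup.closure_le _).2 ?_ hX
  rintro _ ⟨F, hF, f, g, rfl⟩
  exact (h F hF).comp_mem f g

theorem InAdd.mono {S T : Set C} {X : C} (hX : InAdd S X) (h : S ⊆ T) : InAdd T X :=
  hX.trans fun _ hF => .of_mem (h hF)

theorem InAdd.retract {S : Set C} {X Y : C} (hY : InAdd S Y) (r : Retract X Y) : InAdd S X := by
  have := hY.comp_mem r.i r.r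
  rwa [r.retract] at this

theorem InAdd.iso {S : Set C} {X Y : C} (hY : InAdd S Y) (e : X ≅ Y) : InAdd S X :=
  hY.retract (Retract.ofIso e)

theorem InAdd.biprod {S : Set C} {X Y : C} (hX : InAdd S X) (hY : InAdd S Y) :
    InAdd S (X ⊞ Y) := by
  have h := add_mem (hX.comp_mem (biprod.fst : X ⊞ Y ⟶ X) biprod.inl)
    (hY.comp_mem (biprod.snd : X ⊞ Y ⟶ Y) biprod.inr)
  rwa [biprod.total] at h

theorem InAdd.map {D : Type*} [Category* D] [Abelian D] {S : Set C} {X : C}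
    (hX : InAdd S X) (Φ : C ⥤ D) [Φ.Additive] {T : Set D} (h : ∀ F ∈ S, InAdd T (Φ.obj F)) :
    InAdd T (Φ.obj X) := by
  have hle : AddSubgroup.closure {h : X ⟶ X | ∃ F ∈ S, ∃ (f : X ⟶ F) (g : F ⟶ X), f ≫ g = h} ≤
      (AddSubgroup.closure {h : Φ.obj X ⟶ Φ.obj X | ∃ F ∈ T,
        ∃ (f : Φ.obj X ⟶ F) (g : F ⟶ Φ.obj X), f ≫ g = h}).comap Φ.mapAddHom := by
    rw [AddSubgroup.closure_le]
    rintro _ ⟨F, hF, a, b, rfl⟩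
    have := (h F hF).comp_mem (Φ.map a) (Φ.map b)
    rw [← Φ.map_comp] at this
    exact this
  have := hle hX
  simpa [InAdd] using this

/-- Fullness lifts the factorisations and faithfulness lifts the equation between them. This is what
lets algebraicity descend along inflation. -/
theorem InAdd.of_map {D : Type*} [Category* D] [Abelian D] {S : Set C} {X : C}
    (Φ : C ⥤ D) [Φ.Additive] [Φ.Full] [Φ.Faithful] (hX : InAdd (Φ.obj '' S) (Φ.obj X)) :
    InAdd S X := by
  have hle : AddSubgroup.closure {h : Φ.obj X ⟶ Φ.obj X | ∃ F ∈ Φ.obj '' S,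
        ∃ (f : Φ.obj X ⟶ F) (g : F ⟶ Φ.obj X), f ≫ g = h} ≤
      (AddSubgroup.closure {h : X ⟶ X | ∃ F ∈ S, ∃ (f : X ⟶ F) (g : F ⟶ X), f ≫ g = h}).map
        Φ.mapAddHom := by
    rw [AddSubgroup.closure_le]
    rintro _ ⟨_, ⟨F, hF, rfl⟩, a, b, rfl⟩
    refine ⟨Φ.preimage a ≫ Φ.preimage b, AddSubgroup.subset_closure ⟨F, hF, _, _, rfl⟩, ?_⟩
    simp
  obtain ⟨f, hf, h⟩ := hle hX
  have : f = 𝟙 X := Φ.map_injective (by simpa using h)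
  rwa [this] at hf

end Summands

end KrullSchmidt

namespace KrullSchmidt

/-! #### Indecomposable objects have local endomorphism rings -/

section Local

variable (K : Type w) [Field K] {C : Type u} [Category.{v} C] [Abelian C] [Linear K C]
  [∀ X Y : C, FiniteDimensional K (X ⟶ Y)]

include K

/-- Fitting's lemma. In the finite-dimensional commutative algebra `K[f]` the powers of `f`
stabilise up to multiples, which yields an idempotent; indecomposability makes it `0` (then `f` is
nilpotent) or `1` (then `f` is invertible). -/
theorem isUnit_or_isNilpotent {N : C} (hN : Indecomposable N) (f : End N) :
    IsUnit f ∨ IsNilpotent f := by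
  have hfd : FiniteDimensional K (End N) := inferInstanceAs (FiniteDimensional K (N ⟶ N))
  have hcomm : IsMulCommutative (Algebra.adjoin K {f}) :=
    Algebra.isMulCommutative_adjoin K (by rintro a rfl b rfl; rfl)
  let _ : CommRing (Algebra.adjoin K {f}) := { mul_comm := hcomm.is_comm.comm }
  have : IsArtinianRing (Algebra.adjoin K {f}) := isArtinian_of_tower K inferInstance
  let x : Algebra.adjoin K {f} := ⟨f, Algebra.self_mem_adjoin_singleton K f⟩
  obtain ⟨n, y, hn⟩ := IsArtinian.exists_pow_succ_smul_dvd x (1 : Algebra.adjoin K {f})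
  simp only [smul_eq_mul, mul_one, Nat.succ_eq_add_one] at hn
  -- From `x ^ (n + 1) * y = x ^ n`, each further factor `x * y` can be absorbed, so `x ^ (n + 1) *
  -- y ^ (n + 1)` is idempotent.
  have hk : ∀ k, x ^ (n + 1 + k) * y ^ k = x ^ (n + 1) := by
    intro k
    induction k with
    | zero => simp
    | succ k ih =>
      calc x ^ (n + 1 + (k + 1)) * y ^ (k + 1) = (x ^ (n + 1) * y) * x ^ (k + 1) * y ^ k := by ring
        _ = x ^ (n + 1 + k) * y ^ k := by rw [hn]; ring
        _ = _ := ih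
  have he : (x ^ (n + 1) * y ^ (n + 1)) * (x ^ (n + 1) * y ^ (n + 1)) =
      x ^ (n + 1) * y ^ (n + 1) := by
    calc _ = (x ^ (n + 1 + (n + 1)) * y ^ (n + 1)) * y ^ (n + 1) := by ring
      _ = _ := by rw [hk]
  have he' := congrArg (Subtype.val : _ → End N) he
  rcases hN.idempotent ((x ^ (n + 1) * y ^ (n + 1) : Algebra.adjoin K {f}) : End N) he' with h | h
  · right
    refine ⟨n + 1, ?_⟩
    have h0 : x ^ (n + 1) * y ^ (n + 1) = 0 := Subtype.ext h
    have : x ^ (n + 1) = 0 := by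
      rw [← hk (n + 1), pow_add, mul_assoc, h0, mul_zero]
    exact congrArg Subtype.val this
  · left
    have h1 : x ^ (n + 1) * y ^ (n + 1) = 1 := Subtype.ext h
    have h2 : x * (x ^ n * y ^ (n + 1)) = 1 := by rw [← h1]; ring
    have h3 : (x ^ n * y ^ (n + 1)) * x = 1 := by rw [← h1]; ring
    exact ⟨⟨f, (x ^ n * y ^ (n + 1) : Algebra.adjoin K {f}), congrArg Subtype.val h2,
      congrArg Subtype.val h3⟩, rfl⟩

theorem isUnit_of_add_eq_one {N : C} (hN : Indecomposable N) {a b : End N} (h : a + b = 1) :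
    IsUnit a ∨ IsUnit b := by
  rcases isUnit_or_isNilpotent K hN a with h1 | h1
  · exact Or.inl h1
  · right
    rw [eq_sub_of_add_eq' h]
    exact h1.isUnit_one_sub

theorem isUnit_of_isUnit_add {N : C} (hN : Indecomposable N) {a b : End N} (h : IsUnit (a + b)) :
    IsUnit a ∨ IsUnit b := by
  obtain ⟨c, hc⟩ := h
  have : (↑c⁻¹ * a : End N) + (↑c⁻¹ * b : End N) = 1 := by
    rw [← mul_add, ← hc, Units.inv_mul]
  rcases isUnit_of_add_eq_one K hN this with h | h
  · exact Or.inl ((Units.isUnit_units_mul _ _).1 h)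
  · exact Or.inr ((Units.isUnit_units_mul _ _).1 h)

theorem isIso_of_isIso_add {N : C} (hN : Indecomposable N) {a b : N ⟶ N} (h : IsIso (a + b)) :
    IsIso a ∨ IsIso b := by
  rw [← isUnit_iff_isIso, ← isUnit_iff_isIso]
  exact isUnit_of_isUnit_add K hN ((isUnit_iff_isIso (a + b)).2 h)

/-- An indecomposable object in the additive closure of `S` is a retract of a member of `S`. -/
theorem InAdd.exists_retract {S : Set C} {N : C} (h : InAdd S N) (hN : Indecomposable N) :
    ∃ F ∈ S, Nonempty (Retract N F) := by
  have key : ∀ x : N ⟶ N, x ∈ AddSubgroup.closure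
      {h : N ⟶ N | ∃ F ∈ S, ∃ (f : N ⟶ F) (g : F ⟶ N), f ≫ g = h} →
      IsIso x → ∃ F ∈ S, Nonempty (Retract N F) := by
    intro x hx
    induction hx using AddSubgroup.closure_induction with
    | mem x hx =>
      obtain ⟨F, hF, f, g, rfl⟩ := hx
      exact fun h => ⟨F, hF, retract_of_isIso f g h⟩
    | zero => exact fun h => absurd h (not_isIso_zero hN.1)
    | add x y _ _ h1 h2 => exact fun h => (isIso_of_isIso_add K hN h).elim h1 h2
    | neg x _ h1 =>
      intro h
      rw [← isUnit_iff_isIso] at h h1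
      exact h1 (by simpa using IsUnit.neg (α := End N) h)
  exact key _ h inferInstance

theorem retract_of_retract_biprod {N X Y : C} (hN : Indecomposable N) (r : Retract N (X ⊞ Y)) :
    Nonempty (Retract N X) ∨ Nonempty (Retract N Y) := by
  have h : InAdd {X, Y} N :=
    InAdd.retract (.biprod (.of_mem (by simp)) (.of_mem (by simp))) r
  obtain ⟨F, hF, hr⟩ := h.exists_retract K hN
  rcases hF with rfl | rfl
  · exact Or.inl hr
  · exact Or.inr hr

/-! #### Decompositions into indecomposable objects -/

/-- This gives the measure for inductions on decompositions: `End Y` embeds as a corner of `End X`,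
and the corner is proper because the identity of `X` has the non-zero component `𝟙 N`. -/
theorem finrank_end_lt {X N Y : C} (e : X ≅ N ⊞ Y) (hN : ¬ IsZero N) :
    Module.finrank K (Y ⟶ Y) < Module.finrank K (X ⟶ X) := by
  let φ : (Y ⟶ Y) →ₗ[K] (X ⟶ X) :=
    { toFun := fun f => e.hom ≫ biprod.snd ≫ f ≫ biprod.inr ≫ e.inv
      map_add' := by simp
      map_smul' := by simp }
  have hinj : Function.Injective φ := by
    intro f g h
    have := congrArg (fun t => biprod.inr ≫ e.inv ≫ t ≫ e.hom ≫ biprod.snd) h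
    simpa [φ] using this
  refine lt_of_le_of_ne (LinearMap.finrank_le_finrank_of_injective hinj) fun h => hN ?_
  have hs := (LinearMap.injective_iff_surjective_of_finrank_eq_finrank h).1 hinj
  obtain ⟨f, hf⟩ := hs (𝟙 X)
  rw [IsZero.iff_id_eq_zero]
  have := congrArg (fun t => biprod.inl ≫ e.inv ≫ t ≫ e.hom ≫ biprod.fst) hf
  simpa [φ] using this.symm

theorem exists_indecomposable_summand (X : C) (hX : ¬ IsZero X) :
    ∃ N Y : C, Indecomposable N ∧ Nonempty (X ≅ N ⊞ Y) := by
  induction h : Module.finrank K (X ⟶ X) using Nat.strong_induction_on generalizing X with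
  | _ n ih =>
    by_cases hi : Indecomposable X
    · exact ⟨X, _, hi, ⟨isoBiprodZero (isZero_zero C)⟩⟩
    · simp only [Indecomposable, not_and, not_forall, not_or] at hi
      obtain ⟨Y, Z, e, hY, hZ⟩ := hi hX
      obtain ⟨N, W, hN, ⟨e'⟩⟩ := ih _ (h ▸ finrank_end_lt K e hY) Z hZ rfl
      obtain ⟨V, ⟨e''⟩⟩ := exists_complement ((retractInl e').trans (retractInr e))
      exact ⟨N, V, hN, ⟨e''⟩⟩

/-- Induction over a decomposition into indecomposable summands. -/
theorem decomposition_induction {P : C → Prop} (h0 : ∀ X, IsZero X → P X)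
    (h1 : ∀ X N Y, Indecomposable N → (X ≅ N ⊞ Y) → P Y → P X) (X : C) : P X := by
  induction h : Module.finrank K (X ⟶ X) using Nat.strong_induction_on generalizing X with
  | _ n ih =>
    by_cases hX : IsZero X
    · exact h0 X hX
    · obtain ⟨N, Y, hN, ⟨e⟩⟩ := exists_indecomposable_summand K X hX
      exact h1 X N Y hN e (ih _ (h ▸ finrank_end_lt K e hN.1) Y rfl)

/-- Every object is in the additive closure of finitely many indecomposable summands of it. -/
theorem exists_finite_indecomposable (X : C) : ∃ S : Set C, S.Finite ∧
    (∀ N ∈ S, Indecomposable N ∧ Nonempty (Retract N X)) ∧ InAdd S X := by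
  refine decomposition_induction K (P := fun X => ∃ S : Set C, S.Finite ∧
    (∀ N ∈ S, Indecomposable N ∧ Nonempty (Retract N X)) ∧ InAdd S X) ?_ ?_ X
  · intro X hX
    refine ⟨∅, Set.finite_empty, by simp, ?_⟩
    rw [InAdd, (IsZero.iff_id_eq_zero X).1 hX]
    exact zero_mem _
  · intro X N Y hN e ih
    obtain ⟨S, hS, h1, h2⟩ := ih
    refine ⟨insert N S, hS.insert N, ?_, ?_⟩
    · rintro M (rfl | hM)
      · exact ⟨hN, ⟨retractInl e⟩⟩
      · exact ⟨(h1 M hM).1, (h1 M hM).2.map fun r => r.trans (retractInr e)⟩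
    · exact InAdd.iso (.biprod (.of_mem (Set.mem_insert N S)) (h2.mono (Set.subset_insert N S))) e

/-! #### Multiplicities and cancellation -/

/-- The morphisms `N ⟶ X` all of whose composites with morphisms `X ⟶ N` are not invertible. -/
def radHom (N X : C) (hN : Indecomposable N) : Submodule K (N ⟶ X) where
  carrier := {f | ∀ g : X ⟶ N, ¬ IsIso (f ≫ g)}
  add_mem' := by
    intro a b ha hb g h
    rw [Preadditive.add_comp] at h
    exact (isIso_of_isIso_add K hN h).elim (ha g) (hb g)
  zero_mem' := by
    intro g h
    rw [zero_comp] at h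
    exact not_isIso_zero hN.1 h
  smul_mem' := by
    intro c f hf g h
    refine hf (c • g) ?_
    simpa using h

/-- The multiplicity of `N` in `X`, scaled by the dimension of the residue division algebra. -/
noncomputable def mult (N X : C) (hN : Indecomposable N) : ℕ :=
  Module.finrank K ((N ⟶ X) ⧸ radHom K N X hN)

theorem mult_iso {N X Y : C} (hN : Indecomposable N) (e : X ≅ Y) :
    mult K N X hN = mult K N Y hN := by
  refine LinearEquiv.finrank_eq (Submodule.Quotient.equiv _ _ (Linear.homCongr K (Iso.refl N) e) ?_)
  ext f
  constructor
  · rintro ⟨f, hf, rfl⟩ g h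
    refine hf (e.hom ≫ g) ?_
    simpa [Linear.homCongr] using h
  · intro hf
    exact ⟨f ≫ e.inv, fun g h => hf (e.inv ≫ g) (by simpa using h), by simp [Linear.homCongr]⟩

/-- Locality of `End N` makes a map into a biproduct radical exactly when both components are, so
the quotient by the radical splits. -/
theorem mult_biprod {N : C} (X Y : C) (hN : Indecomposable N) :
    mult K N (X ⊞ Y) hN = mult K N X hN + mult K N Y hN := by
  let φ : (N ⟶ X ⊞ Y) →ₗ[K] ((N ⟶ X) ⧸ radHom K N X hN) × ((N ⟶ Y) ⧸ radHom K N Y hN) :=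
    ((Submodule.mkQ _).comp (Linear.rightComp K N biprod.fst)).prod
      ((Submodule.mkQ _).comp (Linear.rightComp K N biprod.snd))
  have hs : Function.Surjective φ := by
    rintro ⟨a, b⟩
    obtain ⟨a, rfl⟩ := Submodule.mkQ_surjective _ a
    obtain ⟨b, rfl⟩ := Submodule.mkQ_surjective _ b
    exact ⟨biprod.lift a b, by simp [φ]⟩
  have hk : LinearMap.ker φ = radHom K N (X ⊞ Y) hN := by
    ext f
    have hf : f ∈ LinearMap.ker φ ↔ f ≫ biprod.fst ∈ radHom K N X hN ∧
        f ≫ biprod.snd ∈ radHom K N Y hN := by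
      rw [← Submodule.Quotient.mk_eq_zero (radHom K N X hN),
        ← Submodule.Quotient.mk_eq_zero (radHom K N Y hN), ← Prod.mk_eq_zero]
      rfl
    rw [hf]
    constructor
    · rintro ⟨h1, h2⟩ g h
      have hg : f ≫ g = (f ≫ biprod.fst) ≫ biprod.inl ≫ g + (f ≫ biprod.snd) ≫ biprod.inr ≫ g := by
        conv_lhs => rw [← Category.id_comp g, ← biprod.total, Preadditive.add_comp,
          Preadditive.comp_add]
        simp only [Category.assoc]
      rw [hg] at h
      exact (isIso_of_isIso_add K hN h).elim (h1 _) (h2 _)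
    · intro h
      exact ⟨fun g hg => h (biprod.fst ≫ g) (by simpa using hg),
        fun g hg => h (biprod.snd ≫ g) (by simpa using hg)⟩
  rw [mult, mult, mult, ← Module.finrank_prod, ← (φ.quotKerEquivOfSurjective hs).finrank_eq, hk]

theorem retract_of_mult_ne_zero {N X : C} (hN : Indecomposable N) (h : mult K N X hN ≠ 0) :
    Nonempty (Retract N X) := by
  by_contra hr
  refine h ?_
  have : radHom K N X hN = ⊤ := by
    rw [eq_top_iff]
    exact fun f _ g hg => hr (retract_of_isIso f g hg)
  rw [mult, this]
  exact Module.finrank_zero_of_subsingleton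

theorem mult_ne_zero_of_retract {N X : C} (hN : Indecomposable N) (r : Retract N X) :
    mult K N X hN ≠ 0 := by
  intro h
  have := Module.finrank_zero_iff.1 h
  rw [Submodule.Quotient.subsingleton_iff] at this
  have h2 : r.i ∈ radHom K N X hN := this ▸ Submodule.mem_top
  refine h2 r.r ?_
  rw [r.retract]
  infer_instance

theorem mult_of_isZero {N X : C} (hN : Indecomposable N) (hX : IsZero X) : mult K N X hN = 0 := by
  by_contra h
  obtain ⟨r⟩ := retract_of_mult_ne_zero K hN h
  exact hN.1 (isZero_of_retract r hX)

/-- Objects with the same multiplicities are isomorphic. -/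
theorem iso_of_mult_eq {X Y : C} (h : ∀ N (hN : Indecomposable N), mult K N X hN = mult K N Y hN) :
    Nonempty (X ≅ Y) := by
  refine decomposition_induction K (P := fun X => ∀ Y, (∀ N (hN : Indecomposable N),
    mult K N X hN = mult K N Y hN) → Nonempty (X ≅ Y)) ?_ ?_ X Y h
  · intro X hX Y h
    by_cases hY : IsZero Y
    · exact ⟨hX.iso hY⟩
    · obtain ⟨N, Z, hN, ⟨e⟩⟩ := exists_indecomposable_summand K Y hY
      refine absurd ?_ (mult_ne_zero_of_retract K hN (retractInl e))
      rw [← h, mult_of_isZero K hN hX]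
  · intro X N Z hN e ih Y h
    -- `N` occurs in `X`, hence in `Y`; splitting it off leaves complements with equal
    -- multiplicities, to which the induction applies.
    have h2 := mult_ne_zero_of_retract K hN (retractInl e)
    rw [h] at h2
    obtain ⟨r⟩ := retract_of_mult_ne_zero K hN h2
    obtain ⟨W, ⟨e'⟩⟩ := exists_complement r
    obtain ⟨i⟩ := ih W fun M hM => by
      have := h M hM
      rw [mult_iso K hM e, mult_iso K hM e', mult_biprod, mult_biprod] at this
      omega
    exact ⟨e ≪≫ biprod.mapIso (Iso.refl N) i ≪≫ e'.symm⟩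

theorem cancel_biprod {X Y Z : C} (e : X ⊞ Z ≅ Y ⊞ Z) : Nonempty (X ≅ Y) :=
  iso_of_mult_eq K fun N hN => by
    have := mult_iso K hN e
    rw [mult_biprod, mult_biprod] at this
    omega

end Local
end KrullSchmidt

/-! ### Stable isomorphism classes -/

namespace StableCat
open KrullSchmidt

/-- The category is Frobenius: its projective and injective objects agree. -/
class Frobenius (C : Type u) [Category.{v} C] : Prop where
  projective_iff_injective : ∀ X : C, Projective X ↔ Injective X

section Abelian

variable {C : Type u} [Category.{v} C] [Abelian C]

/-- Two objects are stably isomorphic if they become isomorphic after adding projectives. -/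
def StableIso (M N : C) : Prop :=
  ∃ P Q : C, Projective P ∧ Projective Q ∧ Nonempty (M ⊞ P ≅ N ⊞ Q)

theorem StableIso.of_iso {M N : C} (e : M ≅ N) : StableIso M N :=
  ⟨_, _, (isZero_zero C).projective, (isZero_zero C).projective, ⟨biprod.mapIso e (Iso.refl _)⟩⟩

theorem StableIso.symm {M N : C} : StableIso M N → StableIso N M := by
  rintro ⟨P, Q, hP, hQ, ⟨e⟩⟩
  exact ⟨Q, P, hQ, hP, ⟨e.symm⟩⟩

theorem StableIso.trans {L M N : C} : StableIso L M → StableIso M N → StableIso L N := by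
  rintro ⟨P, Q, hP, hQ, ⟨e⟩⟩ ⟨R, S, hR, hS, ⟨f⟩⟩
  refine ⟨P ⊞ R, S ⊞ Q, inferInstance, inferInstance, ⟨?_⟩⟩
  calc L ⊞ (P ⊞ R) ≅ (L ⊞ P) ⊞ R := (biprod.associator _ _ _).symm
    _ ≅ (M ⊞ Q) ⊞ R := biprod.mapIso e (Iso.refl _)
    _ ≅ M ⊞ (Q ⊞ R) := biprod.associator _ _ _
    _ ≅ M ⊞ (R ⊞ Q) := biprod.mapIso (Iso.refl _) (biprod.braiding _ _)
    _ ≅ (M ⊞ R) ⊞ Q := (biprod.associator _ _ _).symm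
    _ ≅ (N ⊞ S) ⊞ Q := biprod.mapIso f (Iso.refl _)
    _ ≅ N ⊞ (S ⊞ Q) := biprod.associator _ _ _

theorem StableIso.add_projective (M : C) {P : C} (hP : Projective P) : StableIso (M ⊞ P) M :=
  ⟨_, P, (isZero_zero C).projective, hP, ⟨(isoBiprodZero (isZero_zero C)).symm⟩⟩

/-- The interchange isomorphism of biproducts. -/
noncomputable def biprodInterchange (A B P Q : C) : (A ⊞ B) ⊞ (P ⊞ Q) ≅ (A ⊞ P) ⊞ (B ⊞ Q) :=
  biprod.associator A B (P ⊞ Q) ≪≫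
    biprod.mapIso (Iso.refl A) ((biprod.associator B P Q).symm ≪≫
      biprod.mapIso (biprod.braiding B P) (Iso.refl Q) ≪≫ biprod.associator P B Q) ≪≫
    (biprod.associator A P (B ⊞ Q)).symm

theorem StableIso.biprod {A A' B B' : C} : StableIso A A' → StableIso B B' →
    StableIso (A ⊞ B) (A' ⊞ B') := by
  rintro ⟨P, Q, hP, hQ, ⟨e⟩⟩ ⟨R, S, hR, hS, ⟨f⟩⟩
  exact ⟨P ⊞ R, Q ⊞ S, inferInstance, inferInstance,
    ⟨biprodInterchange _ _ _ _ ≪≫ biprod.mapIso e f ≪≫ (biprodInterchange _ _ _ _).symm⟩⟩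

theorem StableIso.projective {M N : C} (h : StableIso M N) (hN : Projective N) :
    Projective M := by
  obtain ⟨P, Q, hP, hQ, ⟨e⟩⟩ := h
  have := Projective.of_iso e.symm inferInstance
  exact (retractInl (Iso.refl (M ⊞ P))).projective

/-- `N` is a syzygy of `M`: the kernel of an epimorphism from a projective object onto `M`. -/
def IsSyzygy (N M : C) : Prop :=
  ∃ (P : C) (i : N ⟶ P) (p : P ⟶ M) (w : i ≫ p = 0), Projective P ∧ Epi p ∧
    Nonempty (IsLimit (KernelFork.ofι i w))

theorem isSyzygy_kernel {P M : C} (p : P ⟶ M) (hP : Projective P) [Epi p] :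
    IsSyzygy (kernel p) M :=
  ⟨P, kernel.ι p, p, kernel.condition p, hP, inferInstance, ⟨kernelIsKernel p⟩⟩

theorem isSyzygy_cokernel {P M : C} (i : M ⟶ P) (hP : Projective P) [Mono i] :
    IsSyzygy M (cokernel i) :=
  ⟨P, i, cokernel.π i, cokernel.condition i, hP, inferInstance,
    ⟨Abelian.monoIsKernelOfCokernel (CokernelCofork.ofπ _ (cokernel.condition i))
      (cokernelIsCokernel i)⟩⟩

theorem IsSyzygy.of_iso_right {N M M' : C} (h : IsSyzygy N M) (e : M ≅ M') : IsSyzygy N M' := by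
  obtain ⟨P, i, p, w, hP, hp, ⟨hl⟩⟩ := h
  have hm : Mono i := mono_of_isLimit_fork hl
  refine ⟨P, i, p ≫ e.hom, by simp [reassoc_of% w], hP, inferInstance, ⟨?_⟩⟩
  refine KernelFork.IsLimit.ofι' _ _ fun {A} k hk => ?_
  exact KernelFork.IsLimit.lift' hl k (by simpa using congrArg (fun t => t ≫ e.inv) hk)

theorem IsSyzygy.of_iso_left {N N' M : C} (h : IsSyzygy N M) (e : N' ≅ N) : IsSyzygy N' M := by
  obtain ⟨P, i, p, w, hP, hp, ⟨hl⟩⟩ := h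
  have hm : Mono i := mono_of_isLimit_fork hl
  refine ⟨P, e.hom ≫ i, p, by simp [w], hP, inferInstance, ⟨?_⟩⟩
  refine KernelFork.IsLimit.ofι' _ _ fun {A} k hk => ?_
  obtain ⟨l, hl'⟩ := KernelFork.IsLimit.lift' hl k hk
  exact ⟨l ≫ e.inv, by simpa using hl'⟩

/-- A kernel of the sum of two epimorphisms onto `M`, one of which factors through the other. -/
theorem exists_kernel_desc {N P P' M : C} {i : N ⟶ P} {p : P ⟶ M} (w : i ≫ p = 0)
    (hl : IsLimit (KernelFork.ofι i w)) {p' : P' ⟶ M} {b : P' ⟶ P} (hb : b ≫ p = p') :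
    Nonempty (N ⊞ P' ≅ kernel (biprod.desc p p')) := by
  have hm : Mono i := mono_of_isLimit_fork hl
  -- A pair `(x, y)` is killed by `desc p p'` exactly when `x + b y` lies in the kernel of `p`, that
  -- is, when it has the form `(i n - b y, y)`.
  let k : N ⊞ P' ⟶ P ⊞ P' := biprod.desc (i ≫ biprod.inl) (biprod.inr - b ≫ biprod.inl)
  have hk1 : k ≫ biprod.fst = biprod.fst ≫ i - biprod.snd ≫ b := by
    ext <;> simp [k, Preadditive.sub_comp, Preadditive.comp_sub]
  have hk2 : k ≫ biprod.snd = biprod.snd := by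
    ext <;> simp [k, Preadditive.sub_comp]
  have hd : (biprod.desc p p' : P ⊞ P' ⟶ M) = biprod.fst ≫ p + biprod.snd ≫ p' := by
    ext <;> simp [Preadditive.comp_add]
  have hw : k ≫ biprod.desc p p' = 0 := by
    ext <;> simp [k, w, hb, Preadditive.sub_comp]
  have hmono : Mono k := by
    refine Preadditive.mono_of_cancel_zero _ fun {T} g hg => ?_
    have h2 : g ≫ biprod.snd = 0 := by rw [← hk2, reassoc_of% hg, zero_comp]
    have h1 : (g ≫ biprod.fst) ≫ i = 0 := by
      have : g ≫ (biprod.fst ≫ i - biprod.snd ≫ b) = 0 := by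
        rw [← hk1, reassoc_of% hg, zero_comp]
      simpa [Preadditive.comp_sub, reassoc_of% h2] using this
    ext
    · simpa using (cancel_mono i).1 (h1.trans zero_comp.symm)
    · simpa using h2
  refine ⟨IsLimit.conePointUniqueUpToIso (KernelFork.IsLimit.ofι' _ hw fun {T} t ht => ?_)
    (limit.isLimit _)⟩
  have hz : (t ≫ biprod.fst + (t ≫ biprod.snd) ≫ b) ≫ p = 0 := by
    rw [hd, Preadditive.comp_add] at ht
    simpa [Preadditive.add_comp, hb] using ht
  obtain ⟨l, hl'⟩ := KernelFork.IsLimit.lift' hl _ hz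
  simp only [Fork.ι_ofι] at hl'
  refine ⟨biprod.lift l (t ≫ biprod.snd), ?_⟩
  ext
  · rw [Category.assoc, hk1]
    simp [Preadditive.comp_sub, hl']
  · rw [Category.assoc, hk2, biprod.lift_snd]

/-- Schanuel's lemma. -/
theorem IsSyzygy.stableIso_of_eq {N N' M : C} (h : IsSyzygy N M) (h' : IsSyzygy N' M) :
    StableIso N N' := by
  obtain ⟨P, i, p, w, hP, hp, ⟨hl⟩⟩ := h
  obtain ⟨P', i', p', w', hP', hp', ⟨hl'⟩⟩ := h'
  -- Each epimorphism factors through the other by projectivity, so the kernel of their sum can be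
  -- computed in two ways.
  obtain ⟨e⟩ := exists_kernel_desc w hl (Projective.factorThru_comp p' p)
  obtain ⟨e'⟩ := exists_kernel_desc w' hl' (Projective.factorThru_comp p p')
  have hd : (biprod.braiding P P').hom ≫ biprod.desc p' p = biprod.desc p p' := by
    ext <;> simp
  exact ⟨P', P, hP', hP, ⟨e ≪≫ kernelIsoOfEq hd.symm ≪≫ kernelIsIsoComp _ _ ≪≫ e'.symm⟩⟩

theorem IsSyzygy.map {D : Type*} [Category* D] [Abelian D] {N M : C} (h : IsSyzygy N M)
    (F : C ⥤ D) [F.Additive] [PreservesFiniteLimits F] [F.PreservesEpimorphisms]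
    (hF : ∀ P, Projective P → Projective (F.obj P)) : IsSyzygy (F.obj N) (F.obj M) := by
  obtain ⟨P, i, p, w, hP, hp, ⟨hl⟩⟩ := h
  exact ⟨F.obj P, F.map i, F.map p, by rw [← F.map_comp, w, F.map_zero], hF P hP, inferInstance,
    ⟨KernelFork.mapIsLimit _ hl F⟩⟩

theorem StableIso.map {D : Type*} [Category* D] [Abelian D] {N M : C} (h : StableIso N M)
    (F : C ⥤ D) [F.Additive]
    (hF : ∀ P, Projective P → Projective (F.obj P)) : StableIso (F.obj N) (F.obj M) := by
  obtain ⟨P, Q, hP, hQ, ⟨e⟩⟩ := h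
  exact ⟨F.obj P, F.obj Q, hF P hP, hF Q hQ,
    by
    have := preservesBinaryBiproducts_of_preservesBiproducts F
    exact ⟨(F.mapBiprod N P).symm ≪≫ F.mapIso e ≪≫ F.mapBiprod M Q⟩⟩

/-- `N` has no non-zero projective direct summand. -/
def ProjectiveFree (N : C) : Prop :=
  ∀ N' P : C, Projective P → Nonempty (N ≅ N' ⊞ P) → IsZero P

theorem ProjectiveFree.isZero_of_retract {N P : C} (h : ProjectiveFree N) (hP : Projective P)
    (r : Retract P N) : IsZero P := by
  obtain ⟨Z, ⟨e⟩⟩ := exists_complement r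
  exact h Z P hP ⟨e ≪≫ biprod.braiding _ _⟩

theorem projectiveFree_of_retract {N : C} (h : ∀ P, Projective P → Retract P N → IsZero P) :
    ProjectiveFree N := by
  rintro N' P hP ⟨e⟩
  exact h P hP (retractInr e)

section KS

variable (K : Type w) [Field K] [Linear K C] [∀ X Y : C, FiniteDimensional K (X ⟶ Y)]
include K

/-- Compare multiplicities: a projective indecomposable occurs in neither `M` nor `N`, and a
non-projective one occurs in neither of the added projectives. -/
theorem StableIso.iso {M N : C} (h : StableIso M N) (hM : ProjectiveFree M)
    (hN : ProjectiveFree N) : Nonempty (M ≅ N) := by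
  obtain ⟨P, Q, hP, hQ, ⟨e⟩⟩ := h
  refine iso_of_mult_eq K fun X hX => ?_
  by_cases hp : Projective X
  · have key : ∀ L : C, ProjectiveFree L → mult K X L hX = 0 := by
      intro L hL
      by_contra h0
      obtain ⟨r⟩ := retract_of_mult_ne_zero K hX h0
      exact hX.1 (hL.isZero_of_retract hp r)
    rw [key M hM, key N hN]
  · have key : ∀ L : C, Projective L → mult K X L hX = 0 := by
      intro L hL
      by_contra h0
      obtain ⟨r⟩ := retract_of_mult_ne_zero K hX h0
      exact hp r.projective
    have := mult_iso K hX e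
    rwa [mult_biprod, mult_biprod, key P hP, key Q hQ] at this

/-- If an indecomposable object is stably a biproduct, one of the summands is projective. -/
theorem StableIso.projective_or {B X Y : C} (hB : Indecomposable B) (h : StableIso B (X ⊞ Y)) :
    Projective X ∨ Projective Y := by
  -- If `B` is a summand of `X`, it can be cancelled from both sides, leaving `Y` as a summand of
  -- the projective `P`.
  have key : ∀ X Y : C, StableIso B (X ⊞ Y) → Nonempty (Retract B X) → Projective Y := by
    rintro X Y ⟨P, Q, hP, hQ, ⟨e⟩⟩ ⟨r⟩
    obtain ⟨Z, ⟨f⟩⟩ := exists_complement r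
    have i : P ⊞ B ≅ (Z ⊞ (Y ⊞ Q)) ⊞ B :=
      biprod.braiding _ _ ≪≫ e ≪≫ biprod.associator _ _ _ ≪≫ biprod.mapIso f (Iso.refl _) ≪≫
        biprod.associator _ _ _ ≪≫ biprod.braiding _ _
    obtain ⟨g⟩ := cancel_biprod K i
    exact ((retractInl (Iso.refl (Y ⊞ Q))).trans (retractInr g)).projective
  obtain ⟨P, Q, hP, hQ, ⟨e⟩⟩ := id h
  rcases retract_of_retract_biprod K hB ((retractInl (Iso.refl (B ⊞ P))).trans (Retract.ofIso e))
    with h' | h'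
  · obtain ⟨r⟩ := h'
    rcases retract_of_retract_biprod K hB r with r | r
    · exact Or.inr (key X Y h r)
    · exact Or.inl (key Y X (h.trans (.of_iso (biprod.braiding X Y))) r)
  · obtain ⟨r⟩ := h'
    have := h.symm.projective r.projective
    exact Or.inl (retractInl (Iso.refl (X ⊞ Y))).projective

end KS

end Abelian

/-! ### Tensor products of stable classes and the invertible syzygy of the unit. -/

section Monoidal

variable {C : Type u} [Category.{v} C] [Abelian C] [MonoidalCategory C] [BraidedCategory C]
  [MonoidalPreadditive C] [RightRigidCategory C]

/-- The braiding makes a right dual also a left dual, so tensoring with `X` has adjoints on both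
sides and is exact. -/
theorem isLeftAdjoint_tensorLeft (X : C) : (tensorLeft X).IsLeftAdjoint :=
  let _ : ExactPairing Xᘁ X := BraidedCategory.exactPairing_swap X Xᘁ
  (tensorLeftAdjunction Xᘁ X).isLeftAdjoint

theorem isRightAdjoint_tensorLeft (X : C) : (tensorLeft X).IsRightAdjoint :=
  (tensorLeftAdjunction X Xᘁ).isRightAdjoint

/-- The right adjoint of `X ⊗ -` is tensoring with the dual, which preserves epimorphisms; a left
adjoint of such a functor preserves projectives. -/
theorem projective_tensor (X P : C) (hP : Projective P) : Projective (X ⊗ P) := by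
  let _ : ExactPairing Xᘁ X := BraidedCategory.exactPairing_swap X Xᘁ
  have := isLeftAdjoint_tensorLeft Xᘁ
  exact (tensorLeftAdjunction Xᘁ X).map_projective P hP

theorem IsSyzygy.tensor {N M : C} (X : C) (h : IsSyzygy N M) : IsSyzygy (X ⊗ N) (X ⊗ M) := by
  have := isLeftAdjoint_tensorLeft X
  have := isRightAdjoint_tensorLeft X
  have : PreservesFiniteLimits (tensorLeft X) := inferInstance
  exact h.map (tensorLeft X) (projective_tensor X)

theorem StableIso.tensorLeft {N M : C} (X : C) (h : StableIso N M) : StableIso (X ⊗ N) (X ⊗ M) :=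
  h.map (MonoidalCategory.tensorLeft X) (projective_tensor X)

theorem StableIso.tensor {A A' B B' : C} (h : StableIso A A') (h' : StableIso B B') :
    StableIso (A ⊗ B) (A' ⊗ B') :=
  (h'.tensorLeft A).trans (((StableIso.of_iso (β_ A B')).trans (h.tensorLeft B')).trans
    (StableIso.of_iso (β_ B' A')))

variable (C) in
/-- Stable isomorphism as a setoid. -/
def stableSetoid : Setoid C where
  r := StableIso
  iseqv := ⟨fun X => .of_iso (Iso.refl X), .symm, .trans⟩

variable (C) in
/-- The stable isomorphism classes of objects. -/
def Stable : Type u := Quotient (stableSetoid C)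

/-- The stable isomorphism class of an object. -/
def sc (X : C) : Stable C := Quotient.mk (stableSetoid C) X

theorem sc_eq_iff {X Y : C} : sc X = sc Y ↔ StableIso X Y :=
  Quotient.eq (r := stableSetoid C)

theorem sc_iso {X Y : C} (e : X ≅ Y) : sc X = sc Y := sc_eq_iff.2 (.of_iso e)

/-- Stable isomorphism classes form a commutative monoid under the tensor product. -/
instance : CommMonoid (Stable C) where
  mul := Quotient.map₂ (fun X Y : C => X ⊗ Y) fun _ _ h _ _ h' => StableIso.tensor h h'
  one := sc (𝟙_ C)
  mul_assoc := by
    rintro ⟨X⟩ ⟨Y⟩ ⟨Z⟩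
    exact sc_iso (α_ X Y Z)
  one_mul := by
    rintro ⟨X⟩
    exact sc_iso (λ_ X)
  mul_one := by
    rintro ⟨X⟩
    exact sc_iso (ρ_ X)
  mul_comm := by
    rintro ⟨X⟩ ⟨Y⟩
    exact sc_iso (β_ X Y)

theorem sc_tensor (X Y : C) : sc (X ⊗ Y) = sc X * sc Y := rfl

theorem sc_one : sc (𝟙_ C) = 1 := rfl

theorem exists_sc (x : Stable C) : ∃ X, sc X = x := Quotient.exists_rep x

/-- Distributivity of the tensor product over biproducts. -/
noncomputable def tensorBiprod (X A B : C) : X ⊗ (A ⊞ B) ≅ (X ⊗ A) ⊞ (X ⊗ B) :=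
  have := preservesBinaryBiproducts_of_preservesBiproducts (tensorLeft X)
  (tensorLeft X).mapBiprod A B

/-- The monoid of stable classes carries no addition; this substitute allows an action on a
biproduct to be checked summand by summand. -/
theorem mul_sc_biprod {x : Stable C} {A A' B B' : C} (hA : x * sc A = sc A')
    (hB : x * sc B = sc B') : x * sc (A ⊞ B) = sc (A' ⊞ B') := by
  obtain ⟨X, rfl⟩ := exists_sc x
  rw [← sc_tensor, sc_eq_iff] at *
  exact (StableIso.of_iso (tensorBiprod X A B)).trans (hA.biprod hB)

/-- All projectives share one stable class, which is absorbing because tensor products with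
projectives are projective. -/
theorem mul_sc_projective (x : Stable C) {P : C} (hP : Projective P) : x * sc P = sc P := by
  obtain ⟨X, rfl⟩ := exists_sc x
  rw [← sc_tensor, sc_eq_iff]
  exact ⟨P, X ⊗ P, hP, projective_tensor X P hP, ⟨biprod.braiding _ _⟩⟩

theorem sc_biprod_projective (M : C) {P : C} (hP : Projective P) : sc (M ⊞ P) = sc M :=
  sc_eq_iff.2 (.add_projective M hP)

variable [EnoughProjectives C] [EnoughInjectives C] [Frobenius C]

/-- Tensoring the syzygy sequence of the unit with `M` gives one for `M`, so by Schanuel every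
syzygy of `M` is stably `M ⊗ W`. The class of `W` is invertible: the unit embeds in an injective,
which is projective by the Frobenius property, so the unit is itself a syzygy of the cokernel `V`,
and `W ⊗ V` is stably the unit. -/
theorem exists_syzygy_unit : ∃ w : (Stable C)ˣ, ∀ N M : C, IsSyzygy N M → sc N = w * sc M := by
  let W := kernel (Projective.π (𝟙_ C))
  have hW : IsSyzygy W (𝟙_ C) := isSyzygy_kernel (Projective.π (𝟙_ C)) inferInstance
  let V := cokernel (Injective.ι (𝟙_ C))
  have hV : IsSyzygy (𝟙_ C) V := isSyzygy_cokernel (Injective.ι (𝟙_ C))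
    ((Frobenius.projective_iff_injective _).2 inferInstance)
  have key : ∀ N M : C, IsSyzygy N M → sc N = sc W * sc M := by
    intro N M h
    rw [mul_comm, ← sc_tensor, sc_eq_iff]
    exact h.stableIso_of_eq ((hW.tensor M).of_iso_right (ρ_ M))
  have h1 : sc W * sc V = 1 := by rw [← key _ _ hV, sc_one]
  exact ⟨⟨sc W, sc V, h1, by rw [mul_comm, h1]⟩, key⟩

variable (C) in
/-- The stable class of the syzygy of the unit object. -/
noncomputable def syz : (Stable C)ˣ := (exists_syzygy_unit (C := C)).choose

theorem IsSyzygy.sc_eq {N M : C} (h : IsSyzygy N M) : sc N = syz C * sc M :=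
  (exists_syzygy_unit (C := C)).choose_spec N M h

theorem IsSyzygy.sc_eq' {N M : C} (h : IsSyzygy N M) : sc M = (syz C)⁻¹ * sc N := by
  rw [h.sc_eq, Units.inv_mul_cancel_left]

end Monoidal
end StableCat

/-! ### Heller translates in the stable category -/

namespace StableCat
open KrullSchmidt

variable {C : Type u} [Category.{v} C] [Abelian C] [Frobenius C]

/-- A projective summand `Q` of the kernel is injective, so it splits off from `P`. The complement
still maps onto `M`, hence by essentiality its inclusion is an epimorphism, which forces `Q = 0`. -/
theorem projectiveFree_kernel {P M : C} {p : P ⟶ M} (h : IsProjectiveCover p) :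
    ProjectiveFree (kernel p) := by
  obtain ⟨hP, hp, hess⟩ := h
  refine projectiveFree_of_retract fun Q hQ r => ?_
  have hQi : Injective Q := (Frobenius.projective_iff_injective Q).1 hQ
  have hr : Mono r.i := ⟨fun a b h => by simpa using congrArg (fun t => t ≫ r.r) h⟩
  let i : Q ⟶ P := r.i ≫ kernel.ι p
  have hi : Mono i := mono_comp _ _
  obtain ⟨Z, s, hs, -⟩ := retract_complement
    (⟨i, Injective.factorThru (𝟙 Q) i, Injective.comp_factorThru _ _⟩ : Retract Q _)
  have hip : i ≫ p = 0 := by simp [i]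
  have h1 : s.r ≫ s.i ≫ p = p := by
    rw [← Category.assoc, hs]
    simp [Preadditive.sub_comp, hip]
  have h2 : Epi (s.i ≫ p) := by
    rw [← h1] at hp
    exact epi_of_epi s.r _
  have h3 : Epi s.i := hess _ h2
  have h4 : s.i ≫ Injective.factorThru (𝟙 Q) i = 0 := by
    have h5 : s.r ≫ s.i ≫ Injective.factorThru (𝟙 Q) i = 0 := by
      rw [← Category.assoc, hs]
      simp [Preadditive.sub_comp]
    have := congrArg (fun t => s.i ≫ t) h5
    simpa using this
  have h6 : Injective.factorThru (𝟙 Q) i = 0 := by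
    rw [← cancel_epi s.i, h4, comp_zero]
  rw [IsZero.iff_id_eq_zero, ← Injective.comp_factorThru (𝟙 Q) i, h6, comp_zero]

/-- The dual argument: a projective summand of the cokernel splits off from `I`, and `M` still
embeds in the complement. -/
theorem projectiveFree_cokernel {I M : C} {j : M ⟶ I} (h : IsInjectiveHull j) :
    ProjectiveFree (cokernel j) := by
  obtain ⟨hI, hm, hess⟩ := h
  refine projectiveFree_of_retract fun Q hQ r => ?_
  have hr : Epi r.r := ⟨fun a b h => by simpa using congrArg (fun t => r.i ≫ t) h⟩
  let p : I ⟶ Q := cokernel.π j ≫ r.r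
  have hp : Epi p := epi_comp _ _
  obtain ⟨Z, s, hs, -⟩ := retract_complement
    (⟨Projective.factorThru (𝟙 Q) p, p, Projective.factorThru_comp _ _⟩ : Retract Q _)
  have hjp : j ≫ p = 0 := by simp [p]
  have h1 : (j ≫ s.r) ≫ s.i = j := by
    rw [Category.assoc, hs]
    simp [Preadditive.comp_sub, reassoc_of% hjp]
  have h2 : Mono (j ≫ s.r) := by
    rw [← h1] at hm
    exact mono_of_mono _ s.i
  have h3 : Mono s.r := hess _ h2
  have h4 : Projective.factorThru (𝟙 Q) p ≫ s.r = 0 := by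
    have h5 : (Projective.factorThru (𝟙 Q) p ≫ s.r) ≫ s.i = 0 := by
      rw [Category.assoc, hs]
      simp [Preadditive.comp_sub]
    have := congrArg (fun t => t ≫ s.r) h5
    simpa using this
  have h6 : Projective.factorThru (𝟙 Q) p = 0 := by
    rw [← cancel_mono s.r, h4, zero_comp]
  rw [IsZero.iff_id_eq_zero, ← Projective.factorThru_comp (𝟙 Q) p, h6, zero_comp]

end StableCat

namespace FDRep
open KrullSchmidt StableCat

variable {K : Type u} [Field K] {G : Type v} [Group G]

section Finite
variable [Finite G]

/-- Every module is a quotient and a submodule of the module of functions on `G` with values in it. -/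
theorem exists_coindObj_epi_mono (n : ℕ) (e : G ≃ Fin n) (V : FDRep K G) :
    (∃ p : coindObj n e V ⟶ V, Epi p) ∧ ∃ i : V ⟶ coindObj n e V, Mono i := by
  constructor
  · let l : (Fin n → V) →ₗ[K] V := ∑ j, (V.ρ (e.symm j)⁻¹).comp (LinearMap.proj j)
    have hl : ∀ x, l x = ∑ j, V.ρ (e.symm j)⁻¹ (x j) := fun x => by
      simp [l, LinearMap.sum_apply]
    have hc : ∀ (g : G) (x : Fin n → V), l (coindRep (K := K) n e V g x) = V.ρ g (l x) := by
      intro g x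
      rw [hl, hl, map_sum]
      refine Fintype.sum_equiv ((e.symm.trans (Equiv.mulRight g)).trans e) _ _ fun j => ?_
      rw [coindRep_apply, ← Module.End.mul_apply, ← map_mul]
      simp
    refine ⟨homOf (V := coindObj n e V) l hc, epi_of_surj _ fun v =>
      ⟨(Pi.single (e 1) v : Fin n → V), ?_⟩⟩
    change l (Pi.single (e 1) v) = v
    rw [hl, Finset.sum_eq_single (e 1)]
    · simp
    · intro j _ hj
      simp [Pi.single_eq_of_ne hj]
    · simp
  · let l : V →ₗ[K] (Fin n → V) := LinearMap.pi fun j => V.ρ (e.symm j)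
    refine ⟨homOf (W := coindObj n e V) l ?_, mono_of_inj _ fun v w h => ?_⟩
    · intro g v
      funext j
      change V.ρ (e.symm j) (V.ρ g v) = V.ρ (e.symm (e (e.symm j * g))) v
      simp
    · have : V.ρ (e.symm (e 1)) v = V.ρ (e.symm (e 1)) w := congrFun h (e 1)
      simpa using this

/-- A projective module is a retract of a module of functions on `G`. -/
theorem retract_coindObj_of_projective (n : ℕ) (e : G ≃ Fin n) (P : FDRep K G)
    (hP : Projective P) : Nonempty (Retract P (coindObj n e P)) := by
  obtain ⟨p, hp⟩ := (exists_coindObj_epi_mono n e P).1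
  exact ⟨⟨Projective.factorThru (𝟙 P) p, p, Projective.factorThru_comp _ _⟩⟩

/-- The module of functions `G → P` is both projective and injective, and a projective or injective
`P` is a retract of it. -/
instance : Frobenius (FDRep K G) where
  projective_iff_injective P := by
    obtain ⟨n, ⟨e⟩⟩ := Finite.exists_equiv_fin G
    constructor
    · intro hP
      obtain ⟨r⟩ := retract_coindObj_of_projective n e P hP
      have := injective_coindObj n e P
      exact ⟨fun {X Y} g f hf => ⟨Injective.factorThru (g ≫ r.i) f ≫ r.r, by
        rw [← Category.assoc, Injective.comp_factorThru, Category.assoc, r.retract,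
          Category.comp_id]⟩⟩
    · intro hP
      obtain ⟨i, hi⟩ := (exists_coindObj_epi_mono n e P).2
      have := projective_coindObj n e P
      exact Retract.projective ⟨i, Injective.factorThru (𝟙 P) i, Injective.comp_factorThru _ _⟩

theorem isSyzygy_omega (M : FDRep K G) : IsSyzygy (omega M) M :=
  have h := (exists_projectiveCover M).choose_spec.choose_spec
  have := h.epi
  isSyzygy_kernel _ h.projective

theorem isSyzygy_omegaInv (M : FDRep K G) : IsSyzygy M (omegaInv M) :=
  have h := (exists_injectiveHull M).choose_spec.choose_spec
  have := h.mono
  isSyzygy_cokernel _ ((Frobenius.projective_iff_injective _).2 h.injective)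

theorem projectiveFree_omega (M : FDRep K G) : ProjectiveFree (omega M) :=
  projectiveFree_kernel (exists_projectiveCover M).choose_spec.choose_spec

theorem projectiveFree_omegaInv (M : FDRep K G) : ProjectiveFree (omegaInv M) :=
  projectiveFree_cokernel (exists_injectiveHull M).choose_spec.choose_spec

end Finite

theorem projectiveFree_omegaZero (M : FDRep K G) : ProjectiveFree (omegaZero M) :=
  (exists_projectiveFree_summand M).choose_spec.1

theorem exists_omegaZero_iso (M : FDRep K G) :
    ∃ P : FDRep K G, Projective P ∧ Nonempty (M ≅ omegaZero M ⊞ P) :=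
  (exists_projectiveFree_summand M).choose_spec.2

variable [Finite G]

/-- The stable class of a Heller translate. -/
theorem sc_heller (M : FDRep K G) (i : ℤ) :
    sc (heller M i) = ((syz (FDRep K G)) ^ i : (Stable (FDRep K G))ˣ) * sc M := by
  match i with
  | Int.ofNat 0 =>
    obtain ⟨P, hP, ⟨e⟩⟩ := exists_omegaZero_iso M
    change sc (omegaZero M) = _
    rw [sc_iso e, sc_biprod_projective _ hP]
    simp
  | Int.ofNat (n + 1) =>
    change sc (omega^[n + 1] M) = _
    induction n with
    | zero => simpa using (isSyzygy_omega M).sc_eq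
    | succ n ih =>
      rw [Function.iterate_succ_apply', (isSyzygy_omega _).sc_eq, ih]
      simp only [Int.ofNat_eq_natCast, zpow_natCast, Units.val_pow_eq_pow_val]
      rw [← mul_assoc, ← pow_succ']
  | Int.negSucc n =>
    change sc (omegaInv^[n + 1] M) = _
    induction n with
    | zero => simpa using (isSyzygy_omegaInv M).sc_eq'
    | succ n ih =>
      rw [Function.iterate_succ_apply', (isSyzygy_omegaInv _).sc_eq', ih, ← mul_assoc,
        ← Units.val_mul]
      congr 2
      simp only [zpow_negSucc]
      rw [pow_succ _ (n + 1), mul_inv_rev]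

theorem projectiveFree_heller (M : FDRep K G) (i : ℤ) : ProjectiveFree (heller M i) := by
  match i with
  | Int.ofNat 0 => exact projectiveFree_omegaZero M
  | Int.ofNat (n + 1) =>
    change ProjectiveFree (omega^[n + 1] M)
    rw [Function.iterate_succ_apply']
    exact projectiveFree_omega _
  | Int.negSucc n =>
    change ProjectiveFree (omegaInv^[n + 1] M)
    rw [Function.iterate_succ_apply']
    exact projectiveFree_omegaInv _

/-- Projective-free modules are determined by their stable classes, so isomorphisms with translates
become equations in the stable monoid. -/
theorem iso_heller_iff {M N : FDRep K G} {i : ℤ} (hN : ProjectiveFree N) :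
    Nonempty (heller M i ≅ N) ↔ ((syz (FDRep K G)) ^ i : (Stable (FDRep K G))ˣ) * sc M = sc N := by
  rw [← sc_heller]
  exact ⟨fun ⟨e⟩ => sc_iso e, fun h => (sc_eq_iff.1 h).iso K (projectiveFree_heller M i) hN⟩

theorem zpow_fix_iff {S : Type*} [CommMonoid S] (w : Sˣ) (x : S) :
    (∃ n : ℕ, 0 < n ∧ (w ^ n : Sˣ) * x = x) ↔ ∃ i : ℤ, i ≠ 0 ∧ (w ^ i : Sˣ) * x = x := by
  constructor
  · rintro ⟨n, hn, h⟩
    exact ⟨n, by exact_mod_cast hn.ne', by rwa [zpow_natCast]⟩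
  · rintro ⟨i, hi, h⟩
    refine ⟨i.natAbs, Int.natAbs_pos.2 hi, ?_⟩
    rw [← zpow_natCast]
    rcases Int.natAbs_eq i with h1 | h1
    · rwa [← h1]
    · have : ((i.natAbs : ℕ) : ℤ) = -i := by omega
      rw [this, zpow_neg, Units.inv_mul_eq_iff_eq_mul, h]

/-- A module is periodic if and only if its stable class is fixed by some power of the syzygy. -/
theorem isPeriodic_iff (M : FDRep K G) : IsPeriodic M ↔
    ∃ i : ℤ, i ≠ 0 ∧ ((syz (FDRep K G)) ^ i : (Stable (FDRep K G))ˣ) * sc M = sc M := by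
  rw [← zpow_fix_iff]
  refine exists_congr fun n => and_congr_right fun _ => ?_
  rw [iso_heller_iff (projectiveFree_heller M 0), sc_heller M 0, zpow_natCast, zpow_zero,
    Units.val_one, one_mul]

theorem isPeriodic_heller_iff (M : FDRep K G) (i : ℤ) : IsPeriodic (heller M i) ↔ IsPeriodic M := by
  rw [isPeriodic_iff, isPeriodic_iff]
  refine exists_congr fun n => and_congr_right fun _ => ?_
  rw [sc_heller, ← mul_assoc, mul_comm (Units.val _) (Units.val _), mul_assoc]
  exact Units.mul_right_inj _

theorem not_projective_of_not_isPeriodic {M : FDRep K G} (h : ¬ IsPeriodic M) :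
    ¬ Projective M := fun hp =>
  h ((isPeriodic_iff M).2 ⟨1, one_ne_zero, mul_sc_projective _ hp⟩)

/-- Heller translates of a non-projective indecomposable module are indecomposable. -/
theorem indecomposable_heller {B : FDRep K G} (hB : Indecomposable B) (hp : ¬ Projective B)
    (i : ℤ) : Indecomposable (heller B i) ∧ ¬ Projective (heller B i) := by
  have back : ∀ X : FDRep K G, sc X = sc (heller B i) → sc (heller X (-i)) = sc B := by
    intro X hX
    rw [sc_heller, hX, sc_heller, ← mul_assoc, ← Units.val_mul, ← zpow_add]
    simp
  have hnp : ¬ Projective (heller B i) := by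
    intro h
    have h1 := back _ rfl
    rw [sc_heller, mul_sc_projective _ h] at h1
    exact hp ((sc_eq_iff.1 h1.symm).projective h)
  refine ⟨⟨fun h0 => hnp h0.projective, fun Y Z e => ?_⟩, hnp⟩
  -- Shifting a decomposition of `Ω^i(B)` back by `-i` decomposes `B` stably. One shifted summand is
  -- then projective, hence so is the original one, which must vanish because `Ω^i(B)` is
  -- projective-free.
  have h1 : sc (heller Y (-i) ⊞ heller Z (-i)) = sc B := by
    rw [← back _ (sc_iso e.symm), sc_heller, eq_comm]
    exact mul_sc_biprod (sc_heller _ _).symm (sc_heller _ _).symm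
  have h3 : ∀ X : FDRep K G, Projective (heller X (-i)) → Projective X := by
    intro X hX
    have h2 : sc X = sc (heller X (-i)) := by
      have h4 := congrArg
        (fun t => (((syz (FDRep K G)) ^ i : (Stable (FDRep K G))ˣ) : Stable (FDRep K G)) * t)
        (sc_heller X (-i))
      simp only [mul_sc_projective _ hX, ← mul_assoc, ← Units.val_mul, ← zpow_add] at h4
      simpa using h4.symm
    exact (sc_eq_iff.1 h2).projective hX
  have hfree := projectiveFree_heller B i
  rcases StableIso.projective_or K hB (sc_eq_iff.1 h1.symm) with h | h
  · exact Or.inl (hfree.isZero_of_retract (h3 _ h) (retractInl e))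
  · exact Or.inr (hfree.isZero_of_retract (h3 _ h) (retractInr e))

end FDRep

/-! ### The Green ring and algebraic modules -/

namespace StableCat

section Powers

variable {C : Type u} [Category.{v} C] [MonoidalCategory C]

/-- The tensor powers of an object. -/
def tpow (M : C) : ℕ → C
  | 0 => 𝟙_ C
  | n + 1 => tpow M n ⊗ M

/-- The tensor product of two retracts. -/
def retractTensorHom {N M N' M' : C} (r : Retract N M) (r' : Retract N' M') :
    Retract (N ⊗ N') (M ⊗ M') :=
  ⟨r.i ⊗ₘ r'.i, r.r ⊗ₘ r'.r, by
    rw [tensorHom_comp_tensorHom, r.retract, r'.retract, id_tensorHom_id]⟩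

/-- Tensor powers preserve retracts. -/
def tpowRetract {N M : C} (r : Retract N M) : ∀ n, Retract (tpow N n) (tpow M n)
  | 0 => Retract.refl _
  | n + 1 => retractTensorHom (tpowRetract r n) r

/-- A fixed object tensored with a retract. -/
def tensorRetract {N M : C} (X : C) (r : Retract N M) : Retract (X ⊗ N) (X ⊗ M) :=
  retractTensorHom (Retract.refl X) r

end Powers

section
variable {C : Type u} [Category.{v} C] [Abelian C] [MonoidalCategory C] [BraidedCategory C]
  [MonoidalPreadditive C] [RightRigidCategory C]

theorem sc_tpow (M : C) (n : ℕ) : sc (tpow M n) = sc M ^ n := by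
  induction n with
  | zero => rw [pow_zero]; rfl
  | succ n ih => rw [pow_succ, ← ih]; rfl

end

end StableCat

namespace FDRep
open KrullSchmidt StableCat

variable {K : Type u} [Field K] {G : Type v} [Group G]

theorem greenClass_iso {A B : FDRep K G} (e : A ≅ B) : greenClass A = greenClass B := by
  rw [greenClass, greenClass, congr_toSkeleton_of_iso e]

theorem greenClass_tensor (A B : FDRep K G) :
    greenClass (A ⊗ B) = greenClass A * greenClass B := by
  rw [greenClass, Skeleton.toSkeleton_tensorObj, map_mul, map_mul]; rfl

theorem greenClass_unit : greenClass (𝟙_ (FDRep K G)) = 1 := by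
  rw [greenClass, ← Skeleton.one_eq, map_one, map_one]

theorem greenClass_biprod (A B : FDRep K G) :
    greenClass (A ⊞ B) = greenClass A + greenClass B := by
  rw [greenClass, greenClass, greenClass, ← map_add, Ideal.Quotient.eq]
  exact Ideal.subset_span ⟨A, B, rfl⟩

theorem greenClass_isZero {A : FDRep K G} (h : IsZero A) : greenClass A = 0 := by
  have h1 := greenClass_biprod A A
  rw [← greenClass_iso (isoBiprodZero h)] at h1
  simpa using h1.symm

theorem greenClass_tpow (M : FDRep K G) (n : ℕ) :
    greenClass (tpow M n) = greenClass M ^ n := by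
  induction n with
  | zero => rw [pow_zero, tpow, greenClass_unit]
  | succ n ih => rw [tpow, greenClass_tensor, ih, pow_succ]

/-- The multiplicity of an indecomposable module as an additive function on the group ring of
isomorphism classes. -/
noncomputable def skeletonMult (N : FDRep K G) (hN : Indecomposable N) :
    MonoidAlgebra ℤ (Skeleton (FDRep K G)) →+ ℤ :=
  MonoidAlgebra.liftNC (AddMonoidHom.id ℤ)
    (fun X => (mult K N ((fromSkeleton _).obj X) hN : ℤ))

theorem skeletonMult_of (N : FDRep K G) (hN : Indecomposable N) (X : FDRep K G) :
    skeletonMult N hN (MonoidAlgebra.of ℤ _ (toSkeleton X)) = mult K N X hN := by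
  rw [skeletonMult, MonoidAlgebra.of_apply, MonoidAlgebra.liftNC_single,
    mult_iso K hN (fromSkeletonToSkeletonIso X)]
  simp

/-- Multiplicities are additive but not multiplicative, so checking the generators of the ideal is
not enough; multiples are reduced to generators by distributivity of the tensor product. -/
theorem skeletonMult_mem_ideal (N : FDRep K G) (hN : Indecomposable N)
    (x : MonoidAlgebra ℤ (Skeleton (FDRep K G)))
    (hx : x ∈ Ideal.span {x : MonoidAlgebra ℤ (Skeleton (FDRep K G)) | ∃ A B : FDRep K G,
      x = MonoidAlgebra.of ℤ _ (toSkeleton (A ⊞ B)) -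
        (MonoidAlgebra.of ℤ _ (toSkeleton A) + MonoidAlgebra.of ℤ _ (toSkeleton B))}) :
    skeletonMult N hN x = 0 := by
  -- The claim is strengthened to all multiples of `x`, since span induction over the group ring
  -- needs stability under multiplication.
  suffices h : ∀ a, skeletonMult N hN (a * x) = 0 by simpa using h 1
  induction hx using Submodule.span_induction with
  | mem x hx =>
    obtain ⟨A, B, rfl⟩ := hx
    intro a
    induction a using MonoidAlgebra.induction_on with
    | of s =>
      obtain ⟨X, rfl⟩ : ∃ X, toSkeleton X = s := ⟨_, toSkeleton_fromSkeleton_obj s⟩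
      rw [mul_sub, mul_add, ← map_mul, ← map_mul, ← map_mul, ← Skeleton.toSkeleton_tensorObj,
        ← Skeleton.toSkeleton_tensorObj, ← Skeleton.toSkeleton_tensorObj, map_sub, map_add,
        skeletonMult_of, skeletonMult_of, skeletonMult_of, mult_iso K hN (tensorBiprod X A B),
        mult_biprod]
      push_cast
      ring
    | add a b ha hb => rw [add_mul, map_add, ha, hb, add_zero]
    | smul r a ha => rw [smul_mul_assoc, map_zsmul, ha, smul_zero]
  | zero => simp
  | add x y _ _ hx hy => intro a; rw [mul_add, map_add, hx, hy, add_zero]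
  | smul b x _ hx =>
    intro a
    rw [smul_eq_mul, ← mul_assoc]
    exact hx _

/-- The multiplicity of an indecomposable module as an additive function on the Green ring. -/
noncomputable def greenMult (N : FDRep K G) (hN : Indecomposable N) : GreenRing K G →+ ℤ :=
  QuotientAddGroup.lift _ (skeletonMult N hN) (skeletonMult_mem_ideal N hN)

theorem greenMult_greenClass (N : FDRep K G) (hN : Indecomposable N) (X : FDRep K G) :
    greenMult N hN (greenClass X) = mult K N X hN :=
  skeletonMult_of N hN X

/-! #### Algebraic modules are those with finitely many summands in their tensor powers -/

/-- Let `N` be an indecomposable summand of the tensor power whose exponent is the degree of the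
relation. Taking `N`-multiplicities, the non-zero top term must be cancelled, so `N` occurs in a
lower power. The polynomial need not be monic. -/
theorem exists_inAdd_of_isAlgebraicModule {M : FDRep K G} (h : IsAlgebraicModule M) :
    ∃ d, InAdd (tpow M '' Set.Iio d) (tpow M d) := by
  obtain ⟨f, hf, hfM⟩ := h
  refine ⟨f.natDegree, ?_⟩
  obtain ⟨S, -, hS, hS'⟩ := exists_finite_indecomposable K (tpow M f.natDegree)
  refine hS'.trans fun N hN => ?_
  obtain ⟨hN, ⟨r⟩⟩ := hS N hN
  have hsum := congrArg (greenMult N hN) hfM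
  rw [Polynomial.aeval_eq_sum_range, map_sum, map_zero] at hsum
  simp_rw [map_zsmul, ← greenClass_tpow, greenMult_greenClass] at hsum
  rw [Finset.sum_range_succ] at hsum
  obtain ⟨j, hj, hj'⟩ : ∃ j ∈ Finset.range f.natDegree, mult K N (tpow M j) hN ≠ 0 := by
    by_contra! hcon
    rw [Finset.sum_eq_zero fun j hj => by rw [hcon j hj]; simp, zero_add, smul_eq_mul] at hsum
    have h1 := mult_ne_zero_of_retract K hN r
    have h2 : f.coeff f.natDegree ≠ 0 := by simpa using hf
    exact (mul_ne_zero h2 (by exact_mod_cast h1)) hsum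
  obtain ⟨r'⟩ := retract_of_mult_ne_zero K hN hj'
  exact .of_retract ⟨j, by simpa using hj, rfl⟩ r'

theorem inAdd_tpow {M : FDRep K G} {d : ℕ} (h : InAdd (tpow M '' Set.Iio d) (tpow M d)) (n : ℕ) :
    InAdd (tpow M '' Set.Iio d) (tpow M n) := by
  induction n with
  | zero =>
    rcases Nat.eq_zero_or_pos d with rfl | hd
    · exact h
    · exact .of_mem ⟨0, hd, rfl⟩
  | succ n ih =>
    refine ih.map (tensorRight M) ?_
    rintro _ ⟨j, hj, rfl⟩
    rcases Nat.lt_or_ge (j + 1) d with hj' | hj'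
    · exact .of_mem ⟨j + 1, hj', rfl⟩
    · obtain rfl : d = j + 1 := le_antisymm hj' hj
      exact h

/-- By Krull–Schmidt the indecomposable summands of a module in the additive closure of `S` are
among the finitely many summands chosen for the members of `S`. -/
theorem exists_span_of_finite {S : Set (FDRep K G)} (hS : S.Finite) :
    ∃ T : Set (GreenRing K G), T.Finite ∧
      ∀ X, InAdd S X → greenClass X ∈ Submodule.span ℤ T := by
  choose I hI hI' hI'' using fun X : FDRep K G => exists_finite_indecomposable K X
  refine ⟨greenClass '' ⋃ F ∈ S, I F, (hS.biUnion fun F _ => hI F).image _, fun X => ?_⟩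
  refine decomposition_induction K (P := fun X => InAdd S X →
    greenClass X ∈ Submodule.span ℤ (greenClass '' ⋃ F ∈ S, I F)) ?_ ?_ X
  · intro X hX _
    rw [greenClass_isZero hX]
    exact zero_mem _
  · intro X N Y hN e ih hX
    rw [greenClass_iso e, greenClass_biprod]
    refine add_mem ?_ (ih (hX.retract (retractInr e)))
    have h1 : InAdd (⋃ F ∈ S, I F) N := (hX.retract (retractInl e)).trans fun F hF =>
      (hI'' F).mono (Set.subset_biUnion_of_mem hF)
    obtain ⟨F, hF, ⟨r⟩⟩ := h1.exists_retract K hN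
    have hFi : Indecomposable F := by
      obtain ⟨F', -, h2⟩ := Set.mem_iUnion₂.1 hF
      exact (hI' F' F h2).1
    obtain ⟨i⟩ := iso_of_retract hFi hN.1 r
    rw [greenClass_iso i]
    exact Submodule.subset_span ⟨F, hF, rfl⟩

/-- The ring generated by the class of `M` lies in a finitely generated abelian group, so the class
is even integral. -/
theorem isAlgebraicModule_of_inAdd {M : FDRep K G} {S : Set (FDRep K G)} (hS : S.Finite)
    (h : ∀ n, InAdd S (tpow M n)) : IsAlgebraicModule M := by
  obtain ⟨T, hT, hT'⟩ := exists_span_of_finite hS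
  have hint : IsIntegral ℤ (greenClass M) := by
    refine IsIntegral.of_mem_of_fg (Algebra.adjoin ℤ {greenClass M}) ?_ _
      (Algebra.self_mem_adjoin_singleton _ _)
    refine Submodule.FG.of_le (Submodule.fg_span hT) ?_
    intro x hx
    rw [Subalgebra.mem_toSubmodule, Algebra.adjoin_singleton_eq_range_aeval] at hx
    obtain ⟨p, rfl⟩ := hx
    change Polynomial.aeval (greenClass M) p ∈ _
    rw [Polynomial.aeval_eq_sum_range]
    refine sum_mem fun j _ => Submodule.smul_mem _ _ ?_
    rw [← greenClass_tpow]
    exact hT' _ (h j)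
  exact hint.isAlgebraic

theorem isAlgebraicModule_iff {M : FDRep K G} :
    IsAlgebraicModule M ↔ ∃ d, InAdd (tpow M '' Set.Iio d) (tpow M d) :=
  ⟨exists_inAdd_of_isAlgebraicModule, fun ⟨d, h⟩ =>
    isAlgebraicModule_of_inAdd ((Set.finite_Iio d).image _) (inAdd_tpow h)⟩

theorem IsAlgebraicModule.exists_finite {M : FDRep K G} (h : IsAlgebraicModule M) :
    ∃ S : Set (FDRep K G), S.Finite ∧ ∀ n, InAdd S (tpow M n) := by
  obtain ⟨d, hd⟩ := isAlgebraicModule_iff.1 h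
  exact ⟨_, (Set.finite_Iio d).image _, inAdd_tpow hd⟩

theorem IsAlgebraicModule.retract {M N : FDRep K G} (h : IsAlgebraicModule M)
    (r : Retract N M) : IsAlgebraicModule N := by
  obtain ⟨S, hS, hM⟩ := h.exists_finite
  exact isAlgebraicModule_of_inAdd hS fun n => (hM n).retract (tpowRetract r n)

theorem IsAlgebraicModule.iso {M N : FDRep K G} (h : IsAlgebraicModule M)
    (e : M ≅ N) : IsAlgebraicModule N := h.retract (Retract.ofIso e.symm)

theorem IsAlgebraicModule.biprod {M N : FDRep K G} (hM : IsAlgebraicModule M)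
    (hN : IsAlgebraicModule N) : IsAlgebraicModule (M ⊞ N) := by
  rw [IsAlgebraicModule, greenClass_biprod]
  exact IsAlgebraic.add hM hN

theorem isAlgebraicModule_unit : IsAlgebraicModule (𝟙_ (FDRep K G)) := by
  rw [IsAlgebraicModule, greenClass_unit]
  exact isAlgebraic_one

theorem isAlgebraicModule_tpow_iff {M : FDRep K G} {n : ℕ} (hn : 0 < n) :
    IsAlgebraicModule (tpow M n) ↔ IsAlgebraicModule M := by
  rw [IsAlgebraicModule, greenClass_tpow]
  exact ⟨IsAlgebraic.of_pow hn, fun h => IsAlgebraic.pow h n⟩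

variable [Finite G]

/-- The underlying linear map, as an additive homomorphism. -/
def linHom (V W : FDRep K G) : (V ⟶ W) →+ (V →ₗ[K] W) where
  toFun := lin
  map_zero' := rfl
  map_add' _ _ := rfl

/-- A basis of `V` splits the functions `G → V` into copies of the functions `G → K`. -/
theorem inAdd_coindObj (n : ℕ) (e : G ≃ Fin n) (V : FDRep K G) :
    InAdd {coindObj n e (𝟙_ (FDRep K G))} (coindObj n e V) := by
  let b := Module.finBasis K V
  let l (j : Fin (Module.finrank K V)) : (Fin n → V) →ₗ[K] (Fin n → K) := (b.coord j).compLeft _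
  let l' (j : Fin (Module.finrank K V)) : (Fin n → K) →ₗ[K] (Fin n → V) :=
    (LinearMap.toSpanSingleton K V (b j)).compLeft _
  let f (j) : coindObj n e V ⟶ coindObj n e (𝟙_ (FDRep K G)) :=
    homOf (V := coindObj n e V) (W := coindObj n e (𝟙_ (FDRep K G))) (l j) fun g x => rfl
  let f' (j) : coindObj n e (𝟙_ (FDRep K G)) ⟶ coindObj n e V :=
    homOf (V := coindObj n e (𝟙_ (FDRep K G))) (W := coindObj n e V) (l' j) fun g x => by
      funext i; rfl
  have hsum : 𝟙 (coindObj n e V) = ∑ j, f j ≫ f' j := by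
    refine lin_ext fun x => ?_
    change x = linHom _ _ (∑ j, f j ≫ f' j) x
    rw [map_sum, LinearMap.sum_apply]
    funext i
    exact (b.sum_repr (x i)).symm.trans (Finset.sum_apply i _ (fun j => l' j (l j x))).symm
  rw [InAdd, hsum]
  exact sum_mem fun j _ => AddSubgroup.subset_closure ⟨_, rfl, _, _, rfl⟩

/-- Every positive tensor power is projective, hence a summand of copies of one fixed module, the
functions `G → K`. -/
theorem isAlgebraicModule_of_projective {P : FDRep K G} (hP : Projective P) :
    IsAlgebraicModule P := by
  obtain ⟨n, ⟨e⟩⟩ := Finite.exists_equiv_fin G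
  have key : ∀ Q : FDRep K G, Projective Q → InAdd {coindObj n e (𝟙_ (FDRep K G))} Q :=
    fun Q hQ => (inAdd_coindObj n e Q).retract (retract_coindObj_of_projective n e Q hQ).some
  refine isAlgebraicModule_of_inAdd
    (S := {coindObj n e (𝟙_ (FDRep K G)), 𝟙_ (FDRep K G)}) (by simp) fun k => ?_
  cases k with
  | zero => exact .of_mem (by simp [tpow])
  | succ k => exact (key _ (projective_tensor _ _ hP)).mono (by simp)

theorem isAlgebraicModule_of_sc_eq {M N : FDRep K G} (h : sc M = sc N)
    (hM : IsAlgebraicModule M) : IsAlgebraicModule N := by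
  obtain ⟨P, Q, hP, hQ, ⟨e⟩⟩ := sc_eq_iff.1 h
  exact ((hM.biprod (isAlgebraicModule_of_projective hP)).iso e).retract
    (retractInl (Iso.refl _))

/-- Heller translates of periodic algebraic modules are algebraic. -/
theorem isAlgebraicModule_heller_of_isPeriodic {M : FDRep K G} (hM : IsAlgebraicModule M)
    (hp : IsPeriodic M) (i : ℤ) : IsAlgebraicModule (heller M i) := by
  obtain ⟨n, hn, h⟩ := (zpow_fix_iff _ _).2 ((isPeriodic_iff M).1 hp)
  -- Passing to the `n`-th tensor power turns the shift by `i` into a shift by `i * n`, which acts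
  -- trivially since `Ω^n` fixes `M` stably.
  rw [← isAlgebraicModule_tpow_iff hn]
  refine isAlgebraicModule_of_sc_eq ?_ ((isAlgebraicModule_tpow_iff hn).2 hM)
  rw [sc_tpow, sc_tpow, sc_heller, mul_pow, ← Units.val_pow_eq_pow_val, ← zpow_natCast,
    ← zpow_mul, mul_comm i, zpow_mul, zpow_natCast]
  have key : ∀ j : ℤ, (((syz (FDRep K G)) ^ n) ^ j : (Stable (FDRep K G))ˣ) * sc M = sc M := by
    have h1 : (syz (FDRep K G)) ^ n ∈ MulAction.stabilizer (Stable (FDRep K G))ˣ (sc M) := h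
    exact fun j => zpow_mem h1 j
  obtain ⟨k, rfl⟩ : ∃ k, n = k + 1 := ⟨n - 1, by omega⟩
  rw [pow_succ' (sc M), ← mul_assoc, key]

end FDRep

/-! ### Non-periodic algebraic modules -/

namespace FDRep
open KrullSchmidt StableCat

variable {K : Type u} [Field K] {G : Type v} [Group G]

theorem exists_finite_indecomposable_set {S : Set (FDRep K G)} (hS : S.Finite) :
    ∃ T : Set (FDRep K G), T.Finite ∧ (∀ N ∈ T, Indecomposable N) ∧ ∀ F ∈ S, InAdd T F := by
  choose I hI hI' hI'' using fun X : FDRep K G => exists_finite_indecomposable K X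
  refine ⟨⋃ F ∈ S, I F, hS.biUnion fun F _ => hI F, fun N hN => ?_, fun F hF =>
    (hI'' F).mono (Set.subset_biUnion_of_mem hF)⟩
  obtain ⟨F, -, h⟩ := Set.mem_iUnion₂.1 hN
  exact (hI' F N h).1

variable [Finite G]

theorem inAdd_of_sc_eq {S : Set (FDRep K G)} {X Y : FDRep K G} (h : sc X = sc Y)
    (hY : InAdd (S ∪ {P | Projective P}) Y) : InAdd (S ∪ {P | Projective P}) X := by
  obtain ⟨P, Q, hP, hQ, ⟨e⟩⟩ := sc_eq_iff.1 h
  exact (InAdd.iso (.biprod hY (.of_mem (Or.inr hQ))) e).retract (retractInl (Iso.refl _))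

theorem isPeriodic_of_sc_eq {X Y : FDRep K G} (h : sc X = sc Y) (hY : IsPeriodic Y) :
    IsPeriodic X := by
  rw [isPeriodic_iff] at *
  rwa [h]

theorem sc_heller_tensor (i : ℤ) (B : FDRep K G) : sc (heller (𝟙_ (FDRep K G)) i ⊗ B) =
    ((syz (FDRep K G)) ^ i : (Stable (FDRep K G))ˣ) * sc B := by
  rw [sc_tensor, sc_heller, sc_one, mul_one]

/-- If the translates of an indecomposable module lie in a finite set up to isomorphism, two of them
coincide. -/
theorem zpow_fix_of_indecomposable {S : Set (FDRep K G)} (hS : S.Finite)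
    (hind : ∀ N ∈ S, Indecomposable N) {B : FDRep K G} (hB : Indecomposable B)
    (hp : ¬ Projective B) (l : ℤ)
    (h : ∀ t : ℕ, t ≤ S.ncard →
      InAdd (S ∪ {P | Projective P}) (heller (𝟙_ (FDRep K G)) (l * t) ⊗ B)) :
    ((syz (FDRep K G)) ^ (l * (S.ncard.factorial : ℤ)) : (Stable (FDRep K G))ˣ) * sc B = sc B := by
  -- Each translate is indecomposable and non-projective, so lying in the additive closure forces it
  -- to be isomorphic to a member of `S`.
  have h1 : ∀ t : Fin (S.ncard + 1), ∃ F : S, Nonempty (heller B (l * (t : ℕ)) ≅ F) := by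
    intro t
    obtain ⟨hi, hn⟩ := indecomposable_heller hB hp (l * (t : ℕ))
    have h2 : InAdd (S ∪ {P | Projective P}) (heller B (l * (t : ℕ))) :=
      inAdd_of_sc_eq (by rw [sc_heller_tensor, sc_heller]) (h t (Nat.lt_succ_iff.1 t.2))
    obtain ⟨F, hF, ⟨r⟩⟩ := h2.exists_retract K hi
    rcases hF with hF | hF
    · exact ⟨⟨F, hF⟩, iso_of_retract (hind F hF) hi.1 r⟩
    · have : Projective F := hF
      exact absurd r.projective hn
  choose F hF using h1
  have := hS.fintype
  obtain ⟨a, b, hab, hFab⟩ := Fintype.exists_ne_map_eq_of_card_lt F (by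
    rw [Fintype.card_fin, ← Nat.card_eq_fintype_card, Nat.card_coe_set_eq]
    exact Nat.lt_succ_self _)
  have key : ∀ a b : Fin (S.ncard + 1), a < b → F a = F b → (syz (FDRep K G)) ^
      (l * (S.ncard.factorial : ℤ)) ∈ MulAction.stabilizer (Stable (FDRep K G))ˣ (sc B) := by
    intro a b hab hFab
    have h3 : sc (heller B (l * (a : ℕ))) = sc (heller B (l * (b : ℕ))) := by
      rw [sc_iso (hF a).some, sc_iso (hF b).some, hFab]
    rw [sc_heller, sc_heller] at h3
    have h4 : (syz (FDRep K G)) ^ (l * ((b : ℕ) - (a : ℕ) : ℕ) : ℤ) ∈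
        MulAction.stabilizer (Stable (FDRep K G))ˣ (sc B) := by
      rw [Nat.cast_sub hab.le, mul_sub, zpow_sub, mul_comm, MulAction.mem_stabilizer_iff, mul_smul]
      change _ • (((syz (FDRep K G)) ^ (l * (b : ℕ)) : (Stable (FDRep K G))ˣ) * sc B) = _
      rw [← h3]
      exact inv_smul_smul _ (sc B)
    -- The difference of two coinciding indices is at most `S.ncard`, so it divides the factorial;
    -- this makes the exponent independent of `B`.
    obtain ⟨k, hk⟩ := Nat.dvd_factorial (Nat.sub_pos_of_lt hab)
      (le_trans (Nat.sub_le _ _) (Nat.lt_succ_iff.1 b.2))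
    rw [hk, Nat.cast_mul, ← mul_assoc, zpow_mul]
    exact zpow_mem h4 _
  rcases lt_or_gt_of_ne hab with h3 | h3
  · exact key a b h3 hFab
  · exact key b a h3 hFab.symm

/-- The exponent is the same for all indecomposable summands, so one power of the syzygy fixes them
simultaneously; projective summands are absorbed. -/
theorem zpow_fix_of_inAdd {S : Set (FDRep K G)} (hS : S.Finite)
    (hind : ∀ N ∈ S, Indecomposable N) (B : FDRep K G) (l : ℤ)
    (h : ∀ t : ℕ, t ≤ S.ncard →
      InAdd (S ∪ {P | Projective P}) (heller (𝟙_ (FDRep K G)) (l * t) ⊗ B)) :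
    ((syz (FDRep K G)) ^ (l * (S.ncard.factorial : ℤ)) : (Stable (FDRep K G))ˣ) * sc B = sc B := by
  revert h
  refine decomposition_induction K (P := fun B : FDRep K G => (∀ t : ℕ, t ≤ S.ncard →
      InAdd (S ∪ {P | Projective P}) (heller (𝟙_ (FDRep K G)) (l * t) ⊗ B)) →
    ((syz (FDRep K G)) ^ (l * (S.ncard.factorial : ℤ)) : (Stable (FDRep K G))ˣ) * sc B = sc B)
    ?_ ?_ B
  · intro X hX _
    exact mul_sc_projective _ hX.projective
  · intro X N Y hN e ih h
    rw [sc_iso e]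
    refine mul_sc_biprod ?_ (ih fun t ht => (h t ht).retract (tensorRetract _ (retractInr e)))
    by_cases hp : Projective N
    · exact mul_sc_projective _ hp
    · exact zpow_fix_of_indecomposable hS hind hN hp l
        fun t ht => (h t ht).retract (tensorRetract _ (retractInl e))

/-- Direct summands of periodic modules are periodic. -/
theorem IsPeriodic.retract {B C : FDRep K G} (hC : IsPeriodic C) (r : Retract B C) :
    IsPeriodic B := by
  obtain ⟨i, hi, h⟩ := (isPeriodic_iff C).1 hC
  obtain ⟨S, hS, hS', hSC⟩ := exists_finite_indecomposable K C
  refine (isPeriodic_iff B).2 ⟨i * (S.ncard.factorial : ℤ),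
    mul_ne_zero hi (by exact_mod_cast Nat.factorial_ne_zero _),
    zpow_fix_of_inAdd hS (fun N hN => (hS' N hN).1) B i fun t _ => ?_⟩
  refine InAdd.retract ?_ (tensorRetract _ r)
  -- The translates of `C` by multiples of its period are stably `C`, so the finitely many summands
  -- of `C` suffice for all of them.
  refine inAdd_of_sc_eq ?_ (hSC.mono Set.subset_union_left)
  rw [sc_heller_tensor, zpow_mul]
  have h1 : (syz (FDRep K G)) ^ i ∈ MulAction.stabilizer (Stable (FDRep K G))ˣ (sc C) := h
  exact zpow_mem h1 _

theorem IsPeriodic.tensor {A : FDRep K G} (hA : IsPeriodic A) (X : FDRep K G) :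
    IsPeriodic (A ⊗ X) := by
  obtain ⟨i, hi, h⟩ := (isPeriodic_iff A).1 hA
  exact (isPeriodic_iff _).2 ⟨i, hi, by rw [sc_tensor, ← mul_assoc, h]⟩

omit [Finite G] in
/-- A module is a direct summand of `M ⊗ M* ⊗ M`. -/
theorem retract_tensor_dual (M : FDRep K G) : Nonempty (Retract M ((M ⊗ Mᘁ) ⊗ M)) := by
  refine ⟨⟨(λ_ M).inv ≫ η_ M Mᘁ ▷ M, (α_ M Mᘁ M).hom ≫ M ◁ ε_ M Mᘁ ≫ (ρ_ M).hom, ?_⟩⟩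
  have := ExactPairing.evaluation_coevaluation M Mᘁ
  rw [Category.assoc, reassoc_of% this]
  simp

/-- The exponent drops by one at a time: since `M` is a summand of `M ⊗ M* ⊗ M`, each positive
tensor power of `M` is stably a summand of the next one tensored with `M*`. -/
theorem isPeriodic_of_isPeriodic_tpow {M : FDRep K G} {n : ℕ} (h : IsPeriodic (tpow M (n + 1))) :
    IsPeriodic M := by
  induction n with
  | zero => exact isPeriodic_of_sc_eq (by rw [sc_tpow, zero_add, pow_one]) h
  | succ n ih =>
    refine ih ?_
    obtain ⟨r⟩ := retract_tensor_dual M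
    refine IsPeriodic.retract ?_ (tensorRetract (tpow M n) r)
    refine isPeriodic_of_sc_eq ?_ (h.tensor (Mᘁ))
    simp only [sc_tensor, sc_tpow, pow_succ]
    ac_rfl

/-- If two different Heller translates of a module are algebraic, the module is periodic. -/
theorem isPeriodic_of_isAlgebraicModule {M : FDRep K G} (hM : IsAlgebraicModule M) {l : ℤ}
    (hl : l ≠ 0) (hV : IsAlgebraicModule (heller M l)) : IsPeriodic M := by
  obtain ⟨S₁, hS₁, h₁⟩ := hM.exists_finite
  obtain ⟨S₂, hS₂, h₂⟩ := hV.exists_finite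
  -- `S` collects the indecomposable summands of all mixed products of powers of `M` and of
  -- `Ω^l(M)`.
  obtain ⟨S, hS, hind, hadd⟩ := exists_finite_indecomposable_set
    (Set.Finite.image2 (fun X Y : FDRep K G => X ⊗ Y) hS₁ hS₂)
  have h3 : ∀ a b, InAdd S (tpow M a ⊗ tpow (heller M l) b) := by
    intro a b
    refine (h₁ a).map (tensorRight (tpow (heller M l) b)) fun F hF => ?_
    exact (h₂ b).map (tensorLeft F) fun F' hF' => hadd _ ⟨F, hF, F', hF', rfl⟩
  refine isPeriodic_of_isPeriodic_tpow (n := S.ncard) ((isPeriodic_iff _).2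
    ⟨l * (S.ncard.factorial : ℤ), mul_ne_zero hl (by exact_mod_cast Nat.factorial_ne_zero _),
      zpow_fix_of_inAdd hS hind _ l fun t ht => ?_⟩)
  -- With `N = S.ncard + 1`, replacing `t` of the `N` factors `M` by `Ω^l(M)` shifts the `N`-th
  -- power by `l * t`; all values `t ≤ S.ncard` needed for the pigeonhole are available.
  refine inAdd_of_sc_eq ?_ ((h3 (S.ncard + 1 - t) t).mono Set.subset_union_left)
  rw [sc_heller_tensor, sc_tensor, sc_tpow, sc_tpow, sc_tpow, sc_heller, mul_pow,
    ← Units.val_pow_eq_pow_val, zpow_mul, zpow_natCast, mul_left_comm, ← pow_add,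
    Nat.sub_add_cancel (by omega)]

theorem heller_unique {M : FDRep K G} (hM : ¬ IsPeriodic M) {i j : ℤ}
    (hi : IsAlgebraicModule (heller M i)) (hj : IsAlgebraicModule (heller M j)) : i = j := by
  by_contra hij
  refine hM ((isPeriodic_heller_iff M i).1
    (isPeriodic_of_isAlgebraicModule hi (l := j - i) (by omega) ?_))
  refine isAlgebraicModule_of_sc_eq ?_ hj
  rw [sc_heller, sc_heller, sc_heller, ← mul_assoc, ← Units.val_mul, ← zpow_add, sub_add_cancel]

theorem isAlgebraicModule_heller_zero_iff {M : FDRep K G} :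
    IsAlgebraicModule (heller M 0) ↔ IsAlgebraicModule M := by
  have h : sc (heller M 0) = sc M := by rw [sc_heller, zpow_zero, Units.val_one, one_mul]
  exact ⟨isAlgebraicModule_of_sc_eq h, isAlgebraicModule_of_sc_eq h.symm⟩

theorem isAlgebraicModule_heller_iff {M : FDRep K G} (hM : ¬ IsPeriodic M)
    (ha : IsAlgebraicModule M) (i : ℤ) : IsAlgebraicModule (heller M i) ↔ i = 0 := by
  constructor
  · exact fun h => heller_unique hM h (isAlgebraicModule_heller_zero_iff.2 ha)
  · rintro rfl
    exact isAlgebraicModule_heller_zero_iff.2 ha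

end FDRep

/-! ### Duality -/

namespace FDRep
open KrullSchmidt StableCat

variable {K : Type u} [Field K] {G : Type v} [Group G]

/-- The isomorphism given by an equivariant linear equivalence. -/
noncomputable def isoOf {V W : FDRep K G} (l : V ≃ₗ[K] W)
    (h : ∀ g v, l (V.ρ g v) = W.ρ g (l v)) : V ≅ W where
  hom := homOf l.toLinearMap h
  inv := homOf l.symm.toLinearMap fun g w => by
    apply l.injective
    change l (l.symm _) = l (V.ρ g (l.symm w))
    rw [h]; simp
  hom_inv_id := lin_ext fun v => l.symm_apply_apply v
  inv_hom_id := lin_ext fun v => l.apply_symm_apply v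

/-- Evaluation of a linear form in the dual module. -/
def dualEval {V : FDRep K G} (φ : dualModule V) (v : V) : K := (show Module.Dual K V from φ) v

theorem dual_ext {V : FDRep K G} {φ ψ : dualModule V} (h : ∀ v, dualEval φ v = dualEval ψ v) :
    φ = ψ :=
  LinearMap.ext (f := (show Module.Dual K V from φ)) (g := (show Module.Dual K V from ψ)) h

theorem dualEval_ρ {V : FDRep K G} (g : G) (φ : dualModule V) (v : V) :
    dualEval ((dualModule V).ρ g φ) v = dualEval φ (V.ρ g⁻¹ v) := rfl

/-- The dual of a morphism. -/
noncomputable def dualHom {V W : FDRep K G} (f : V ⟶ W) : dualModule W ⟶ dualModule V :=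
  homOf (V := dualModule W) (W := dualModule V) (lin f).dualMap fun g φ => by
    refine dual_ext fun v => ?_
    change dualEval φ (W.ρ g⁻¹ (lin f v)) = dualEval φ (lin f (V.ρ g⁻¹ v))
    rw [lin_comm]

theorem dualHom_comp {V W X : FDRep K G} (f : V ⟶ W) (g : W ⟶ X) :
    dualHom (f ≫ g) = dualHom g ≫ dualHom f := rfl

theorem dualHom_id (V : FDRep K G) : dualHom (𝟙 V) = 𝟙 (dualModule V) := rfl

/-- Duality is additive. -/
noncomputable def dualAddHom (V W : FDRep K G) : (V ⟶ W) →+ (dualModule W ⟶ dualModule V) where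
  toFun := dualHom
  map_zero' := lin_ext fun φ => dual_ext fun _ =>
    map_zero (show Module.Dual K W from φ)
  map_add' f g := lin_ext fun φ => dual_ext fun v =>
    map_add (show Module.Dual K W from φ) (lin f v) (lin g v)

theorem dualHom_zero (V W : FDRep K G) : dualHom (0 : V ⟶ W) = 0 := (dualAddHom V W).map_zero

theorem dualHom_add {V W : FDRep K G} (f g : V ⟶ W) : dualHom (f + g) = dualHom f + dualHom g :=
  (dualAddHom V W).map_add f g

/-- The dual of a direct sum decomposition. -/
theorem dual_biprod (A B : FDRep K G) :
    Nonempty (dualModule (A ⊞ B) ≅ dualModule A ⊞ dualModule B) := by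
  refine ⟨⟨biprod.lift (dualHom biprod.inl) (dualHom biprod.inr),
    biprod.desc (dualHom biprod.fst) (dualHom biprod.snd), ?_, ?_⟩⟩
  · rw [biprod.lift_desc, ← dualHom_comp, ← dualHom_comp, ← dualHom_add, biprod.total, dualHom_id]
  · apply biprod.hom_ext' <;> apply biprod.hom_ext <;>
      simp only [biprod.inl_desc_assoc, biprod.inr_desc_assoc, Category.assoc, biprod.lift_fst,
        biprod.lift_snd, ← dualHom_comp, biprod.inl_fst, biprod.inl_snd, biprod.inr_fst,
        biprod.inr_snd, dualHom_id, dualHom_zero, Category.comp_id]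

theorem inAdd_dualModule {S : Set (FDRep K G)} {X : FDRep K G} (h : InAdd S X) :
    InAdd (dualModule '' S) (dualModule X) := by
  have hle : AddSubgroup.closure {h : X ⟶ X | ∃ F ∈ S, ∃ (f : X ⟶ F) (g : F ⟶ X), f ≫ g = h} ≤
      (AddSubgroup.closure {h : dualModule X ⟶ dualModule X | ∃ F ∈ dualModule '' S,
        ∃ (f : dualModule X ⟶ F) (g : F ⟶ dualModule X), f ≫ g = h}).comap (dualAddHom X X) := by
    rw [AddSubgroup.closure_le]
    rintro _ ⟨F, hF, a, b, rfl⟩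
    exact AddSubgroup.subset_closure ⟨_, ⟨F, hF, rfl⟩, dualHom b, dualHom a, (dualHom_comp a b).symm⟩
  have h1 := hle h
  rwa [AddSubgroup.mem_comap, show dualAddHom X X (𝟙 X) = 𝟙 _ from dualHom_id X] at h1

/-- The dual of a tensor product. -/
theorem dual_tensor (A B : FDRep K G) :
    Nonempty (dualModule A ⊗ dualModule B ≅ dualModule (A ⊗ B)) := by
  refine ⟨isoOf (V := dualModule A ⊗ dualModule B) (W := dualModule (A ⊗ B))
    (TensorProduct.dualDistribEquiv K A B) fun g x => ?_⟩
  have h : (TensorProduct.dualDistribEquiv K A B).toLinearMap ∘ₗ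
      TensorProduct.map (Representation.dual A.ρ g) (Representation.dual B.ρ g) =
      (TensorProduct.map (A.ρ g⁻¹) (B.ρ g⁻¹)).dualMap ∘ₗ
        (TensorProduct.dualDistribEquiv K A B).toLinearMap :=
    TensorProduct.ext' fun φ ψ => TensorProduct.ext' fun a b => rfl
  exact LinearMap.congr_fun h x

theorem dual_unit : Nonempty (𝟙_ (FDRep K G) ≅ dualModule (𝟙_ (FDRep K G))) := by
  refine ⟨isoOf (V := 𝟙_ (FDRep K G)) (W := dualModule (𝟙_ (FDRep K G)))
    (LinearMap.ringLmapEquivSelf K K K).symm fun g x => rfl⟩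

theorem dual_tpow (M : FDRep K G) (n : ℕ) :
    Nonempty (tpow (dualModule M) n ≅ dualModule (tpow M n)) := by
  induction n with
  | zero => exact dual_unit
  | succ n ih => exact ⟨(ih.some ⊗ᵢ Iso.refl _) ≪≫ (dual_tensor _ _).some⟩

/-- The dual of an algebraic module is algebraic. -/
theorem isAlgebraicModule_dualModule {M : FDRep K G} (h : IsAlgebraicModule M) :
    IsAlgebraicModule (dualModule M) := by
  obtain ⟨S, hS, hM⟩ := h.exists_finite
  exact isAlgebraicModule_of_inAdd (hS.image dualModule) fun n =>
    (inAdd_dualModule (hM n)).iso (dual_tpow M n).some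

/-- Morphisms into a dual correspond to bilinear forms. -/
noncomputable def flipHom {X Y : FDRep K G} (t : X ⟶ dualModule Y) : Y ⟶ dualModule X :=
  homOf (V := Y) (W := dualModule X)
    (LinearMap.flip (show X →ₗ[K] Y →ₗ[K] K from lin t)) fun g y => by
    refine dual_ext fun x => ?_
    change dualEval (lin t x) (Y.ρ g y) = dualEval (lin t (X.ρ g⁻¹ x)) y
    rw [lin_comm, dualEval_ρ, inv_inv]

theorem flipHom_comp_dualHom {X Y Z : FDRep K G} (t : X ⟶ dualModule Y) (f : Z ⟶ Y) :
    flipHom (t ≫ dualHom f) = f ≫ flipHom t := rfl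

theorem flipHom_comp {X Y Z : FDRep K G} (t : X ⟶ dualModule Y) (f : Z ⟶ X) :
    flipHom (f ≫ t) = flipHom t ≫ dualHom f := rfl

theorem flipHom_flipHom {X Y : FDRep K G} (t : X ⟶ dualModule Y) : flipHom (flipHom t) = t := rfl

theorem epi_dualHom {V W : FDRep K G} (f : V ⟶ W) [Mono f] : Epi (dualHom f) :=
  epi_of_surj _ (LinearMap.dualMap_surjective_of_injective (lin_injective f))

theorem mono_dualHom {V W : FDRep K G} (f : V ⟶ W) [Epi f] : Mono (dualHom f) :=
  mono_of_inj _ (LinearMap.dualMap_injective_of_surjective (lin_surjective f))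

variable [Finite G]

/-- Maps `X ⟶ P*` correspond to maps `P ⟶ X*`, and extension along a monomorphism becomes lifting
along its dual epimorphism. So `P*` is injective, hence projective. -/
theorem projective_dualModule {P : FDRep K G} (hP : Projective P) : Projective (dualModule P) := by
  refine (Frobenius.projective_iff_injective _).2 ⟨fun {X Y} u m hm => ?_⟩
  have := epi_dualHom m
  refine ⟨flipHom (Projective.factorThru (flipHom u) (dualHom m)), ?_⟩
  have h := flipHom_comp (flipHom (Projective.factorThru (flipHom u) (dualHom m))) m
  rw [flipHom_flipHom, Projective.factorThru_comp] at h
  rw [← flipHom_flipHom (m ≫ _), h, flipHom_flipHom]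

theorem stableIso_dualModule {M N : FDRep K G} (h : StableIso M N) :
    StableIso (dualModule M) (dualModule N) := by
  obtain ⟨P, Q, hP, hQ, ⟨e⟩⟩ := h
  exact ⟨dualModule P, dualModule Q, projective_dualModule hP, projective_dualModule hQ,
    ⟨(dual_biprod M P).some.symm ≪≫
      ⟨dualHom e.inv, dualHom e.hom, by rw [← dualHom_comp, e.hom_inv_id, dualHom_id],
        by rw [← dualHom_comp, e.inv_hom_id, dualHom_id]⟩ ≪≫ (dual_biprod N Q).some⟩⟩

/-- Duality is exact, reverses arrows and preserves projectives. The kernel property is checked by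
transposing a map into the dual of `P` to a map out of `P` and using that `p` is a cokernel of `i`.
-/
theorem isSyzygy_dual {N M : FDRep K G} (h : IsSyzygy N M) :
    IsSyzygy (dualModule M) (dualModule N) := by
  obtain ⟨P, i, p, w, hP, hp, ⟨hl⟩⟩ := h
  have hi : Mono i := mono_of_isLimit_fork hl
  have hc := Abelian.epiIsCokernelOfKernel _ hl
  have := epi_dualHom i
  have := mono_dualHom p
  refine ⟨dualModule P, dualHom p, dualHom i, ?_, projective_dualModule hP, inferInstance, ⟨?_⟩⟩
  · rw [← dualHom_comp, w, dualHom_zero]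
  · refine KernelFork.IsLimit.ofι' _ _ fun {T} t ht => ?_
    have h1 : i ≫ flipHom t = 0 := by
      rw [← flipHom_comp_dualHom, ht]; rfl
    obtain ⟨s, hs⟩ := CokernelCofork.IsColimit.desc' hc (flipHom t) h1
    refine ⟨flipHom s, ?_⟩
    have hs' : p ≫ s = flipHom t := hs
    rw [← flipHom_flipHom t, ← hs', flipHom_comp]

variable (K G) in
/-- Duality as an endomorphism of the monoid of stable classes. -/
noncomputable def stableDual : Stable (FDRep K G) →* Stable (FDRep K G) where
  toFun := Quotient.map dualModule fun _ _ h => stableIso_dualModule h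
  map_one' := sc_iso dual_unit.some.symm
  map_mul' := by
    rintro ⟨X⟩ ⟨Y⟩
    exact sc_iso (dual_tensor X Y).some.symm

theorem stableDual_sc (M : FDRep K G) : stableDual K G (sc M) = sc (dualModule M) := rfl

/-- Dualising the syzygy sequence of the unit exhibits the self-dual unit as a syzygy of the dual of
`Ω(K)`. -/
theorem stableDual_syz : Units.map (stableDual K G) (syz (FDRep K G)) = (syz (FDRep K G))⁻¹ := by
  have h := isSyzygy_omega (𝟙_ (FDRep K G))
  have h1 := (isSyzygy_dual h).sc_eq
  rw [← sc_iso dual_unit.some, ← stableDual_sc, h.sc_eq, sc_one, mul_one] at h1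
  rw [eq_inv_iff_mul_eq_one, mul_comm]
  exact Units.ext h1.symm

theorem sc_dualModule_heller (M : FDRep K G) (i : ℤ) :
    sc (dualModule (heller M i)) = sc (heller (dualModule M) (-i)) := by
  rw [← stableDual_sc, sc_heller, map_mul, sc_heller, zpow_neg, ← inv_zpow, ← stableDual_syz,
    ← map_zpow, stableDual_sc]
  rfl

/-- The dual of `Ω^i(M)` is algebraic and stably `Ω^{-i}(M)`, so uniqueness of the algebraic
translate gives `i = -i`. -/
theorem eq_zero_of_isSelfDual {M : FDRep K G} (hM : ¬ IsPeriodic M) (hd : IsSelfDual M) {i : ℤ}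
    (hi : IsAlgebraicModule (heller M i)) : i = 0 ∧ IsAlgebraicModule M := by
  have h : IsAlgebraicModule (heller M (-i)) := by
    refine isAlgebraicModule_of_sc_eq ?_ (isAlgebraicModule_dualModule hi)
    rw [sc_dualModule_heller, sc_heller, sc_heller, ← sc_iso hd.some]
  obtain rfl : i = 0 := by
    have := heller_unique hM hi h
    omega
  exact ⟨rfl, isAlgebraicModule_heller_zero_iff.1 hi⟩

end FDRep

/-! ### Change of groups -/

namespace FDRep
open KrullSchmidt StableCat

variable {K : Type u} [Field K] {G : Type v} [Group G] {H : Type w} [Group H]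

/-- Higman's criterion: a module whose identity is a trace is projective. -/
theorem projective_of_trace [Fintype H] (X : FDRep K H) (θ : X →ₗ[K] X)
    (h : ∀ x, ∑ g : H, X.ρ g (θ (X.ρ g⁻¹ x)) = x) : Projective X := by
  constructor
  intro E B u p hp
  obtain ⟨r, hr⟩ := (lin p).exists_rightInverse_of_surjective
    (LinearMap.range_eq_top.2 (lin_surjective p))
  -- The linear section `r` need not be equivariant; averaging over the group repairs this, and the
  -- trace hypothesis shows that the average still lifts `u`.
  let l : X →ₗ[K] E := ∑ g : H, (E.ρ g).comp (r.comp ((lin u).comp (θ.comp (X.ρ g⁻¹))))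
  have hl : ∀ x, l x = ∑ g : H, E.ρ g (r (lin u (θ (X.ρ g⁻¹ x)))) := fun x => by
    simp [l, LinearMap.sum_apply]
  refine ⟨homOf l fun a x => ?_, lin_ext fun x => ?_⟩
  · rw [hl, hl, map_sum]
    refine Fintype.sum_equiv (Equiv.mulLeft a⁻¹) _ _ fun g => ?_
    have h1 : ∀ b c : H, ∀ v, X.ρ b (X.ρ c v) = X.ρ (b * c) v := fun b c v => by
      rw [map_mul]; rfl
    have h2 : ∀ b c : H, ∀ v, E.ρ b (E.ρ c v) = E.ρ (b * c) v := fun b c v => by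
      rw [map_mul]; rfl
    rw [h1, h2]
    simp
  · change lin p (l x) = lin u x
    rw [hl, map_sum]
    have h1 : ∀ g : H, lin p (E.ρ g (r (lin u (θ (X.ρ g⁻¹ x))))) =
        lin u (X.ρ g (θ (X.ρ g⁻¹ x))) := by
      intro g
      rw [lin_comm, lin_comm]
      congr 1
      exact LinearMap.congr_fun hr _
    simp_rw [h1]
    rw [← map_sum, h]

/-! ### Restriction and inflation along a group homomorphism. -/

section Res

variable (φ : H →* G)

theorem res_tpow (M : FDRep K G) (n : ℕ) :
    Nonempty (tpow (inflate φ M) n ≅ inflate φ (tpow M n)) := by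
  induction n with
  | zero => exact ⟨Iso.refl _⟩
  | succ n ih => exact ⟨ih.some ⊗ᵢ Iso.refl _⟩

theorem IsAlgebraicModule.inflate {M : FDRep K G} (h : IsAlgebraicModule M) :
    IsAlgebraicModule (inflate φ M) := by
  obtain ⟨S, hS, hM⟩ := h.exists_finite
  exact isAlgebraicModule_of_inAdd (hS.image (FDRep.inflate φ)) fun n =>
    ((hM n).map (Action.res (FGModuleCat K) φ) fun F hF =>
      InAdd.of_mem (S := FDRep.inflate φ '' S) (Set.mem_image_of_mem _ hF)).iso
      (res_tpow φ M n).some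

/-- Inflation along a surjective homomorphism reflects algebraicity. -/
theorem isAlgebraicModule_of_inflate (hφ : Function.Surjective φ) {M : FDRep K G}
    (h : IsAlgebraicModule (FDRep.inflate φ M)) : IsAlgebraicModule M := by
  obtain ⟨d, hd⟩ := isAlgebraicModule_iff.1 h
  refine isAlgebraicModule_iff.2 ⟨d, ?_⟩
  -- Surjectivity makes equivariance over `H` and over `G` the same condition, so inflation is fully
  -- faithful.
  have := Action.full_res (FGModuleCat K) φ hφ
  refine InAdd.of_map (Action.res (FGModuleCat K) φ) ?_
  refine (InAdd.trans hd ?_).iso (res_tpow φ M d).some.symm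
  rintro _ ⟨j, hj, rfl⟩
  exact (InAdd.of_mem (Set.mem_image_of_mem (Action.res (FGModuleCat K) φ).obj
    (Set.mem_image_of_mem (tpow M) hj))).iso (res_tpow φ M j).some

/-- Inflation along a surjective homomorphism preserves indecomposability. -/
theorem indecomposable_inflate (hφ : Function.Surjective φ) {M : FDRep K G}
    (h : Indecomposable M) : Indecomposable (FDRep.inflate φ M) := by
  have := Action.full_res (FGModuleCat K) φ hφ
  let R := Action.res (FGModuleCat K) φ
  refine indecomposable_of_idempotent (fun h0 => h.1 ?_) fun e he => ?_
  · rw [IsZero.iff_id_eq_zero] at h0 ⊢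
    refine R.map_injective ?_
    rw [R.map_id, R.map_zero]
    exact h0
  · obtain ⟨f, rfl⟩ := R.map_surjective e
    rw [← R.map_comp] at he
    rcases h.idempotent f (R.map_injective he) with h1 | h1
    · exact Or.inl (by rw [h1, R.map_zero])
    · exact Or.inr (by rw [h1, R.map_id])

instance : PreservesFiniteLimits (Action.res (FGModuleCat.{u} K) φ) := by
  have : PreservesFiniteLimits (Action.res (FGModuleCat K) φ ⋙ Action.forget (FGModuleCat K) H) :=
    inferInstanceAs (PreservesFiniteLimits (Action.forget (FGModuleCat K) G))
  exact preservesFiniteLimits_of_reflects_of_preserves _ (Action.forget (FGModuleCat K) H)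

instance : (Action.res (FGModuleCat.{u} K) φ).PreservesEpimorphisms where
  preserves {X Y} f _ := epi_of_surj ((Action.res (FGModuleCat.{u} K) φ).map f)
    (@lin_surjective K _ G _ X Y f _)

variable [Finite G] [Finite H]

/-- It suffices to treat functions on `G`. Cutting them off to a transversal of the cosets of the
image of `H` gives a linear map whose `H`-trace is the identity, so Higman's criterion applies. -/
theorem projective_res (hφ : Function.Injective φ) (P : FDRep K G) (hP : Projective P) :
    Projective ((Action.res (FGModuleCat K) φ).obj P) := by
  classical
  obtain ⟨n, ⟨e⟩⟩ := Finite.exists_equiv_fin G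
  obtain ⟨r⟩ := retract_coindObj_of_projective n e P hP
  have := Fintype.ofFinite H
  suffices h : Projective ((Action.res (FGModuleCat K) φ).obj (coindObj n e P)) from
    (r.map (Action.res (FGModuleCat K) φ)).projective
  let T : Set G := {a | (QuotientGroup.mk a : G ⧸ φ.range).out = a}
  -- Each coset meets `T` once and `φ` is injective, so exactly one term of the trace contributes at
  -- each point.
  have hT : ∀ a : G, ∃ h : H, ∀ h', a * φ h' ∈ T ↔ h' = h := by
    intro a
    obtain ⟨⟨_, h, rfl⟩, hh⟩ := QuotientGroup.mk_out_eq_mul φ.range a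
    refine ⟨h, fun h' => ?_⟩
    have h1 : (QuotientGroup.mk (a * φ h') : G ⧸ φ.range) = QuotientGroup.mk a :=
      QuotientGroup.mk_mul_of_mem a ⟨h', rfl⟩
    change (QuotientGroup.mk (a * φ h') : G ⧸ φ.range).out = _ ↔ _
    rw [h1, hh]
    simp only [mul_right_inj]
    exact ⟨fun h2 => (hφ h2).symm, fun h2 => by rw [h2]⟩
  let θ : (Fin n → P) →ₗ[K] (Fin n → P) :=
    { toFun := fun x i => if e.symm i ∈ T then x i else 0
      map_add' := fun x y => by funext i; by_cases h : e.symm i ∈ T <;> simp [h]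
      map_smul' := fun c x => by funext i; by_cases h : e.symm i ∈ T <;> simp [h] }
  refine projective_of_trace _ θ fun (x : Fin n → P) => ?_
  funext i
  obtain ⟨h, hh⟩ := hT (e.symm i)
  change (∑ g : H, coindRep (K := K) n e P (φ g) (θ (coindRep n e P (φ g⁻¹) x))) i = x i
  rw [Finset.sum_apply, Finset.sum_eq_single h]
  · rw [coindRep_apply]
    simp only [θ, LinearMap.coe_mk, AddHom.coe_mk, Equiv.symm_apply_apply]
    rw [if_pos ((hh h).2 rfl), coindRep_apply]
    simp
  · intro g _ hg
    rw [coindRep_apply]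
    simp only [θ, LinearMap.coe_mk, AddHom.coe_mk, Equiv.symm_apply_apply]
    rw [if_neg fun h' => hg ((hh g).1 h')]
  · simp

/-- Restriction to a subgroup as a homomorphism between the monoids of stable classes. -/
noncomputable def stableRes (hφ : Function.Injective φ) :
    Stable (FDRep K G) →* Stable (FDRep K H) where
  toFun := Quotient.map (FDRep.inflate φ) fun _ _ h =>
    h.map (Action.res (FGModuleCat K) φ) (projective_res φ hφ)
  map_one' := rfl
  map_mul' := by
    rintro ⟨X⟩ ⟨Y⟩
    rfl

theorem stableRes_sc (hφ : Function.Injective φ) (M : FDRep K G) :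
    stableRes φ hφ (sc M) = sc (FDRep.inflate φ M) := rfl

theorem stableRes_syz (hφ : Function.Injective φ) :
    Units.map (stableRes φ hφ) (syz (FDRep K G)) = syz (FDRep K H) := by
  have h := isSyzygy_omega (𝟙_ (FDRep K G))
  have h1 := (h.map (Action.res (FGModuleCat K) φ) (projective_res φ hφ)).sc_eq
  have h2 : stableRes φ hφ (sc (omega (𝟙_ (FDRep K G)))) =
    syz (FDRep K H) * stableRes φ hφ (sc (𝟙_ (FDRep K G))) := h1
  rw [h.sc_eq, sc_one, mul_one, map_one, mul_one] at h2
  exact Units.ext h2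

/-- Restriction to a subgroup commutes with Heller translates up to projective summands. -/
theorem sc_inflate_heller (hφ : Function.Injective φ) (M : FDRep K G) (i : ℤ) :
    sc (FDRep.inflate φ (heller M i)) =
      ((syz (FDRep K H)) ^ i : (Stable (FDRep K H))ˣ) * sc (FDRep.inflate φ M) := by
  rw [← stableRes_sc φ hφ, sc_heller, map_mul, ← stableRes_syz φ hφ, ← map_zpow]
  rfl

/-- Restrictions of periodic modules to subgroups are periodic. -/
theorem IsPeriodic.res (hφ : Function.Injective φ) {M : FDRep K G} (h : IsPeriodic M) :
    IsPeriodic (FDRep.inflate φ M) := by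
  obtain ⟨i, hi, h⟩ := (isPeriodic_iff M).1 h
  exact (isPeriodic_iff _).2 ⟨i, hi, by
    rw [← sc_inflate_heller φ hφ, ← stableRes_sc φ hφ, sc_heller, h]; rfl⟩

end Res

/-! #### Short exact sequences -/

theorem isSyzygy_of_exact {N P M : FDRep K G} (i : N ⟶ P) (p : P ⟶ M) (hP : Projective P)
    (hi : Function.Injective (lin i)) (hp : Function.Surjective (lin p))
    (hip : ∀ y, lin p (lin i y) = 0) (h : ∀ x, lin p x = 0 → ∃ y, lin i y = x) :
    IsSyzygy N M := by
  have hm := mono_of_inj i hi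
  have he := epi_of_surj p hp
  let l : N ⟶ kernel p := kernel.lift p i (lin_ext hip)
  have hl : l ≫ kernel.ι p = i := kernel.lift_ι _ _ _
  have h1 : Mono l := by
    rw [← hl] at hm
    exact mono_of_mono l (kernel.ι p)
  have h2 : Epi l := by
    refine epi_of_surj _ fun y => ?_
    obtain ⟨x, hx⟩ := h (lin (kernel.ι p) y) (by rw [← lin_comp, kernel.condition]; rfl)
    refine ⟨x, lin_injective (kernel.ι p) ?_⟩
    rw [← hx, ← lin_comp, hl]
  have h3 : IsIso l := isIso_of_mono_of_epi l
  exact (isSyzygy_kernel p hP).of_iso_left (asIso l)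

end FDRep

/-! ### The four-group -/

namespace FDRep
open KrullSchmidt StableCat

variable {K : Type u} [Field K]

section Trivial
variable {G : Type v} [Group G]

/-- Endomorphisms of the trivial module are scalars, and a field has only the idempotents `0` and
`1`. -/
theorem indecomposable_unit : Indecomposable (𝟙_ (FDRep K G)) := by
  have hlin : ∀ (e : 𝟙_ (FDRep K G) ⟶ 𝟙_ (FDRep K G)) (x : K), lin e x = (x * (lin e (1 : K) : K) : K) :=
    fun e x => by
      have := (lin e).map_smul x (1 : K)
      rw [show x • (1 : K) = x from mul_one x] at this
      exact this
  refine indecomposable_of_idempotent (fun h => ?_) fun e he => ?_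
  · have h1 := (IsZero.iff_id_eq_zero _).1 h
    have h2 : (1 : K) = (0 : K) := congrArg (fun f => (lin f (1 : K) : K)) h1
    exact one_ne_zero h2
  · have h1 : lin e (lin e (1 : K)) = lin e (1 : K) := congrArg (fun f => lin f (1 : K)) he
    rw [hlin e (lin e (1 : K))] at h1
    have h2 : (lin e (1 : K) : K) * (lin e (1 : K) : K) = (lin e (1 : K) : K) := h1
    rcases IsIdempotentElem.iff_eq_zero_or_one.1 h2 with h | h
    · left
      exact lin_ext fun x => (hlin e x).trans ((congrArg (x * ·) h).trans (mul_zero x))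
    · right
      exact lin_ext fun x => (hlin e x).trans ((congrArg (x * ·) h).trans (mul_one x))

end Trivial

section Involutions

theorem pow_val_add {M : Type*} [Monoid M] {A : M} (hA : A * A = 1) (x y : ZMod 2) :
    A ^ (x + y).val = A ^ x.val * A ^ y.val := by
  have h : ∀ n : ℕ, A ^ (n % 2) = A ^ n := fun n => by
    conv_rhs => rw [← Nat.div_add_mod n 2, pow_add, pow_mul, pow_two, hA, one_pow, one_mul]
  rw [ZMod.val_add, h, pow_add]

/-- The homomorphism from the four-group given by two commuting involutions. -/
def fourHom {M : Type*} [Monoid M] (A B : M) (hA : A * A = 1) (hB : B * B = 1)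
    (hAB : Commute A B) : FourGroup →* M where
  toFun g := A ^ g.1.toAdd.val * B ^ g.2.toAdd.val
  map_one' := by simp
  map_mul' g h := by
    simp only [Prod.fst_mul, Prod.snd_mul, toAdd_mul, pow_val_add hA, pow_val_add hB]
    have := (hAB.pow_pow h.1.toAdd.val g.2.toAdd.val).eq
    rw [mul_assoc, ← mul_assoc _ _ (B ^ h.2.toAdd.val), this]
    simp only [mul_assoc]

/-- The representation of the four-group given by two commuting involutions. -/
def fourRep {V : Type u} [AddCommGroup V] [Module K V] (A B : Module.End K V) (hA : A * A = 1)
    (hB : B * B = 1) (hAB : Commute A B) : Representation K FourGroup V :=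
  fourHom A B hA hB hAB

end Involutions

/-- A linear map commuting with the involutions is equivariant. -/
theorem fourRep_equivariant {V W : Type u} [AddCommGroup V] [Module K V] [AddCommGroup W]
    [Module K W] {A B : Module.End K V} {A' B' : Module.End K W} {hA hB hAB hA' hB' hAB'}
    (l : V →ₗ[K] W) (h1 : ∀ v, l (A v) = A' (l v)) (h2 : ∀ v, l (B v) = B' (l v))
    (g : FourGroup) (v : V) :
    l (fourRep A B hA hB hAB g v) = fourRep A' B' hA' hB' hAB' g (l v) := by
  have hp : ∀ {C : Module.End K V} {C' : Module.End K W}, (∀ v, l (C v) = C' (l v)) →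
      ∀ (n : ℕ) v, l ((C ^ n) v) = (C' ^ n) (l v) := by
    intro C C' h n
    induction n with
    | zero => simp
    | succ n ih => intro v; rw [pow_succ, pow_succ, Module.End.mul_apply, ih, h]; rfl
  change l ((A ^ _) ((B ^ _) v)) = (A' ^ _) ((B' ^ _) (l v))
  rw [hp h1, hp h2]

theorem fourRep_values {V : Type u} [AddCommGroup V] [Module K V] {A B : Module.End K V}
    {hA hB hAB} (v : V) : fourRep A B hA hB hAB (1, 1) v = v ∧
      fourRep A B hA hB hAB (1, .ofAdd 1) v = B v ∧ fourRep A B hA hB hAB (.ofAdd 1, 1) v = A v ∧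
      fourRep A B hA hB hAB (.ofAdd 1, .ofAdd 1) v = A (B v) := by
  refine ⟨?_, ?_, ?_, ?_⟩
  · change (A ^ 0 * B ^ 0) v = _; simp
  · change (A ^ 0 * B ^ 1) v = _; simp
  · change (A ^ 1 * B ^ 0) v = _; simp
  · change (A ^ 1 * B ^ 1) v = _; simp

theorem sum_fourGroup {M : Type*} [AddCommMonoid M] (f : FourGroup → M) :
    ∑ g, f g = f (1, 1) + f (1, .ofAdd 1) + (f (.ofAdd 1, 1) + f (.ofAdd 1, .ofAdd 1)) := by
  have h : ∀ f : Multiplicative (ZMod 2) → M, ∑ x, f x = f 1 + f (.ofAdd 1) := fun f =>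
    Fin.sum_univ_two (f := f)
  rw [Fintype.sum_prod_type, h, h, h]

variable [CharP K 2]

theorem add_self_of_charTwo {V : Type*} [AddCommGroup V] [Module K V] (v : V) : v + v = 0 := by
  rw [← two_smul K v, CharTwo.two_eq_zero, zero_smul]

section Free

variable (K)
/-- The square-zero operator `a` on the free module on `K ^ m` over `K[a, b] / (a², b²)`. -/
def freeA (m : ℕ) : Module.End K ((Fin m → K) × (Fin m → K) × (Fin m → K) × (Fin m → K)) where
  -- Coordinates refer to the basis `1, a, b, ab`; the map is multiplication by the group element `1
  -- + a`.
  toFun x := (x.1, x.2.1 + x.1, x.2.2.1, x.2.2.2 + x.2.2.1)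
  map_add' x y := by ext <;> simp <;> ring
  map_smul' c x := by ext <;> simp

/-- The square-zero operator `b` on the free module on `K ^ m` over `K[a, b] / (a², b²)`. -/
def freeB (m : ℕ) : Module.End K ((Fin m → K) × (Fin m → K) × (Fin m → K) × (Fin m → K)) where
  toFun x := (x.1, x.2.1, x.2.2.1 + x.1, x.2.2.2 + x.2.1)
  map_add' x y := by ext <;> simp <;> ring
  map_smul' c x := by ext <;> simp

theorem freeA_mul_self (m : ℕ) : freeA K m * freeA K m = 1 := by
  refine LinearMap.ext fun x => ?_
  simp [freeA, add_assoc, add_self_of_charTwo (K := K)]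

theorem freeB_mul_self (m : ℕ) : freeB K m * freeB K m = 1 := by
  refine LinearMap.ext fun x => ?_
  simp [freeB, add_assoc, add_self_of_charTwo (K := K)]

theorem freeA_commute_freeB (m : ℕ) : Commute (freeA K m) (freeB K m) := by
  refine LinearMap.ext fun x => ?_
  simp only [freeA, freeB, Module.End.mul_apply, LinearMap.coe_mk, AddHom.coe_mk, Prod.mk.injEq,
    true_and]
  abel

/-- The free `KV₄`-module of rank `m`. -/
noncomputable abbrev fourFree (m : ℕ) : FDRep K FourGroup :=
  FDRep.of (fourRep (freeA K m) (freeB K m) (freeA_mul_self K m) (freeB_mul_self K m)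
    (freeA_commute_freeB K m))

theorem projective_fourFree (m : ℕ) : Projective (fourFree K m) := by
  -- In the basis of group elements `1, 1 + a, 1 + b, (1 + a)(1 + b)`, the coefficient of the
  -- identity is the sum of the four coordinates; `θ` projects onto it.
  let θ : Module.End K ((Fin m → K) × (Fin m → K) × (Fin m → K) × (Fin m → K)) :=
    { toFun := fun x => (x.1 + x.2.1 + x.2.2.1 + x.2.2.2, 0, 0, 0)
      map_add' := fun x y => by ext <;> simp <;> ring
      map_smul' := fun c x => by ext <;> simp }
  refine projective_of_trace _ θ fun x => ?_
  rw [sum_fourGroup]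
  have h := fun v => fourRep_values (hA := freeA_mul_self K m) (hB := freeB_mul_self K m)
    (hAB := freeA_commute_freeB K m) v
  have hinv : ∀ g : FourGroup, g⁻¹ = g := by decide
  simp only [hinv, of_ρ']
  rw [(h _).1, (h _).1, (h _).2.1, (h _).2.1, (h _).2.2.1, (h _).2.2.1, (h _).2.2.2, (h _).2.2.2]
  have h2 : (2 : K) = 0 := CharTwo.two_eq_zero
  ext i <;> simp [freeA, freeB, θ] <;> grind

end Free

/-! #### The Heller translates of the trivial module of the four-group -/

section String

variable (K)

/-- Append a zero coordinate at the end. -/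
def snocZero (n : ℕ) : (Fin n → K) →ₗ[K] (Fin (n + 1) → K) where
  toFun u := Fin.snoc (α := fun _ => K) u 0
  map_add' u v := by
    funext i
    refine Fin.lastCases ?_ (fun i => ?_) i <;> simp
  map_smul' c u := by
    funext i
    refine Fin.lastCases ?_ (fun i => ?_) i <;> simp

/-- Insert a zero coordinate at the beginning. -/
def consZero (n : ℕ) : (Fin n → K) →ₗ[K] (Fin (n + 1) → K) where
  toFun u := Fin.cons (α := fun _ => K) 0 u
  map_add' u v := by
    funext i
    refine Fin.cases ?_ (fun i => ?_) i <;> simp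
  map_smul' c u := by
    funext i
    refine Fin.cases ?_ (fun i => ?_) i <;> simp

@[simp] theorem snocZero_castSucc (n : ℕ) (u : Fin n → K) (i : Fin n) :
    snocZero K n u i.castSucc = u i := Fin.snoc_castSucc (α := fun _ => K) 0 u i

@[simp] theorem snocZero_last (n : ℕ) (u : Fin n → K) :
    snocZero K n u (Fin.last n) = 0 := Fin.snoc_last (α := fun _ => K) 0 u

@[simp] theorem consZero_succ (n : ℕ) (u : Fin n → K) (i : Fin n) :
    consZero K n u i.succ = u i := Fin.cons_succ (α := fun _ => K) 0 u i

@[simp] theorem consZero_zero (n : ℕ) (u : Fin n → K) :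
    consZero K n u 0 = 0 := Fin.cons_zero (α := fun _ => K) 0 u

theorem snocZero_consZero (n : ℕ) (u : Fin n → K) :
    snocZero K (n + 1) (consZero K n u) = consZero K (n + 1) (snocZero K n u) :=
  (Fin.cons_snoc_eq_snoc_cons (β := K) 0 u 0).symm

/-- The involution `1 + ℓ` on `K ^ n × K ^ (n + 1)`. -/
def shear {n : ℕ} (l : (Fin n → K) →ₗ[K] (Fin (n + 1) → K)) :
    Module.End K ((Fin n → K) × (Fin (n + 1) → K)) where
  toFun x := (x.1, x.2 + l x.1)
  map_add' x y := by
    simp only [Prod.fst_add, Prod.snd_add, map_add, Prod.mk_add_mk, Prod.mk.injEq, true_and]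
    abel
  map_smul' c x := by simp

theorem shear_mul_self {n : ℕ} (l : (Fin n → K) →ₗ[K] (Fin (n + 1) → K)) :
    shear K l * shear K l = 1 := by
  refine LinearMap.ext fun x => ?_
  simp [shear, add_assoc, add_self_of_charTwo (K := K)]

theorem shear_commute {n : ℕ} (l l' : (Fin n → K) →ₗ[K] (Fin (n + 1) → K)) :
    Commute (shear K l) (shear K l') := by
  refine LinearMap.ext fun x => ?_
  simp only [shear, Module.End.mul_apply, LinearMap.coe_mk, AddHom.coe_mk, Prod.mk.injEq,
    true_and]
  abel

/-- The string module `Ω⁻ⁿ(K)` of dimension `2n + 1` of the four-group. -/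
noncomputable abbrev fourString (n : ℕ) : FDRep K FourGroup :=
  FDRep.of (fourRep (shear K (snocZero K n)) (shear K (consZero K n)) (shear_mul_self K _)
    (shear_mul_self K _) (shear_commute K _ _))

/-- Write the larger string with top `u_j` and bottom `v_j`, where `a u_j = v_j` and `b u_j =
v_{j+1}`. Its free cover on generators `e_j` has kernel spanned by the elements `a e_{j+1} + b e_j`
and `ab e_j`, which form the next shorter string. -/
theorem isSyzygy_fourString (n : ℕ) : IsSyzygy (fourString K n) (fourString K (n + 1)) := by
  let i : (Fin n → K) × (Fin (n + 1) → K) →ₗ[K]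
      (Fin (n + 1) → K) × (Fin (n + 1) → K) × (Fin (n + 1) → K) × (Fin (n + 1) → K) :=
    { toFun := fun x => (0, consZero K n x.1, snocZero K n x.1, x.2)
      map_add' := fun x y => by simp
      map_smul' := fun c x => by simp }
  let p : (Fin (n + 1) → K) × (Fin (n + 1) → K) × (Fin (n + 1) → K) × (Fin (n + 1) → K) →ₗ[K]
      (Fin (n + 1) → K) × (Fin (n + 2) → K) :=
    { toFun := fun x => (x.1, snocZero K _ x.2.1 + consZero K _ x.2.2.1)
      map_add' := fun x y => by
        simp only [Prod.fst_add, Prod.snd_add, map_add, Prod.mk_add_mk, Prod.mk.injEq, true_and]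
        abel
      map_smul' := fun c x => by simp }
  refine isSyzygy_of_exact
    (homOf (V := fourString K n) (W := fourFree K (n + 1)) i
      (fourRep_equivariant (hA := shear_mul_self K _) (hB := shear_mul_self K _)
        (hAB := shear_commute K _ _) (hA' := freeA_mul_self K _) (hB' := freeB_mul_self K _)
        (hAB' := freeA_commute_freeB K _) i (fun v => ?_) (fun v => ?_)))
    (homOf (V := fourFree K (n + 1)) (W := fourString K (n + 1)) p
      (fourRep_equivariant (hA := freeA_mul_self K _) (hB := freeB_mul_self K _)
        (hAB := freeA_commute_freeB K _) (hA' := shear_mul_self K _) (hB' := shear_mul_self K _)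
        (hAB' := shear_commute K _ _) p (fun v => ?_) (fun v => ?_)))
    (projective_fourFree K _) ?_ ?_ ?_ ?_
  · simp [i, shear, freeA]
  · simp [i, shear, freeB]
  · simp only [p, shear, freeA, LinearMap.coe_mk, AddHom.coe_mk, map_add, Prod.mk.injEq, true_and]
    abel
  · simp only [p, shear, freeB, LinearMap.coe_mk, AddHom.coe_mk, map_add, Prod.mk.injEq, true_and]
    abel
  · change Function.Injective i
    rw [← LinearMap.ker_eq_bot, LinearMap.ker_eq_bot']
    rintro ⟨u, v⟩ h
    simp only [i, LinearMap.coe_mk, AddHom.coe_mk, Prod.mk_eq_zero, true_and] at h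
    obtain ⟨h1, -, rfl⟩ := h
    have : u = 0 := by
      funext j
      simpa using congrFun h1 j.succ
    rw [this]; rfl
  · change Function.Surjective p
    rintro ⟨u, v⟩
    -- All bottom coordinates but the last come from `a`; the last one is reached only through `b`.
    refine ⟨(u, fun j => v j.castSucc, fun j => if j = Fin.last n then v (Fin.last _) else 0, 0), ?_⟩
    simp only [p, LinearMap.coe_mk, AddHom.coe_mk, Prod.mk.injEq, true_and]
    funext j
    refine Fin.lastCases ?_ (fun j => ?_) j
    · rw [Pi.add_apply, snocZero_last, ← Fin.succ_last, consZero_succ]; simp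
    · rw [Pi.add_apply, snocZero_castSucc]
      refine Fin.cases ?_ (fun j => ?_) j
      · rw [Fin.castSucc_zero, consZero_zero, add_zero]
      · rw [← Fin.succ_castSucc, consZero_succ, if_neg (Fin.castSucc_lt_last j).ne, add_zero]
  · rintro ⟨u, v⟩
    change p (i (u, v)) = 0
    simp only [p, i, LinearMap.coe_mk, AddHom.coe_mk, snocZero_consZero,
      add_self_of_charTwo (K := K)]
    rfl
  · rintro ⟨w, q, r, s⟩ h
    have h' : p (w, q, r, s) = 0 := h
    simp only [p, LinearMap.coe_mk, AddHom.coe_mk, Prod.mk_eq_zero] at h'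
    obtain ⟨rfl, h2⟩ := h'
    -- Comparing entries gives `q 0 = 0`, `q (j + 1) = r j` and a vanishing last entry of `r`, so
    -- the initial entries of `r` determine both.
    have h3 : snocZero K _ q = consZero K _ r := by
      rw [← sub_eq_zero, sub_eq_add_neg, ← h2]
      congr 1
      rw [eq_comm, eq_neg_iff_add_eq_zero]
      exact add_self_of_charTwo (K := K) _
    refine ⟨(fun j => r j.castSucc, s), ?_⟩
    change i _ = _
    simp only [i, LinearMap.coe_mk, AddHom.coe_mk, Prod.mk.injEq, true_and, and_true]
    constructor
    · funext j
      refine Fin.cases ?_ (fun j => ?_) j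
      · rw [consZero_zero]
        have := congrFun h3 (Fin.castSucc 0)
        rw [snocZero_castSucc, Fin.castSucc_zero, consZero_zero] at this
        exact this.symm
      · rw [consZero_succ]
        have := congrFun h3 (Fin.castSucc j.succ)
        rw [snocZero_castSucc, ← Fin.succ_castSucc, consZero_succ] at this
        exact this.symm
    · funext j
      refine Fin.lastCases ?_ (fun j => ?_) j
      · rw [snocZero_last]
        have := congrFun h3 (Fin.last _)
        rw [snocZero_last, ← Fin.succ_last, consZero_succ] at this
        exact this
      · rw [snocZero_castSucc]

theorem sc_fourString (n : ℕ) : sc (fourString K n) =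
    ((syz (FDRep K FourGroup)) ^ (-n : ℤ) : (Stable (FDRep K FourGroup))ˣ) := by
  induction n with
  | zero =>
    rw [Nat.cast_zero, neg_zero, zpow_zero, Units.val_one, ← sc_one]
    let l : ((Fin 0 → K) × (Fin 1 → K)) ≃ₗ[K] K :=
      { toFun := fun x => x.2 0
        map_add' := fun x y => rfl
        map_smul' := fun c x => rfl
        invFun := fun x => (0, fun _ => x)
        left_inv := fun x => Prod.ext (Subsingleton.elim _ _) (funext fun i => by fin_cases i; rfl)
        right_inv := fun x => rfl }
    have h1 : ∀ l : (Fin 0 → K) →ₗ[K] (Fin 1 → K), shear K l = 1 := fun l =>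
      LinearMap.ext fun x => by
        have h0 : l x.1 = 0 := by rw [Subsingleton.elim x.1 0, map_zero]
        simp [shear, h0]
    refine sc_iso (isoOf (V := fourString K 0) (W := 𝟙_ _) l fun g x => ?_)
    change l (((shear K _) ^ _ * (shear K _) ^ _ : Module.End K _) x) = l x
    rw [h1, h1, one_pow, one_pow, one_mul]; rfl
  | succ n ih =>
    rw [(isSyzygy_fourString K n).sc_eq', ih, ← Units.val_mul]
    congr 1
    rw [Nat.cast_succ, neg_add, add_comm, zpow_add, zpow_neg_one]

end String

end FDRep

/-! ### Norms and non-periodicity of the trivial module of the four-group. -/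

namespace FDRep
open KrullSchmidt StableCat

variable {K : Type u} [Field K]

/-- The invariants of a projective module are traces. -/
theorem exists_trace_of_projective {G : Type v} [Group G] [Fintype G] (P : FDRep K G)
    (hP : Projective P) : ∃ θ : P →ₗ[K] P, ∀ x, ∑ g : G, P.ρ g (θ (P.ρ g⁻¹ x)) = x := by
  classical
  obtain ⟨n, ⟨e⟩⟩ := Finite.exists_equiv_fin G
  obtain ⟨r⟩ := retract_coindObj_of_projective n e P hP
  let i : P →ₗ[K] (Fin n → P) := lin r.i
  let q : (Fin n → P) →ₗ[K] P := lin r.r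
  -- On functions the projection to those supported at the identity has trace one; it is transported
  -- along the retract.
  refine ⟨q ∘ₗ (LinearMap.single K (fun _ => (P : Type u)) (e 1)) ∘ₗ (LinearMap.proj (e 1)) ∘ₗ i,
    fun x => ?_⟩
  have hi : ∀ (g : G) x, i (P.ρ g x) = coindRep (K := K) n e P g (i x) := fun g x => lin_comm r.i g x
  have hq : ∀ (g : G) x, q (coindRep (K := K) n e P g x) = P.ρ g (q x) := fun g x => lin_comm r.r g x
  have hqi : q (i x) = x := congrArg (fun f => lin f x) r.retract
  simp only [LinearMap.comp_apply, LinearMap.proj_apply, ← hq, hi, ← map_sum]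
  refine (congrArg q (funext fun j => ?_)).trans hqi
  rw [Finset.sum_apply]
  simp only [coindRep_apply, LinearMap.coe_single]
  rw [Finset.sum_eq_single (e.symm j)⁻¹]
  · simp
  · intro g _ hg
    rw [Pi.single_eq_of_ne]
    intro h
    exact hg (eq_inv_of_mul_eq_one_right (e.injective h))
  · simp

variable [CharP K 2]

/-- The left side is `(1 + A)(1 + B) v`, and each factor maps into the bottom layer, which it kills.
-/
theorem add_shear_eq_zero (n : ℕ) (v : (Fin n → K) × (Fin (n + 1) → K)) :
    v + shear K (consZero K n) v + (shear K (snocZero K n) v +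
      shear K (snocZero K n) (shear K (consZero K n) v)) = 0 := by
  have h2 : (2 : K) = 0 := CharTwo.two_eq_zero
  ext i
  · simp only [shear, LinearMap.coe_mk, AddHom.coe_mk, Prod.fst_add, Pi.add_apply, Prod.fst_zero,
      Pi.zero_apply]
    linear_combination (2 * v.1 i) * h2
  · simp only [shear, LinearMap.coe_mk, AddHom.coe_mk, Prod.snd_add, Pi.add_apply, Prod.snd_zero,
      Pi.zero_apply]
    linear_combination (2 * v.2 i + consZero K n v.1 i + snocZero K n v.1 i) * h2

theorem sum_fourString (n : ℕ) (v : fourString K n) :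
    ∑ g, (fourString K n).ρ g v = 0 := by
  rw [sum_fourGroup]
  have h := fourRep_values (hA := shear_mul_self K _) (hB := shear_mul_self K _)
    (hAB := shear_commute K (snocZero K n) (consZero K n)) v
  rw [of_ρ', h.1, h.2.1, h.2.2.1, h.2.2.2]
  exact add_shear_eq_zero n v

/-- A projective module of the four-group on which the norm vanishes is zero. -/
theorem eq_zero_of_sum_eq_zero (P : FDRep K FourGroup) (hP : Projective P)
    (h : ∀ v, ∑ g, P.ρ g v = 0) (v : P) : v = 0 := by
  obtain ⟨θ, hθ⟩ := exists_trace_of_projective P hP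
  have hm : ∀ (g k : FourGroup) (x : P), P.ρ g (P.ρ k x) = P.ρ (g * k) x := fun g k x => by
    rw [map_mul]; rfl
  -- For invariant `y`, the trace formula writes `y` as the norm of `θ y`, which vanishes by
  -- hypothesis.
  have hinv : ∀ y : P, P.ρ (.ofAdd 1, 1) y = y → P.ρ (1, .ofAdd 1) y = y → y = 0 := by
    intro y ha hb
    have hg : ∀ g : FourGroup, P.ρ g y = y := by
      have : ∀ g : FourGroup, g = 1 ∨ g = (.ofAdd 1, 1) ∨ g = (1, .ofAdd 1) ∨
        g = (.ofAdd 1, 1) * (1, .ofAdd 1) := by decide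
      intro g
      rcases this g with rfl | rfl | rfl | rfl
      · rw [map_one]; rfl
      · exact ha
      · exact hb
      · rw [← hm, hb, ha]
    rw [← hθ y]
    simp only [hg]
    exact h _
  have h2 : ∀ y : P, y + y = 0 := add_self_of_charTwo (K := K)
  have haa : (((.ofAdd 1, 1) : FourGroup) * (.ofAdd 1, 1)) = 1 := by decide
  have hbb : (((1, .ofAdd 1) : FourGroup) * (1, .ofAdd 1)) = 1 := by decide
  have hab : (((1, .ofAdd 1) : FourGroup) * (.ofAdd 1, 1)) = (.ofAdd 1, .ofAdd 1) := by decide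
  have h1 : ∀ y : P, P.ρ 1 y = y := fun y => by rw [map_one]; rfl
  have hz : ∀ y z : P, y + z = 0 → z = y := fun y z hyz =>
    add_left_cancel (hyz.trans (h2 y).symm)
  -- The element `v + A v` is fixed by `A` in characteristic two and by `B` because the norm of `v`
  -- vanishes, so it is zero.
  have ha : P.ρ (.ofAdd 1, 1) v = v := by
    refine hz _ _ (hinv _ ?_ (hz _ _ ?_))
    · rw [map_add, hm, haa, h1, add_comm]
    · rw [← h v, sum_fourGroup, map_add, hm, hab]
      change _ = P.ρ 1 v + _ + _
      rw [h1]
      abel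
  have hb : P.ρ (1, .ofAdd 1) v = v := by
    refine hz _ _ (hinv _ ?_ ?_)
    · have hba : (((.ofAdd 1, 1) : FourGroup) * (1, .ofAdd 1)) = (1, .ofAdd 1) * (.ofAdd 1, 1) := by
        decide
      rw [map_add, hm, hba, ← hm, ha]
    · rw [map_add, hm, hbb, h1, add_comm]
  exact hinv v ha hb

theorem projectiveFree_fourString (n : ℕ) : ProjectiveFree (fourString K n) := by
  refine projectiveFree_of_retract fun P hP r => ?_
  rw [IsZero.iff_id_eq_zero]
  refine lin_ext fun v => eq_zero_of_sum_eq_zero P hP (fun v => ?_) _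
  have : Mono r.i := inferInstance
  refine lin_injective r.i ?_
  rw [map_zero, map_sum, ← sum_fourString n (lin r.i v)]
  exact Finset.sum_congr rfl fun g _ => lin_comm r.i g v

/-- Periodicity would make some string with `n ≠ 0` stably trivial. Both modules are
projective-free, hence isomorphic, but their dimensions are `2n + 1` and `1`. -/
theorem not_isPeriodic_fourGroup : ¬ IsPeriodic (trivialModule K FourGroup) := by
  rw [isPeriodic_iff]
  rintro ⟨i, hi, h⟩
  rw [sc_one, mul_one, Units.val_eq_one] at h
  obtain ⟨n, hn, h⟩ : ∃ n : ℕ, n ≠ 0 ∧ syz (FDRep K FourGroup) ^ (-n : ℤ) = 1 := by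
    refine ⟨i.natAbs, Int.natAbs_ne_zero.2 hi, ?_⟩
    rcases Int.natAbs_eq i with h1 | h1
    · rw [zpow_neg, ← h1, h, inv_one]
    · rw [← h1, h]
  have h1 : sc (fourString K n) = sc (fourString K 0) := by
    rw [sc_fourString, sc_fourString, h]; simp
  obtain ⟨e⟩ := StableIso.iso K (sc_eq_iff.1 h1) (projectiveFree_fourString n)
    (projectiveFree_fourString 0)
  have h3 := (mono_dim e.hom).1
  have h4 : ∀ k, Module.finrank K (fourString K k) = k + (k + 1) := fun k => by
    change Module.finrank K ((Fin k → K) × (Fin (k + 1) → K)) = _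
    simp
  rw [h4, h4] at h3
  omega

theorem isAlgebraicModule_heller_fourGroup_iff (i : ℤ) :
    IsAlgebraicModule (heller (trivialModule K FourGroup) i) ↔ i = 0 :=
  isAlgebraicModule_heller_iff not_isPeriodic_fourGroup isAlgebraicModule_unit i

theorem nonempty_heller_iso_fourString :
    Nonempty (heller (trivialModule K FourGroup) (-1) ≅ fourString K 1) := by
  rw [iso_heller_iff (projectiveFree_fourString 1), sc_fourString, sc_one, mul_one]
  rfl

end FDRep

/-! ### The quaternion group -/

namespace FDRep
open KrullSchmidt StableCat

variable {K : Type u} [Field K]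

section Regular

variable {G : Type} [Group G] [Fintype G]

variable (K G) in
/-- Functions `G → V` with `G` acting by right translation. -/
def regularRep (V : Type u) [AddCommGroup V] [Module K V] : Representation K G (G → V) where
  toFun g := LinearMap.funLeft K V (· * g)
  map_one' := by ext; simp [LinearMap.funLeft]
  map_mul' g h := by ext; simp [LinearMap.funLeft, mul_assoc]

variable (K G) in
/-- The free module of functions `G → V`. -/
noncomputable abbrev regularObj (V : Type u) [AddCommGroup V] [Module K V] [Module.Finite K V] :
    FDRep K G :=
  FDRep.of (regularRep K G V)

theorem projective_regularObj (V : Type u) [AddCommGroup V] [Module K V] [Module.Finite K V] :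
    Projective (regularObj K G V) := by
  classical
  refine projective_of_trace _
    (LinearMap.single K (fun _ : G => V) 1 ∘ₗ LinearMap.proj (R := K) (φ := fun _ : G => V) 1)
    fun (x : G → V) => ?_
  funext j
  change (∑ g : G, regularRep K G V g (Pi.single 1 (regularRep K G V g⁻¹ x 1))) j = x j
  rw [Finset.sum_apply, Finset.sum_eq_single j⁻¹]
  · simp [regularRep, LinearMap.funLeft_apply]
  · intro g _ hg
    change (Pi.single 1 _ : G → V) (j * g) = 0
    exact Pi.single_eq_of_ne (fun h => hg (eq_inv_of_mul_eq_one_right h)) _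
  · simp

end Regular

/-- Exactness at `Q` says that `P` maps onto the kernel of `d'`, so an exact sequence of projectives
can be cut into syzygies. -/
theorem isSyzygy_kernel_kernel {G : Type v} [Group G] [Finite G] {P Q R : FDRep K G} (d : P ⟶ Q)
    (d' : Q ⟶ R) (hP : Projective P) (hd : ∀ x, lin d' (lin d x) = 0)
    (h : ∀ y, lin d' y = 0 → ∃ x, lin d x = y) : IsSyzygy (kernel d) (kernel d') := by
  let l : P ⟶ kernel d' := kernel.lift d' d (lin_ext hd)
  have hl : l ≫ kernel.ι d' = d := kernel.lift_ι _ _ _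
  have he : Epi l := by
    refine epi_of_surj _ fun y => ?_
    obtain ⟨x, hx⟩ := h (lin (kernel.ι d') y) (by rw [← lin_comp, kernel.condition]; rfl)
    refine ⟨x, lin_injective (kernel.ι d') ?_⟩
    rw [← hx, ← lin_comp, hl]
  exact (isSyzygy_kernel l hP).of_iso_left
    (kernelIsoOfEq hl.symm ≪≫ kernelCompMono l (kernel.ι d'))

namespace Quaternion

open QuaternionGroup

/-- The quaternion group of order eight. -/
abbrev Q8 : Type := QuaternionGroup 2

/-- The function on the quaternion group with given values. -/
def ofValues {V : Type*} (p : Fin 4 → V) (q : Fin 4 → V) : Q8 → V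
  | a i => p i
  | xa i => q i

theorem forall_iff {p : Q8 → Prop} : (∀ h, p h) ↔ (p (a 0) ∧ p (a 1) ∧ p (a 2) ∧ p (a 3)) ∧
    p (xa 0) ∧ p (xa 1) ∧ p (xa 2) ∧ p (xa 3) := by
  constructor
  · intro h
    simp [h]
  · rintro ⟨⟨h0, h1, h2, h3⟩, k0, k1, k2, k3⟩ (i | i) <;> fin_cases i <;> assumption

section
variable {V : Type*} (p q : Fin 4 → V)
@[simp] theorem ofValues_a0 : ofValues p q (a 0) = p 0 := rfl
@[simp] theorem ofValues_a1 : ofValues p q (a 1) = p 1 := rfl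
@[simp] theorem ofValues_a2 : ofValues p q (a 2) = p 2 := rfl
@[simp] theorem ofValues_a3 : ofValues p q (a 3) = p 3 := rfl
@[simp] theorem ofValues_xa0 : ofValues p q (xa 0) = q 0 := rfl
@[simp] theorem ofValues_xa1 : ofValues p q (xa 1) = q 1 := rfl
@[simp] theorem ofValues_xa2 : ofValues p q (xa 2) = q 2 := rfl
@[simp] theorem ofValues_xa3 : ofValues p q (xa 3) = q 3 := rfl
end

theorem mul_table :
    ((a 1 * a 0 : Q8) = a 1 ∧ (a 1 * a 1 : Q8) = a 2 ∧ (a 1 * a 2 : Q8) = a 3 ∧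
      (a 1 * a 3 : Q8) = a 0) ∧
    ((a 1 * xa 0 : Q8) = xa 3 ∧ (a 1 * xa 1 : Q8) = xa 0 ∧ (a 1 * xa 2 : Q8) = xa 1 ∧
      (a 1 * xa 3 : Q8) = xa 2) ∧
    ((xa 0 * a 0 : Q8) = xa 0 ∧ (xa 0 * a 1 : Q8) = xa 1 ∧ (xa 0 * a 2 : Q8) = xa 2 ∧
      (xa 0 * a 3 : Q8) = xa 3) ∧
    ((xa 0 * xa 0 : Q8) = a 2 ∧ (xa 0 * xa 1 : Q8) = a 3 ∧ (xa 0 * xa 2 : Q8) = a 0 ∧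
      (xa 0 * xa 3 : Q8) = a 1) ∧
    ((xa 1 * a 0 : Q8) = xa 1 ∧ (xa 1 * a 1 : Q8) = xa 2 ∧ (xa 1 * a 2 : Q8) = xa 3 ∧
      (xa 1 * a 3 : Q8) = xa 0) ∧
    ((xa 1 * xa 0 : Q8) = a 1 ∧ (xa 1 * xa 1 : Q8) = a 2 ∧ (xa 1 * xa 2 : Q8) = a 3 ∧
      (xa 1 * xa 3 : Q8) = a 0) := by decide

variable (K)

/-- The first differential of the periodic resolution. -/
def diff₁ : (Q8 → K) →ₗ[K] (Q8 → K × K) where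
  toFun f h := (f (a 1 * h) + f h, f (xa 0 * h) + f h)
  map_add' f g := by
    funext h
    ext <;> simp <;> abel
  map_smul' c f := by
    funext h
    ext <;> simp <;> ring

/-- The second differential of the periodic resolution. -/
def diff₂ : (Q8 → K × K) →ₗ[K] (Q8 → K × K) where
  toFun f h := ((f (a 1 * h)).1 + (f h).1 + ((f (xa 0 * h)).2 + (f h).2),
    (f (xa 1 * h)).1 + (f h).1 + ((f (a 1 * h)).2 + (f h).2))
  map_add' f g := by
    funext h
    ext <;> simp <;> abel
  map_smul' c f := by
    funext h
    ext <;> simp <;> ring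

/-- The third differential of the periodic resolution. -/
def diff₃ : (Q8 → K × K) →ₗ[K] (Q8 → K) where
  toFun f h := (f (a 1 * h)).1 + (f h).1 + ((f (xa 1 * h)).2 + (f h).2)
  map_add' f g := by
    funext h
    simp; abel
  map_smul' c f := by
    funext h
    simp; ring

variable {K} [CharP K 2]

/-- With `x = a 1` and `y = xa 0`, the two components express the defining relations `x² = y²` and
`xyx = y`; the second differential consists of their Fox derivatives modulo two. -/
theorem diff₂_diff₁ (f : Q8 → K) : diff₂ K (diff₁ K f) = 0 := by
  have h2 : (2 : K) = 0 := CharTwo.two_eq_zero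
  rw [funext_iff, forall_iff]
  simp only [diff₁, diff₂, LinearMap.coe_mk, AddHom.coe_mk, mul_table, Pi.zero_apply,
    Prod.mk_eq_zero]
  refine ⟨⟨⟨?_, ?_⟩, ⟨?_, ?_⟩, ⟨?_, ?_⟩, ⟨?_, ?_⟩⟩, ⟨?_, ?_⟩, ⟨?_, ?_⟩, ⟨?_, ?_⟩, ⟨?_, ?_⟩⟩ <;>
  grind

theorem diff₃_diff₂ (f : Q8 → K × K) : diff₃ K (diff₂ K f) = 0 := by
  have h2 : (2 : K) = 0 := CharTwo.two_eq_zero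
  rw [funext_iff, forall_iff]
  simp only [diff₃, diff₂, LinearMap.coe_mk, AddHom.coe_mk, mul_table, Pi.zero_apply]
  refine ⟨⟨?_, ?_, ?_, ?_⟩, ?_, ?_, ?_, ?_⟩ <;> grind

theorem exact₁ (f : Q8 → K) (hf : diff₁ K f = 0) (h : Q8) : f h = f (a 0) := by
  have h2 : (2 : K) = 0 := CharTwo.two_eq_zero
  rw [funext_iff, forall_iff] at hf
  simp only [diff₁, LinearMap.coe_mk, AddHom.coe_mk, mul_table, Pi.zero_apply,
    Prod.mk_eq_zero] at hf
  revert h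
  rw [forall_iff]
  refine ⟨⟨?_, ?_, ?_, ?_⟩, ?_, ?_, ?_, ?_⟩ <;> grind

theorem exact₂ (u : Q8 → K × K) (hu : diff₂ K u = 0) : ∃ f, diff₁ K f = u := by
  have h2 : (2 : K) = 0 := CharTwo.two_eq_zero
  rw [funext_iff, forall_iff] at hu
  simp only [diff₂, LinearMap.coe_mk, AddHom.coe_mk, mul_table, Pi.zero_apply,
    Prod.mk_eq_zero] at hu
  -- The preimage is unique up to constants and is normalised to vanish at `a 0`; the remaining
  -- values are solved from `u`.
  refine ⟨ofValues ![0, (u (a 0)).1, (u (xa 2)).2 + (u (a 2)).2, (u (a 3)).1]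
    ![(u (a 0)).2, (u (xa 2)).1 + (u (xa 2)).2, (u (xa 2)).2, (u (a 3)).2 + (u (a 3)).1], ?_⟩
  rw [funext_iff, forall_iff]
  simp only [diff₁, LinearMap.coe_mk, AddHom.coe_mk, mul_table, Prod.ext_iff, ofValues_a0,
    ofValues_a1, ofValues_a2, ofValues_a3, ofValues_xa0, ofValues_xa1, ofValues_xa2, ofValues_xa3,
    Matrix.cons_val]
  refine ⟨⟨⟨?_, ?_⟩, ⟨?_, ?_⟩, ⟨?_, ?_⟩, ⟨?_, ?_⟩⟩, ⟨?_, ?_⟩, ⟨?_, ?_⟩, ⟨?_, ?_⟩, ⟨?_, ?_⟩⟩ <;>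
  grind

theorem exact₃ (u : Q8 → K × K) (hu : diff₃ K u = 0) : ∃ f, diff₂ K f = u := by
  have h2 : (2 : K) = 0 := CharTwo.two_eq_zero
  rw [funext_iff, forall_iff] at hu
  simp only [diff₃, LinearMap.coe_mk, AddHom.coe_mk, mul_table, Pi.zero_apply] at hu
  -- A particular solution of the linear system. Seven coordinates are set to zero, matching the
  -- dimension of the kernel of `diff₂`.
  refine ⟨ofValues
    ![((u (xa 3)).2 + (u (xa 3)).1, (u (xa 2)).1), 0, (0, (u (a 1)).2),
      ((u (a 1)).1 + (u (xa 2)).2, (u (a 2)).2 + (u (a 1)).2)]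
    ![((u (xa 1)).1 + (u (a 2)).2 + (u (a 1)).1 + (u (a 1)).2, (u (xa 1)).2 + (u (a 1)).1),
      (0, (u (a 1)).1), 0, (0, (u (xa 3)).1)], ?_⟩
  rw [funext_iff, forall_iff]
  simp only [diff₂, LinearMap.coe_mk, AddHom.coe_mk, mul_table, Prod.ext_iff, ofValues_a0,
    ofValues_a1, ofValues_a2, ofValues_a3, ofValues_xa0, ofValues_xa1, ofValues_xa2, ofValues_xa3,
    Matrix.cons_val, Prod.fst_zero, Prod.snd_zero]
  refine ⟨⟨⟨?_, ?_⟩, ⟨?_, ?_⟩, ⟨?_, ?_⟩, ⟨?_, ?_⟩⟩, ⟨?_, ?_⟩, ⟨?_, ?_⟩, ⟨?_, ?_⟩, ⟨?_, ?_⟩⟩ <;>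
  grind

theorem exact₄ (f : Q8 → K) (hf : f (a 0) + f (a 1) + f (a 2) + f (a 3) +
    (f (xa 0) + f (xa 1) + f (xa 2) + f (xa 3)) = 0) : ∃ s, diff₃ K s = f := by
  have h2 : (2 : K) = 0 := CharTwo.two_eq_zero
  -- Here nine coordinates are free and set to zero, matching the kernel of `diff₃`.
  refine ⟨ofValues ![0, 0, 0, (0, f (a 3))] ![0, (f (a 0) + f (xa 1), f (a 0)),
    (f (xa 0) + f (xa 3) + f (a 2), f (a 1)), (f (xa 0), f (a 2))], ?_⟩
  rw [funext_iff, forall_iff]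
  simp only [diff₃, LinearMap.coe_mk, AddHom.coe_mk, mul_table, ofValues_a0,
    ofValues_a1, ofValues_a2, ofValues_a3, ofValues_xa0, ofValues_xa1, ofValues_xa2, ofValues_xa3,
    Matrix.cons_val, Prod.fst_zero, Prod.snd_zero]
  refine ⟨⟨?_, ?_, ?_, ?_⟩, ?_, ?_, ?_, ?_⟩ <;> grind

end Quaternion

end FDRep

/-! ### Period four for the quaternion group, and inflation from the four-group. -/

namespace FDRep
open KrullSchmidt StableCat
variable {K : Type u} [Field K]

namespace Quaternion
open QuaternionGroup

theorem sum_eq {V : Type*} [AddCommMonoid V] (f : Q8 → V) : ∑ h, f h =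
    f (a 0) + f (a 1) + f (a 2) + f (a 3) + (f (xa 0) + f (xa 1) + f (xa 2) + f (xa 3)) := by
  have h : (Finset.univ : Finset Q8) = {a 0, a 1, a 2, a 3, xa 0, xa 1, xa 2, xa 3} := by decide
  rw [h]
  repeat rw [Finset.sum_insert (by decide)]
  rw [Finset.sum_singleton]
  simp only [add_assoc]

variable [CharP K 2]

/-- The Heller operator has order dividing four on the stable category of the quaternion group. -/
theorem syz_pow_four : syz (FDRep K Q8) ^ 4 = 1 := by
  let P := regularObj K Q8 K
  let Q := regularObj K Q8 (K × K)
  let i₀ : (𝟙_ (FDRep K Q8)) ⟶ P := homOf (V := 𝟙_ (FDRep K Q8)) (W := P)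
    (LinearMap.pi fun _ => LinearMap.id (R := K) (M := K)) fun g v => rfl
  let d₁ : P ⟶ Q := homOf (V := P) (W := Q) (diff₁ K) fun g (f : Q8 → K) => by
    funext h
    change (f (a 1 * h * g) + f (h * g), f (xa 0 * h * g) + f (h * g)) =
      (f (a 1 * (h * g)) + f (h * g), f (xa 0 * (h * g)) + f (h * g))
    simp only [mul_assoc]
  let d₂ : Q ⟶ Q := homOf (V := Q) (W := Q) (diff₂ K) fun g (f : Q8 → K × K) => by
    funext h
    change ((f (a 1 * h * g)).1 + (f (h * g)).1 + ((f (xa 0 * h * g)).2 + (f (h * g)).2),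
      (f (xa 1 * h * g)).1 + (f (h * g)).1 + ((f (a 1 * h * g)).2 + (f (h * g)).2)) =
      ((f (a 1 * (h * g))).1 + (f (h * g)).1 + ((f (xa 0 * (h * g))).2 + (f (h * g)).2),
      (f (xa 1 * (h * g))).1 + (f (h * g)).1 + ((f (a 1 * (h * g))).2 + (f (h * g)).2))
    simp only [mul_assoc]
  let d₃ : Q ⟶ P := homOf (V := Q) (W := P) (diff₃ K) fun g (f : Q8 → K × K) => by
    funext h
    change (f (a 1 * h * g)).1 + (f (h * g)).1 + ((f (xa 1 * h * g)).2 + (f (h * g)).2) =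
      (f (a 1 * (h * g))).1 + (f (h * g)).1 + ((f (xa 1 * (h * g))).2 + (f (h * g)).2)
    simp only [mul_assoc]
  let s : (Q8 → K) →ₗ[K] K := ∑ h, LinearMap.proj h
  have hs : ∀ f, s f = ∑ h, f h := fun f => by simp [s, LinearMap.sum_apply]
  let p : P ⟶ 𝟙_ (FDRep K Q8) := homOf (V := P) (W := 𝟙_ (FDRep K Q8)) s
    fun g (f : Q8 → K) => by
      change s (fun h => f (h * g)) = s f
      rw [hs, hs]
      exact Fintype.sum_equiv (Equiv.mulRight g) _ _ fun _ => rfl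
  have hP : Projective P := projective_regularObj K
  have hQ : Projective Q := projective_regularObj (K × K)
  have h₁ : IsSyzygy (𝟙_ (FDRep K Q8)) (kernel d₂) := by
    let l : P ⟶ kernel d₂ := kernel.lift d₂ d₁ (lin_ext diff₂_diff₁)
    have hl : ∀ x, lin (kernel.ι d₂) (lin l x) = lin d₁ x := fun x => by
      rw [← lin_comp, kernel.lift_ι]
    refine isSyzygy_of_exact i₀ l hP (fun x y h => congrFun h (a 0)) (fun y => ?_) (fun y => ?_)
      fun x hx => ?_
    · obtain ⟨x, hx⟩ := exact₂ (lin (kernel.ι d₂) y) (by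
        change lin d₂ _ = 0
        rw [← lin_comp, kernel.condition]; rfl)
      exact ⟨x, lin_injective (kernel.ι d₂) ((hl x).trans hx)⟩
    · refine lin_injective (kernel.ι d₂) ?_
      rw [hl, map_zero]
      refine funext fun h => Prod.ext ?_ ?_ <;> exact add_self_of_charTwo (K := K) (V := K) _
    · have h1 : diff₁ K x = 0 := by
        have := hl x
        rw [hx, map_zero] at this
        exact this.symm
      exact ⟨(x : Q8 → K) (a 0), funext fun h => (exact₁ x h1 h).symm⟩
  have h₂ : IsSyzygy (kernel d₂) (kernel d₃) :=
    isSyzygy_kernel_kernel d₂ d₃ hQ diff₃_diff₂ exact₃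
  have h₃ : IsSyzygy (kernel d₃) (kernel p) := by
    refine isSyzygy_kernel_kernel d₃ p hQ (fun f => ?_) fun f hf => exact₄ f ?_
    · change s (diff₃ K f) = 0
      rw [hs, sum_eq]
      simp only [diff₃, LinearMap.coe_mk, AddHom.coe_mk, mul_table]
      have h2 : (2 : K) = 0 := CharTwo.two_eq_zero
      grind
    · rw [← sum_eq, ← hs]
      exact hf
  have hp : Epi p := epi_of_surj p fun (c : K) => by
    classical
    refine ⟨(Pi.single (a 0) c : Q8 → K), ?_⟩
    change s (Pi.single (a 0) c) = c
    rw [hs]; simp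
  have h₄ : IsSyzygy (kernel p) (𝟙_ (FDRep K Q8)) := isSyzygy_kernel p hP
  have h := h₁.sc_eq
  -- Four successive syzygies lead from the trivial module back to itself.
  rw [h₂.sc_eq, h₃.sc_eq, h₄.sc_eq, sc_one, mul_one] at h
  refine Units.ext ?_
  rw [Units.val_one, h, Units.val_pow_eq_pow_val]
  simp only [pow_succ, pow_zero, one_mul, mul_assoc]

theorem isPeriodic (M : FDRep K Q8) : IsPeriodic M :=
  (isPeriodic_iff M).2 ⟨4, by decide, by
    rw [show (4 : ℤ) = (4 : ℕ) from rfl, zpow_natCast, syz_pow_four, Units.val_one, one_mul]⟩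

/-- The projection of the quaternion group onto its quotient by the centre. -/
def toFourGroup : Q8 →* FourGroup where
  toFun
    | a i => (.ofAdd (ZMod.cast i), 1)
    | xa i => (.ofAdd (ZMod.cast i), .ofAdd 1)
  map_one' := by decide
  map_mul' := by decide

theorem toFourGroup_surjective : Function.Surjective toFourGroup := by decide

/-- Every `Q₈`-module is periodic, so one algebraic translate would make the inflated module itself
algebraic, and this would descend to `V₄`. -/
theorem not_isAlgebraicModule_heller_inflate {i : ℤ} (hi : i ≠ 0) (j : ℤ) :
    ¬ IsAlgebraicModule
      (heller (inflate toFourGroup (heller (trivialModule K FourGroup) i)) j) := by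
  intro h
  have h1 := isAlgebraicModule_heller_of_isPeriodic h (isPeriodic _) (-j)
  refine hi ((isAlgebraicModule_heller_fourGroup_iff i).1
    (isAlgebraicModule_of_inflate toFourGroup toFourGroup_surjective
      (isAlgebraicModule_of_sc_eq ?_ h1)))
  rw [sc_heller, sc_heller, ← mul_assoc, ← Units.val_mul, ← zpow_add, neg_add_cancel, zpow_zero,
    Units.val_one, one_mul]

end Quaternion

theorem indecomposable_heller_fourGroup [CharP K 2] (i : ℤ) :
    Indecomposable (heller (trivialModule K FourGroup) i) :=
  (indecomposable_heller indecomposable_unit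
    (not_projective_of_not_isPeriodic not_isPeriodic_fourGroup) i).1

end FDRep

/-! ### Dihedral groups -/

namespace FDRep
open KrullSchmidt StableCat
variable {K : Type u} [Field K]

namespace Dihedral
open DihedralGroup

theorem two_mul_half {m : ℕ} (hm : m ≠ 0) :
    (2 ^ (m - 1) : ZMod (2 ^ m)) + 2 ^ (m - 1) = 0 := by
  obtain ⟨k, rfl⟩ := Nat.exists_eq_succ_of_ne_zero hm
  have h := ZMod.natCast_self (2 ^ (k + 1))
  push_cast at h
  rw [Nat.succ_sub_one, ← two_mul, ← pow_succ', h]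

theorem half_ne_zero {m : ℕ} (hm : m ≠ 0) : (2 ^ (m - 1) : ZMod (2 ^ m)) ≠ 0 := by
  intro h
  have h1 : ((2 ^ (m - 1) : ℕ) : ZMod (2 ^ m)) = 0 := by push_cast; exact h
  rw [ZMod.natCast_eq_zero_iff, Nat.pow_dvd_pow_iff_le_right one_lt_two] at h1
  omega

/-- The four-subgroup generated by the central rotation and a reflection. -/
def ofFourGroup {m : ℕ} (hm : m ≠ 0) : FourGroup →* DihedralGroup (2 ^ m) :=
  fourHom (r (2 ^ (m - 1))) (sr 0)
    (by rw [r_mul_r, two_mul_half hm]; rfl) (by rw [sr_mul_self])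
    (by
      rw [commute_iff_eq, r_mul_sr, sr_mul_r, zero_sub, zero_add, neg_eq_of_add_eq_zero_left]
      exact two_mul_half hm)

theorem ofFourGroup_injective {m : ℕ} (hm : m ≠ 0) : Function.Injective (ofFourGroup hm) := by
  rw [injective_iff_map_eq_one]
  intro g hg
  have h : ∀ g : FourGroup, g = 1 ∨ g = (.ofAdd 1, 1) ∨ g = (1, .ofAdd 1) ∨
    g = (.ofAdd 1, .ofAdd 1) := by decide
  rcases h g with rfl | rfl | rfl | rfl
  · rfl
  · have : r (2 ^ (m - 1)) ^ 1 * sr 0 ^ 0 = (1 : DihedralGroup (2 ^ m)) := hg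
    rw [pow_one, pow_zero, mul_one, one_def] at this
    exact absurd (r.inj this) (half_ne_zero hm)
  · have : r (2 ^ (m - 1)) ^ 0 * sr 0 ^ 1 = (1 : DihedralGroup (2 ^ m)) := hg
    rw [pow_one, pow_zero, one_mul, one_def] at this
    exact absurd this nofun
  · have : r (2 ^ (m - 1)) ^ 1 * sr 0 ^ 1 = (1 : DihedralGroup (2 ^ m)) := hg
    rw [pow_one, pow_one, r_mul_sr, one_def] at this
    exact absurd this nofun

/-- The abelianization of a dihedral 2-group. -/
def toFourGroup {m : ℕ} (hm : m ≠ 0) : DihedralGroup (2 ^ m) →* FourGroup where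
  toFun
    | r i => (.ofAdd (ZMod.castHom (dvd_pow_self 2 hm) (ZMod 2) i), 1)
    | sr i => (.ofAdd (ZMod.castHom (dvd_pow_self 2 hm) (ZMod 2) i), .ofAdd 1)
  map_one' := by
    rw [one_def]
    change (Multiplicative.ofAdd (ZMod.castHom (dvd_pow_self 2 hm) (ZMod 2) 0), _) = _
    rw [map_zero]; rfl
  map_mul' := by
    have h1 : ∀ x y : ZMod 2, y - x = x + y := by decide
    have h2 : (Multiplicative.ofAdd (1 : ZMod 2)) * .ofAdd 1 = 1 := by decide
    rintro (i | i) (j | j)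
    · simp only [r_mul_r, map_add]; rfl
    · simp only [r_mul_sr, map_sub, h1]; rfl
    · simp only [sr_mul_r, map_add]; rfl
    · simp only [sr_mul_sr, map_sub, h1]
      exact Prod.ext rfl h2.symm

theorem toFourGroup_surjective {m : ℕ} (hm : m ≠ 0) : Function.Surjective (toFourGroup hm) := by
  rintro ⟨x, y⟩
  obtain ⟨i, hi⟩ := ZMod.castHom_surjective (dvd_pow_self 2 hm) x.toAdd
  have h : ∀ y : Multiplicative (ZMod 2), y = 1 ∨ y = .ofAdd 1 := by decide
  rcases h y with rfl | rfl
  · exact ⟨r i, Prod.ext (congrArg Multiplicative.ofAdd hi) rfl⟩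
  · exact ⟨sr i, Prod.ext (congrArg Multiplicative.ofAdd hi) rfl⟩

/-- For `m ≥ 2` the central rotation is an even power of the generator, so it dies in the
abelianization. -/
theorem toFourGroup_ofFourGroup {m : ℕ} (hm : 2 ≤ m) (hm' : m ≠ 0) (g : FourGroup) :
    toFourGroup hm' (ofFourGroup hm' g) = (1, g.2) := by
  have h1 : toFourGroup hm' (r (2 ^ (m - 1))) = 1 := by
    refine Prod.ext (congrArg Multiplicative.ofAdd (?_ : _ = (0 : ZMod 2))) rfl
    rw [map_pow, map_ofNat]
    exact zero_pow (by omega)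
  have h2 : toFourGroup hm' (sr 0) = (1, .ofAdd 1) :=
    Prod.ext (congrArg Multiplicative.ofAdd (map_zero _)) rfl
  change toFourGroup hm' (r (2 ^ (m - 1)) ^ _ * sr 0 ^ _) = _
  rw [map_mul, map_pow, map_pow, h1, h2, one_pow, one_mul]
  have h : ∀ g : FourGroup, ((1, .ofAdd 1) : FourGroup) ^ g.2.toAdd.val = (1, g.2) := by decide
  exact h g

variable [CharP K 2]

variable (K) in
/-- The inflation of `Ω⁻¹(K)` from the four-group to a dihedral group. -/
noncomputable abbrev inflatedString {m : ℕ} (hm : m ≠ 0) : FDRep K (DihedralGroup (2 ^ m)) :=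
  inflate (toFourGroup hm) (heller (trivialModule K FourGroup) (-1))

/-- The trivial module is a direct summand of the restriction of the inflated string module. -/
theorem nonempty_retract {m : ℕ} (hm : 2 ≤ m) (hm' : m ≠ 0) :
    Nonempty (Retract (trivialModule K FourGroup)
      (inflate (ofFourGroup hm') (inflatedString K hm'))) := by
  obtain ⟨e⟩ := nonempty_heller_iso_fourString (K := K)
  let F := Action.res (FGModuleCat K) (toFourGroup hm') ⋙
    Action.res (FGModuleCat K) (ofFourGroup hm')
  let X : FDRep K FourGroup := F.obj (fourString K 1)
  suffices h : Nonempty (Retract (𝟙_ (FDRep K FourGroup)) X) from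
    ⟨h.some.trans (Retract.ofIso (F.mapIso e.symm))⟩
  have hρ : ∀ (g : FourGroup) (v : (Fin 1 → K) × (Fin 2 → K)), X.ρ g v = v ∨
      X.ρ g v = shear K (consZero K 1) v := by
    intro g v
    have h1 : X.ρ g v = (fourString K 1).ρ (1, g.2) v := by
      rw [← toFourGroup_ofFourGroup hm hm' g]; rfl
    have h : ∀ y : Multiplicative (ZMod 2), y = 1 ∨ y = .ofAdd 1 := by decide
    have h2 := fourRep_values (hA := shear_mul_self K _) (hB := shear_mul_self K _)
      (hAB := shear_commute K (snocZero K 1) (consZero K 1)) v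
    rcases h g.2 with hg | hg
    · rw [hg] at h1
      exact Or.inl (h1.trans h2.1)
    · rw [hg] at h1
      exact Or.inr (h1.trans h2.2.1)
  -- Only `1 + b` acts on the restriction, moving the top vector to the second bottom vector. The
  -- line of the first bottom vector therefore splits off.
  let i : K →ₗ[K] (Fin 1 → K) × (Fin 2 → K) :=
    LinearMap.inr K _ _ ∘ₗ LinearMap.single K (fun _ => K) 0
  let q : (Fin 1 → K) × (Fin 2 → K) →ₗ[K] K := LinearMap.proj 0 ∘ₗ LinearMap.snd K _ _
  refine ⟨⟨homOf (V := 𝟙_ _) (W := X) i fun g c => ?_,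
    homOf (V := X) (W := 𝟙_ _) q fun g v => ?_, lin_ext fun c => ?_⟩⟩
  · change i c = _
    rcases hρ g (i c) with h | h
    · exact h.symm
    · refine Eq.trans ?_ h.symm
      simp [i, shear]
  · change q _ = q v
    rcases hρ g v with h | h
    · exact congrArg q h
    · refine (congrArg q h).trans ?_
      simp [q, shear]
      rfl
  · change q (i c) = c
    simp [q, i]

theorem indecomposable_inflatedString {m : ℕ} (hm : m ≠ 0) :
    Indecomposable (inflatedString K hm) :=
  indecomposable_inflate _ (toFourGroup_surjective hm) (indecomposable_heller_fourGroup _)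

/-- Periodicity passes to restrictions and summands, and would reach the trivial module of the
four-subgroup. -/
theorem not_isPeriodic_inflatedString {m : ℕ} (hm : 2 ≤ m) (hm' : m ≠ 0) :
    ¬ IsPeriodic (inflatedString K hm') := fun h =>
  not_isPeriodic_fourGroup ((h.res _ (ofFourGroup_injective hm')).retract
    (nonempty_retract hm hm').some)

theorem not_isPeriodic_unit {m : ℕ} (hm : m ≠ 0) :
    ¬ IsPeriodic (𝟙_ (FDRep K (DihedralGroup (2 ^ m)))) := fun h =>
  not_isPeriodic_fourGroup (h.res _ (ofFourGroup_injective hm))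

/-- Restricted to the four-subgroup, the `j`-th translate stably contains `Ω^j(K)` as a summand, so
algebraicity forces `j = 0`. The case `j = 0` fails too, because the module is inflated from the
non-algebraic `Ω⁻¹(K)`. -/
theorem not_isAlgebraicModule_heller_inflatedString {m : ℕ} (hm : 2 ≤ m) (hm' : m ≠ 0) (j : ℤ) :
    ¬ IsAlgebraicModule (heller (inflatedString K hm') j) := by
  intro h
  obtain ⟨r⟩ := nonempty_retract (K := K) hm hm'
  have h1 : sc (FDRep.inflate (ofFourGroup hm') (heller (inflatedString K hm') j)) =
      sc (heller (trivialModule K FourGroup) j ⊗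
        FDRep.inflate (ofFourGroup hm') (inflatedString K hm')) := by
    rw [sc_inflate_heller _ (ofFourGroup_injective hm'), sc_tensor, sc_heller, sc_one, mul_one]
  have h2 := ((isAlgebraicModule_of_sc_eq h1 (h.inflate _)).retract (tensorRetract _ r)).iso
    (ρ_ (heller (trivialModule K FourGroup) j))
  obtain rfl := (isAlgebraicModule_heller_fourGroup_iff j).1 h2
  have h3 := isAlgebraicModule_of_inflate _ (toFourGroup_surjective hm')
    (isAlgebraicModule_heller_zero_iff.1 h)
  have := (isAlgebraicModule_heller_fourGroup_iff _).1 h3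
  omega

end Dihedral

end FDRep

theorem theoremB :
    -- the general statement, for a finite-dimensional module `M` of a finite group `G`
    (∀ (K : Type u) [Field K] (G : Type v) [Group G] [Finite G] (M : FDRep K G),
      (FDRep.IsAlgebraicModule M → FDRep.IsPeriodic M →
        ∀ i : ℤ, FDRep.IsAlgebraicModule (FDRep.heller M i)) ∧
      (¬ FDRep.IsPeriodic M →
        (∀ i j : ℤ, FDRep.IsAlgebraicModule (FDRep.heller M i) →
          FDRep.IsAlgebraicModule (FDRep.heller M j) → i = j) ∧
        (FDRep.IsAlgebraicModule M →
          ∀ i : ℤ, FDRep.IsAlgebraicModule (FDRep.heller M i) ↔ i = 0) ∧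
        (FDRep.IsSelfDual M → ∀ i : ℤ, FDRep.IsAlgebraicModule (FDRep.heller M i) →
          i = 0 ∧ FDRep.IsAlgebraicModule M))) ∧
    -- all possibilities occur
    (∀ (K : Type u) [Field K] [CharP K 2],
      -- quaternion group: periodic, all translates algebraic
      (FDRep.IsPeriodic (FDRep.trivialModule K (QuaternionGroup 2)) ∧
        ∀ i : ℤ, FDRep.IsAlgebraicModule
          (FDRep.heller (FDRep.trivialModule K (QuaternionGroup 2)) i)) ∧
      -- four-group: non-periodic, exactly one translate algebraic
      (¬ FDRep.IsPeriodic
          (FDRep.trivialModule K FDRep.FourGroup) ∧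
        ∀ i : ℤ, FDRep.IsAlgebraicModule (FDRep.heller
          (FDRep.trivialModule K FDRep.FourGroup) i) ↔
            i = 0) ∧
      -- quaternion group: periodic, no translate algebraic
      (∃ π : QuaternionGroup 2 →* FDRep.FourGroup,
        Function.Surjective π ∧
        ∀ i : ℤ, i ≠ 0 →
          Indecomposable
            (FDRep.inflate π (FDRep.heller (FDRep.trivialModule K FDRep.FourGroup) i)) ∧
          FDRep.IsPeriodic
            (FDRep.inflate π (FDRep.heller (FDRep.trivialModule K FDRep.FourGroup) i)) ∧
          ∀ j : ℤ, ¬ FDRep.IsAlgebraicModule (FDRep.heller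
            (FDRep.inflate π (FDRep.heller (FDRep.trivialModule K FDRep.FourGroup) i)) j)) ∧
      -- dihedral groups of order `2 ^ (m + 1) ≥ 8`
      (∀ m : ℕ, 2 ≤ m →
        -- non-periodic, no translate algebraic
        (∃ M : FDRep K (DihedralGroup (2 ^ m)), Indecomposable M ∧ ¬ FDRep.IsPeriodic M ∧
          ∀ i : ℤ, ¬ FDRep.IsAlgebraicModule (FDRep.heller M i)) ∧
        -- non-periodic, self-dual and algebraic
        (∃ M : FDRep K (DihedralGroup (2 ^ m)), Indecomposable M ∧ ¬ FDRep.IsPeriodic M ∧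
          FDRep.IsSelfDual M ∧ FDRep.IsAlgebraicModule M))) := by
  refine ⟨fun K _ G _ _ M => ⟨FDRep.isAlgebraicModule_heller_of_isPeriodic, fun hM =>
    ⟨fun i j => FDRep.heller_unique hM, FDRep.isAlgebraicModule_heller_iff hM, fun hd i =>
      FDRep.eq_zero_of_isSelfDual hM hd⟩⟩, fun K _ _ => ⟨⟨FDRep.Quaternion.isPeriodic _,
    FDRep.isAlgebraicModule_heller_of_isPeriodic FDRep.isAlgebraicModule_unit
      (FDRep.Quaternion.isPeriodic _)⟩,
    ⟨FDRep.not_isPeriodic_fourGroup, FDRep.isAlgebraicModule_heller_fourGroup_iff⟩,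
    ⟨FDRep.Quaternion.toFourGroup, FDRep.Quaternion.toFourGroup_surjective, fun i hi =>
      ⟨FDRep.indecomposable_inflate _ FDRep.Quaternion.toFourGroup_surjective
        (FDRep.indecomposable_heller_fourGroup i), FDRep.Quaternion.isPeriodic _,
        FDRep.Quaternion.not_isAlgebraicModule_heller_inflate hi⟩⟩, fun m hm => ?_⟩⟩
  have hm' : m ≠ 0 := by omega
  exact ⟨⟨FDRep.Dihedral.inflatedString K hm', FDRep.Dihedral.indecomposable_inflatedString hm',
      FDRep.Dihedral.not_isPeriodic_inflatedString hm hm',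
      FDRep.Dihedral.not_isAlgebraicModule_heller_inflatedString hm hm'⟩,
    ⟨𝟙_ _, FDRep.indecomposable_unit, FDRep.Dihedral.not_isPeriodic_unit hm',
      FDRep.dual_unit, FDRep.isAlgebraicModule_unit⟩⟩
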